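/- **Theorem 1.1.** $\mathsf{APSP}$ and $\mathsf{CoDiameter}$ are subcubic equivalent, that is, there is a subcubic reduction from $\mathsf{APSP}$ to $\mathsf{CoDiameter}$ and a subcubic reduction from $\mathsf{CoDiameter}$ to $\mathsf{APSP}$. Here graphs are directed graphs on $n$ vertices with integer edge weights in $[-M,M]$, where $M$ is polynomially bounded in $n$. The distance $d(u,v)$ is the infimum of the weights of the walks from $u$ to $v$, and it is $\infty$ if $v$ is not reachable from $u$. * $\mathsf{APSP}$: given a graph without negative cycles, output the $n\times n$ matrix of all distances $d(u,v)$. * $\mathsf{CoDiameter}$: given a graph with non-negative edge weights, output a vertex $u$ that is not an endpoint of a diameter (i.e. no vertex $v$ satisfies $d(u,v)=\max_{x,y} d(x,y)$), or report that there is no such vertex. A function $T(n,M)$ is *truly subcubic* if for every constant $c$ there is $\varepsilon>0$ with $T(n,M)=O(n^{3-\varepsilon})$ for all $M\le n^{c}$ (the constants in this and the following bounds may depend on $c$; for $n\le 1$ read $n+2$ for $n$ in the bounds on the weights and words, and $n+1$ for $n$ in the bounds on the time). A *subcubic reduction* from $A$ to $B$ is a program $P$ for a random access machine with words of $O(\log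 n)$ bits and unit-cost basic operations, using $B$ as a black box, such that $P$ solves $A$ correctly with every black box that answers all instances of $B$ correctly, and such that for every truly subcubic $T$ and every constant $c$ there is $\delta>0$ for which the following holds: if each call of the black box on an instance with $m$ vertices and largest absolute weight $M'$ is charged time $T(m,M')$, then $P$ takes total time $O(n^{3-\delta})$ on all instances of $A$ with $n$ vertices and weights at most $n^{c}$ in absolute value. -/

import Mathlib

namespace FineGrained

/-! ### Weighted directed graphs and distances -/

/-- A weighted directed graph on `n` vertices with integer edge weights; the weight `⊤` (infinity)
of a pair means that the pair is not an edge. -/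
structure WDigraph where
  n : ℕ
  w : Fin n → Fin n → WithTop ℤ

namespace WDigraph

/-- `G.HasWalk u v c`: there is a directed walk from `u` to `v` of total weight `c`. -/
inductive HasWalk (G : WDigraph) : Fin G.n → Fin G.n → ℤ → Prop
  | nil (u : Fin G.n) : HasWalk G u u 0
  | cons {u x v : Fin G.n} {a c : ℤ} :
      G.w u x = (a : WithTop ℤ) → HasWalk G x v c → HasWalk G u v (a + c)

/-- `d` is the distance from `u` to `v`: the infimum of the weights of the walks from `u` to `v`
(`⊤` if there is no walk). -/
def IsDist (G : WDigraph) (u v : Fin G.n) (d : WithTop ℤ) : Prop :=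
  IsGLB {z : WithTop ℤ | ∃ c : ℤ, G.HasWalk u v c ∧ z = (c : WithTop ℤ)} d

/-- Every closed walk has nonnegative weight. -/
def NoNegCycle (G : WDigraph) : Prop :=
  ∀ (u : Fin G.n) (c : ℤ), G.HasWalk u u c → 0 ≤ c

/-- All edge weights are nonnegative. -/
def NonnegWeights (G : WDigraph) : Prop :=
  ∀ u v : Fin G.n, 0 ≤ G.w u v

/-- The largest absolute value of an edge weight (`0` if there are no edges). -/
def maxWeight (G : WDigraph) : ℕ :=
  Finset.univ.sup fun p : Fin G.n × Fin G.n => ((G.w p.1 p.2).untopD 0).natAbs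

/-- `d` is the diameter: the longest distance between two vertices. -/
def IsDiameter (G : WDigraph) (d : WithTop ℤ) : Prop :=
  IsGreatest {z : WithTop ℤ | ∃ x y : Fin G.n, G.IsDist x y z} d

/-- `u` is an endpoint of a diameter: some vertex has distance from `u` equal to the diameter. -/
def IsDiameterVertex (G : WDigraph) (u : Fin G.n) : Prop :=
  ∃ (v : Fin G.n) (d : WithTop ℤ), G.IsDist u v d ∧ G.IsDiameter d

end WDigraph

/-! ### Computational problems

Inputs and outputs are laid out in arrays of integers. -/

/-- A computational problem, whose instances carry two parameters: a size (number of vertices) and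
a bound on the weights. -/
structure Problem where
  Inst : Type
  size : Inst → ℕ
  weight : Inst → ℕ
  /-- the array holds (the encoding of) the instance -/
  Input : Inst → (ℤ → ℤ) → Prop
  /-- the array holds (the encoding of) a correct answer for the instance -/
  Output : Inst → (ℤ → ℤ) → Prop

/-- The array `a` holds, from cell `b` on, the `n × n` matrix `D` in row-major order. An entry takes
two cells: `0, 0` for `⊤` and `1, z` for the integer `z`. -/
def HoldsMatrix (a : ℤ → ℤ) (b : ℤ) {n : ℕ} (D : Fin n → Fin n → WithTop ℤ) : Prop :=
  ∀ i j : Fin n,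
    a (b + 2 * ((i : ℤ) * (n : ℤ) + (j : ℤ))) = (if D i j = ⊤ then 0 else 1) ∧
    a (b + 2 * ((i : ℤ) * (n : ℤ) + (j : ℤ)) + 1) = (D i j).untopD 0

/-- The array `a` holds the graph `G`: the number of vertices, then the matrix of weights. -/
def HoldsGraph (a : ℤ → ℤ) (G : WDigraph) : Prop :=
  a 0 = (G.n : ℤ) ∧ HoldsMatrix a 1 G.w

/-- All-pairs shortest paths: given a graph without negative cycles, output the matrix of all
distances. -/
def APSP : Problem where
  Inst := {G : WDigraph // G.NoNegCycle}
  size G := G.1.n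
  weight G := G.1.maxWeight
  Input G a := HoldsGraph a G.1
  Output G a := ∃ D : Fin G.1.n → Fin G.1.n → WithTop ℤ,
    (∀ u v, G.1.IsDist u v (D u v)) ∧ HoldsMatrix a 0 D

/-- CoDiameter: given a graph with nonnegative weights, output (the index of) a vertex that is not
an endpoint of a diameter, or `-1` if every vertex is an endpoint of a diameter. -/
def CoDiameter : Problem where
  Inst := {G : WDigraph // G.NonnegWeights}
  size G := G.1.n
  weight G := G.1.maxWeight
  Input G a := HoldsGraph a G.1
  Output G a :=
    (∃ u : Fin G.1.n, a 0 = ((u : ℕ) : ℤ) ∧ ¬ G.1.IsDiameterVertex u) ∨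
    (a 0 = -1 ∧ ∀ u : Fin G.1.n, G.1.IsDiameterVertex u)

/-! ### The machine model

Programs for a random access machine with oracle calls. The memory consists of registers and of
arrays of cells, all holding integers (a program mentions only finitely many registers and arrays).
Every basic operation costs one step, and all integers that a program handles have to fit into a
machine word. -/

/-- The memory. -/
structure State where
  reg : ℕ → ℤ
  arr : ℕ → ℤ → ℤ

namespace State

def setReg (s : State) (x : ℕ) (v : ℤ) : State :=
  { s with reg := Function.update s.reg x v }

def setCell (s : State) (r : ℕ) (i v : ℤ) : State :=
  { s with arr := Function.update s.arr r (Function.update (s.arr r) i v) }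

def setArr (s : State) (r : ℕ) (a : ℤ → ℤ) : State :=
  { s with arr := Function.update s.arr r a }

/-- The initial memory: the input is in array `0`, everything else is zero. -/
def start (a : ℤ → ℤ) : State where
  reg := fun _ => 0
  arr := Function.update (fun _ _ => 0) 0 a

end State

/-- The basic binary operations: arithmetic (with integer division) and comparison. -/
inductive BinOp
  | add | sub | mul | div | lt

def BinOp.eval : BinOp → ℤ → ℤ → ℤ
  | .add, x, y => x + y
  | .sub, x, y => x - y
  | .mul, x, y => x * y
  | .div, x, y => x / y
  | .lt, x, y => if x < y then 1 else 0

/-- Expressions: constants, registers, array cells, and basic operations. -/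
inductive Expr
  | const (c : ℤ)
  | reg (x : ℕ)
  | cell (r : ℕ) (e : Expr)
  | bin (o : BinOp) (e f : Expr)

namespace Expr

def eval (s : State) : Expr → ℤ
  | const c => c
  | reg x => s.reg x
  | cell r e => s.arr r (e.eval s)
  | bin o e f => o.eval (e.eval s) (f.eval s)

/-- The number of basic operations needed for evaluating the expression. -/
def cost : Expr → ℕ
  | const _ => 1
  | reg _ => 1
  | cell _ e => e.cost + 1
  | bin _ e f => e.cost + f.cost + 1

/-- All values that occur in the evaluation have absolute value at most `W`. -/
def Fits (W : ℕ) (s : State) : Expr → Prop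
  | const c => c.natAbs ≤ W
  | reg x => (s.reg x).natAbs ≤ W
  | cell r e => e.Fits W s ∧ ((cell r e).eval s).natAbs ≤ W
  | bin o e f => e.Fits W s ∧ f.Fits W s ∧ ((bin o e f).eval s).natAbs ≤ W

end Expr

/-- Programs. A condition holds if its value is not `0`; `call q r` submits the content of array `q`
to the oracle, whose answer overwrites array `r`. -/
inductive Prog
  | skip
  | assign (x : ℕ) (e : Expr)
  | store (r : ℕ) (i e : Expr)
  | seq (p q : Prog)
  | ite (e : Expr) (p q : Prog)
  | loop (e : Expr) (p : Prog)
  | call (q r : ℕ)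

/-- An oracle for `B` returns a fixed correct answer to each instance of `B`. -/
def IsOracle (B : Problem) (O : B.Inst → ℤ → ℤ) : Prop :=
  ∀ x : B.Inst, B.Output x (O x)

/-- `Exec B O T W p s s' t`: with oracle `O` for `B` and words bounded by `W`, the program `p` started
in memory `s` halts in memory `s'`, never exceeding the word size, after total time `t`, where an
oracle call on an instance of size `m` and weight `M` is charged `T m M` (plus one step for the call
itself). Only instances of `B` may be submitted to the oracle. -/
inductive Exec (B : Problem) (O : B.Inst → ℤ → ℤ) (T : ℕ → ℕ → ℕ) (W : ℕ) :
    Prog → State → State → ℕ → Prop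
  | skip (s : State) : Exec B O T W .skip s s 1
  | assign {s : State} {x : ℕ} {e : Expr} :
      e.Fits W s → Exec B O T W (.assign x e) s (s.setReg x (e.eval s)) (e.cost + 1)
  | store {s : State} {r : ℕ} {i e : Expr} :
      i.Fits W s → e.Fits W s →
      Exec B O T W (.store r i e) s (s.setCell r (i.eval s) (e.eval s)) (i.cost + e.cost + 1)
  | seq {p q : Prog} {s₁ s₂ s₃ : State} {t₁ t₂ : ℕ} :
      Exec B O T W p s₁ s₂ t₁ → Exec B O T W q s₂ s₃ t₂ →
      Exec B O T W (.seq p q) s₁ s₃ (t₁ + t₂)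
  | ite_true {e : Expr} {p q : Prog} {s s' : State} {t : ℕ} :
      e.Fits W s → e.eval s ≠ 0 → Exec B O T W p s s' t →
      Exec B O T W (.ite e p q) s s' (e.cost + 1 + t)
  | ite_false {e : Expr} {p q : Prog} {s s' : State} {t : ℕ} :
      e.Fits W s → e.eval s = 0 → Exec B O T W q s s' t →
      Exec B O T W (.ite e p q) s s' (e.cost + 1 + t)
  | loop_done {e : Expr} {p : Prog} {s : State} :
      e.Fits W s → e.eval s = 0 → Exec B O T W (.loop e p) s s (e.cost + 1)
  | loop_step {e : Expr} {p : Prog} {s₁ s₂ s₃ : State} {t₁ t₂ : ℕ} :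
      e.Fits W s₁ → e.eval s₁ ≠ 0 → Exec B O T W p s₁ s₂ t₁ →
      Exec B O T W (.loop e p) s₂ s₃ t₂ →
      Exec B O T W (.loop e p) s₁ s₃ (e.cost + 1 + t₁ + t₂)
  | call {q r : ℕ} {s : State} (x : B.Inst) :
      B.Input x (s.arr q) →
      Exec B O T W (.call q r) s (s.setArr r (O x)) (1 + T (B.size x) (B.weight x))

/-! ### Subcubic reductions -/

/-- The time bound `T n M` (for size `n` and weight `M`) is truly subcubic: whenever the weights are
polynomially bounded, it is `O(n ^ (3 - ε))` for some `ε > 0`. (Writing `n + 2` and `n + 1` only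
matters for `n ≤ 1`.) -/
def TrulySubcubic (T : ℕ → ℕ → ℕ) : Prop :=
  ∀ c : ℕ, ∃ ε : ℝ, 0 < ε ∧ ∃ C : ℝ, ∀ n M : ℕ, M ≤ (n + 2) ^ c →
    (T n M : ℝ) ≤ C * ((n : ℝ) + 1) ^ (3 - ε)

/-- A subcubic reduction from `A` to `B`: one oracle program that solves `A` with any oracle for `B`,
such that if the oracle answers in some truly subcubic time `T`, then the program solves `A`, for
polynomially bounded weights, in total time `O(n ^ (3 - δ))` for some `δ > 0`, on words of
`O(log n)` bits (absolute values at most `(n + 2) ^ b`). -/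
def SubcubicReducible (A B : Problem) : Prop :=
  ∃ P : Prog, ∀ c : ℕ, ∃ b : ℕ, ∀ T : ℕ → ℕ → ℕ, TrulySubcubic T →
    ∃ δ : ℝ, 0 < δ ∧ ∃ C : ℝ, ∀ O : B.Inst → ℤ → ℤ, IsOracle B O →
      ∀ x : A.Inst, A.weight x ≤ (A.size x + 2) ^ c →
        ∀ a : ℤ → ℤ, A.Input x a →
          ∃ (s : State) (t : ℕ),
            Exec B O T ((A.size x + 2) ^ b) P (State.start a) s t ∧
            A.Output x (s.arr 1) ∧
            (t : ℝ) ≤ C * ((A.size x : ℝ) + 1) ^ (3 - δ)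

/-- Subcubic equivalence: subcubic reductions in both directions. -/
def SubcubicEquivalent (A B : Problem) : Prop :=
  SubcubicReducible A B ∧ SubcubicReducible B A

end FineGrained

namespace FineGrained

/-! ### Notation for expressions -/

namespace Expr

/-! Reducing CoDiameter to APSP takes one call: in O(n²) further steps one finds the largest
distance and a row that misses it. Infinite distances are replaced by one plus the sum of all finite
ones, which does not change the set of endpoints of diameters (`WDigraph.isDiameterVertex_iff`).

For the converse, give the weight matrix a zero diagonal and a large entry H for every missing edge.
If `2 ^ e ≥ n`, the cheapest walks with exactly `2 ^ e` steps have the distances as weights, and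
infinite distances show up as large values (`WDigraph.isDist_of_isMinWalk`). Hence `e = O(log n)`
squarings with respect to minimum and addition suffice.

The square C of A is found by a binary search for all entries at once. A matrix D with `C < D` is
maintained. In the phase with step h, an entry is lowered by h as long as `A i k + A k j < D i j -
h` for some k, a negative triangle. When none is left, `D ≤ C + h`, and h is halved. After the phase
with `h = 1`, C is `D - 1` (`squareProg_wp`).

Negative triangles are sought in blocks. The indices are padded to σ³ of them, between n and 8n, and
cut into σ² intervals of length σ, so there are σ⁶ blocks of three intervals. A graph with `4 * σ +
1` vertices encodes a block so that the vertices that are not endpoints of a diameter are exactly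
the rows of the block that lie in a negative triangle (`triangleGraph_not_isDiameterVertex`). One
call thus yields such a row, where O(σ²) steps find an entry to lower, or shows that the block is
finished.

A successful search lowers the sum of D by at least h, and D is at most `C + 2 * h` when the phase
begins, so a phase has at most 2σ⁶ successful and σ⁶ unsuccessful searches. Each takes time O(σ ^ (3
- ε)), which makes O(n ^ (3 - ε / 3)) per phase. The logarithmic numbers of phases and squarings
cost another n ^ (ε / 6) (`apsp_time_le`).

All programs are verified with the predicate `WP`: it asserts termination, tracks the running time
and the registers and arrays that change, and keeps the memory below a bound B whose 40th power fits
into a word. -/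

instance : Add Expr := ⟨Expr.bin .add⟩
instance : Sub Expr := ⟨Expr.bin .sub⟩
instance : Mul Expr := ⟨Expr.bin .mul⟩
instance : Div Expr := ⟨Expr.bin .div⟩
instance (k : ℕ) : OfNat Expr k := ⟨Expr.const k⟩

/-- The comparison of two expressions. -/
abbrev lt (e f : Expr) : Expr := .bin .lt e f

/-- A degree such that the values in the evaluation are at most the leaves to this power. -/
def deg : Expr → ℕ
  | const _ => 1
  | reg _ => 1
  | cell _ e => e.deg
  | bin _ e f => e.deg + f.deg

/-- Constants are small, and the cells that are read from the arrays `0` and `3`, which hold input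
and oracle answers, are bounded by `B`. -/
def Safe (B : ℕ) (s : State) : Expr → Prop
  | const c => |c| ≤ 8
  | reg _ => True
  | cell r e => e.Safe B s ∧ (r = 0 ∨ r = 3 →
      -(B : ℤ) ≤ s.arr r (e.eval s) ∧ s.arr r (e.eval s) ≤ B)
  | bin _ e f => e.Safe B s ∧ f.Safe B s

@[simp] theorem eval_ofNat (s : State) (k : ℕ) : (no_index (OfNat.ofNat k) : Expr).eval s = (k : ℤ) := rfl
@[simp] theorem eval_const (s : State) (c : ℤ) : (const c).eval s = c := rfl
@[simp] theorem eval_reg (s : State) (x : ℕ) : (reg x).eval s = s.reg x := rfl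
@[simp] theorem eval_cell (s : State) (r : ℕ) (e : Expr) :
    (cell r e).eval s = s.arr r (e.eval s) := rfl
@[simp] theorem eval_add (s : State) (e f : Expr) : (e + f).eval s = e.eval s + f.eval s := rfl
@[simp] theorem eval_sub (s : State) (e f : Expr) : (e - f).eval s = e.eval s - f.eval s := rfl
@[simp] theorem eval_mul (s : State) (e f : Expr) : (e * f).eval s = e.eval s * f.eval s := rfl
@[simp] theorem eval_div (s : State) (e f : Expr) : (e / f).eval s = e.eval s / f.eval s := rfl
@[simp] theorem eval_lt (s : State) (e f : Expr) :
    (bin .lt e f).eval s = if e.eval s < f.eval s then 1 else 0 := rfl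

@[simp] theorem cost_ofNat (k : ℕ) : (no_index (OfNat.ofNat k) : Expr).cost = 1 := rfl
@[simp] theorem cost_const (c : ℤ) : (const c).cost = 1 := rfl
@[simp] theorem cost_reg (x : ℕ) : (reg x).cost = 1 := rfl
@[simp] theorem cost_cell (r : ℕ) (e : Expr) : (cell r e).cost = e.cost + 1 := rfl
@[simp] theorem cost_add (e f : Expr) : (e + f).cost = e.cost + f.cost + 1 := rfl
@[simp] theorem cost_sub (e f : Expr) : (e - f).cost = e.cost + f.cost + 1 := rfl
@[simp] theorem cost_mul (e f : Expr) : (e * f).cost = e.cost + f.cost + 1 := rfl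
@[simp] theorem cost_div (e f : Expr) : (e / f).cost = e.cost + f.cost + 1 := rfl
@[simp] theorem cost_bin (o : BinOp) (e f : Expr) :
    (bin o e f).cost = e.cost + f.cost + 1 := rfl

@[simp] theorem safe_ofNat (B : ℕ) (s : State) (k : ℕ) :
    (no_index (OfNat.ofNat k) : Expr).Safe B s ↔ k ≤ 8 := by
  change |(k : ℤ)| ≤ 8 ↔ _
  rw [abs_of_nonneg (by positivity)]; omega
@[simp] theorem safe_const (B : ℕ) (s : State) (c : ℤ) : (const c).Safe B s ↔ |c| ≤ 8 := Iff.rfl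
@[simp] theorem safe_reg (B : ℕ) (s : State) (x : ℕ) : (reg x).Safe B s := trivial
@[simp] theorem safe_cell (B : ℕ) (s : State) (r : ℕ) (e : Expr) :
    (cell r e).Safe B s ↔ e.Safe B s ∧ (r = 0 ∨ r = 3 →
      -(B : ℤ) ≤ s.arr r (e.eval s) ∧ s.arr r (e.eval s) ≤ B) := Iff.rfl
@[simp] theorem safe_add (B : ℕ) (s : State) (e f : Expr) :
    (e + f).Safe B s ↔ e.Safe B s ∧ f.Safe B s := Iff.rfl
@[simp] theorem safe_sub (B : ℕ) (s : State) (e f : Expr) :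
    (e - f).Safe B s ↔ e.Safe B s ∧ f.Safe B s := Iff.rfl
@[simp] theorem safe_mul (B : ℕ) (s : State) (e f : Expr) :
    (e * f).Safe B s ↔ e.Safe B s ∧ f.Safe B s := Iff.rfl
@[simp] theorem safe_div (B : ℕ) (s : State) (e f : Expr) :
    (e / f).Safe B s ↔ e.Safe B s ∧ f.Safe B s := Iff.rfl
@[simp] theorem safe_bin (B : ℕ) (s : State) (o : BinOp) (e f : Expr) :
    (bin o e f).Safe B s ↔ e.Safe B s ∧ f.Safe B s := Iff.rfl

theorem deg_pos (e : Expr) : 1 ≤ e.deg := by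
  induction e with
  | const => exact le_rfl
  | reg => exact le_rfl
  | cell r e ih => exact ih
  | bin o e f ih _ => exact le_trans ih (Nat.le_add_right _ _)

end Expr

/-! ### Memory updates and bounds for the contents of the memory. -/

namespace State

@[simp] theorem reg_setReg (s : State) (x : ℕ) (v : ℤ) (y : ℕ) :
    (s.setReg x v).reg y = if y = x then v else s.reg y := by
  simp [setReg, Function.update_apply]
@[simp] theorem arr_setReg (s : State) (x : ℕ) (v : ℤ) (r : ℕ) : (s.setReg x v).arr r = s.arr r :=
  rfl
@[simp] theorem reg_setCell (s : State) (r : ℕ) (i v : ℤ) (y : ℕ) :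
    (s.setCell r i v).reg y = s.reg y := rfl
theorem arr_setCell (s : State) (r : ℕ) (i v : ℤ) (q : ℕ) :
    (s.setCell r i v).arr q = if q = r then Function.update (s.arr r) i v else s.arr q := by
  simp only [setCell, Function.update_apply]
@[simp] theorem arr_setCell_same (s : State) (r : ℕ) (i v : ℤ) :
    (s.setCell r i v).arr r = Function.update (s.arr r) i v := by simp [arr_setCell]
@[simp] theorem reg_setArr (s : State) (r : ℕ) (a : ℤ → ℤ) (y : ℕ) :
    (s.setArr r a).reg y = s.reg y := rfl
@[simp] theorem arr_setArr (s : State) (r : ℕ) (a : ℤ → ℤ) (q : ℕ) :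
    (s.setArr r a).arr q = if q = r then a else s.arr q := by
  simp [setArr, Function.update_apply]

/-- All registers, and all arrays except those for input and oracle answers, are bounded by `B`. -/
def Bounded (B : ℕ) (s : State) : Prop :=
  (∀ x, -(B : ℤ) ≤ s.reg x ∧ s.reg x ≤ B) ∧
  ∀ r, r ≠ 0 → r ≠ 3 → ∀ i, -(B : ℤ) ≤ s.arr r i ∧ s.arr r i ≤ B

theorem Bounded.setReg {B : ℕ} {s : State} (h : s.Bounded B) {x : ℕ} {v : ℤ}
    (hv : -(B : ℤ) ≤ v ∧ v ≤ B) : (s.setReg x v).Bounded B := by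
  refine ⟨fun y => ?_, fun r h0 h3 i => by simpa using h.2 r h0 h3 i⟩
  rw [reg_setReg]; split
  · exact hv
  · exact h.1 y

theorem Bounded.setCell {B : ℕ} {s : State} (h : s.Bounded B) {r : ℕ} {i v : ℤ}
    (hv : -(B : ℤ) ≤ v ∧ v ≤ B) : (s.setCell r i v).Bounded B := by
  refine ⟨fun y => h.1 y, fun q h0 h3 j => ?_⟩
  rw [arr_setCell]; split
  · subst q; rw [Function.update_apply]; split
    · exact hv
    · exact h.2 r h0 h3 j
  · exact h.2 q h0 h3 j

theorem Bounded.setArr {B : ℕ} {s : State} (h : s.Bounded B) {a : ℤ → ℤ} :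
    (s.setArr 3 a).Bounded B := by
  refine ⟨fun y => h.1 y, fun q h0 h3 j => ?_⟩
  rw [arr_setArr, if_neg h3]
  exact h.2 q h0 h3 j

end State

theorem BinOp.natAbs_eval_le (o : BinOp) {x y : ℤ} {B d e : ℕ} (hB : 2 ≤ B) (hd : 1 ≤ d)
    (he : 1 ≤ e) (hx : x.natAbs ≤ B ^ d) (hy : y.natAbs ≤ B ^ e) :
    (o.eval x y).natAbs ≤ B ^ (d + e) := by
  have h1 : 2 ≤ B ^ d := hB.trans (Nat.le_self_pow (by omega) B)
  have h2 : 2 ≤ B ^ e := hB.trans (Nat.le_self_pow (by omega) B)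
  -- The sum of two numbers that are at least 2 is at most their product.
  have h3 : B ^ d + B ^ e ≤ B ^ (d + e) := by rw [pow_add]; nlinarith
  cases o with
  | add => exact (Int.natAbs_add_le x y).trans (by omega)
  | sub => exact (Int.natAbs_sub_le x y).trans (by omega)
  | mul =>
    change (x * y).natAbs ≤ _
    rw [Int.natAbs_mul, pow_add]; exact Nat.mul_le_mul hx hy
  | div =>
    have : (x / y).natAbs ≤ x.natAbs := Int.natAbs_ediv_le_natAbs x y
    change (x / y).natAbs ≤ _
    omega
  | lt =>
    change (if x < y then (1 : ℤ) else 0).natAbs ≤ _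
    split <;> (simp; try omega)

/-- Exponents add under every binary operation, by `BinOp.natAbs_eval_le`, and reading a cell
returns to a value below B. So word size is settled by the shape of the expression, and only the
values that are stored need individual bounds. -/
theorem Expr.fits_of_safe {B W : ℕ} {s : State} (hB : 8 ≤ B) (hs : s.Bounded B) (e : Expr)
    (he : e.Safe B s) (hW : B ^ e.deg ≤ W) :
    e.Fits W s ∧ (e.eval s).natAbs ≤ B ^ e.deg := by
  induction e with
  | const c =>
    have : |c| ≤ 8 := he
    have h2 : c.natAbs ≤ 8 := by rw [Int.abs_eq_natAbs] at this; omega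
    simp only [Expr.deg, pow_one] at hW ⊢
    exact ⟨(h2.trans hB).trans hW, h2.trans hB⟩
  | reg x =>
    have := hs.1 x
    have h2 : (s.reg x).natAbs ≤ B := by omega
    simp only [Expr.deg, pow_one] at hW ⊢
    exact ⟨h2.trans hW, h2⟩
  | cell r e ih =>
    obtain ⟨h1, h2⟩ := he
    obtain ⟨h3, h4⟩ := ih h1 hW
    have h5 : -(B : ℤ) ≤ s.arr r (e.eval s) ∧ s.arr r (e.eval s) ≤ B := by
      by_cases h0 : r = 0
      · exact h2 (Or.inl h0)
      by_cases h03 : r = 3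
      · exact h2 (Or.inr h03)
      exact hs.2 r h0 h03 _
    have h6 : (s.arr r (e.eval s)).natAbs ≤ B ^ e.deg :=
      le_trans (by omega) (Nat.le_self_pow (by have := e.deg_pos; omega) B)
    exact ⟨⟨h3, h6.trans hW⟩, h6⟩
  | bin o e f ihe ihf =>
    obtain ⟨h1, h2⟩ := he
    have hp1 := e.deg_pos
    have hp2 := f.deg_pos
    obtain ⟨a1, a2⟩ := ihe h1 ((Nat.pow_le_pow_right (by omega) (by simp [Expr.deg])).trans hW)
    obtain ⟨b1, b2⟩ := ihf h2 ((Nat.pow_le_pow_right (by omega) (by simp [Expr.deg])).trans hW)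
    have := o.natAbs_eval_le (by omega) hp1 hp2 a2 b2
    exact ⟨⟨a1, b1, this.trans hW⟩, this⟩

/-! ### Weakest preconditions -/

namespace Prog

/-- The registers that the program may change. -/
def regs : Prog → List ℕ
  | skip => []
  | assign x _ => [x]
  | store _ _ _ => []
  | seq p q => p.regs ++ q.regs
  | ite _ p q => p.regs ++ q.regs
  | loop _ p => p.regs
  | call _ _ => []

/-- The arrays that the program may change. -/
def arrs : Prog → List ℕ
  | skip => []
  | assign _ _ => []
  | store r _ _ => [r]
  | seq p q => p.arrs ++ q.arrs
  | ite _ p q => p.arrs ++ q.arrs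
  | loop _ p => p.arrs
  | call _ r => [r]

/-- The two memories agree on everything that the program does not change. -/
def Frame (p : Prog) (s s' : State) : Prop :=
  (∀ x, x ∉ p.regs → s'.reg x = s.reg x) ∧ ∀ r, r ∉ p.arrs → s'.arr r = s.arr r

theorem Frame.rfl {p : Prog} {s : State} : p.Frame s s := ⟨fun _ _ => Eq.refl _, fun _ _ => Eq.refl _⟩

theorem Frame.trans {p : Prog} {s₁ s₂ s₃ : State} (h : p.Frame s₁ s₂) (h' : p.Frame s₂ s₃) :
    p.Frame s₁ s₃ :=
  ⟨fun x hx => (h'.1 x hx).trans (h.1 x hx), fun r hr => (h'.2 r hr).trans (h.2 r hr)⟩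

theorem Frame.mono {p q : Prog} {s s' : State} (h : p.Frame s s') (h1 : p.regs ⊆ q.regs)
    (h2 : p.arrs ⊆ q.arrs) : q.Frame s s' :=
  ⟨fun x hx => h.1 x fun hx' => hx (h1 hx'), fun r hr => h.2 r fun hr' => hr (h2 hr')⟩

end Prog

/-- An oracle, its running time, the word size, and a bound on the contents of the memory that
guarantees that all expressions fit into words. -/
structure Env where
  P : Problem
  O : P.Inst → ℤ → ℤ
  T : ℕ → ℕ → ℕ
  W : ℕ
  B : ℕ
  eight_le : 8 ≤ B
  pow_le : B ^ 40 ≤ W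

/-- From the memory `s`, the program halts, and the final memory and the time satisfy `Q`. -/
def WP (E : Env) (p : Prog) (s : State) (Q : State → ℕ → Prop) : Prop :=
  s.Bounded E.B → ∃ s' t, Exec E.P E.O E.T E.W p s s' t ∧ s'.Bounded E.B ∧ p.Frame s s' ∧ Q s' t

/-! ### Proof rules for total correctness with running time. -/

section Rules

variable {E : Env} {s : State} {Q : State → ℕ → Prop}

theorem Expr.Safe.fits {e : Expr} (he : e.Safe E.B s) (hs : s.Bounded E.B)
    (hd : e.deg ≤ 40) : e.Fits E.W s :=
  (Expr.fits_of_safe E.eight_le hs e he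
    ((Nat.pow_le_pow_right (by have := E.eight_le; omega) hd).trans E.pow_le)).1

theorem WP.mono {p : Prog} {Q' : State → ℕ → Prop} (h : WP E p s Q')
    (hQ : ∀ s' t, s'.Bounded E.B → p.Frame s s' → Q' s' t → Q s' t) : WP E p s Q := fun hs => by
  obtain ⟨s', t, h1, h2, h3, h4⟩ := h hs
  exact ⟨s', t, h1, h2, h3, hQ s' t h2 h3 h4⟩

theorem WP.of_bounded {p : Prog} (h : s.Bounded E.B → WP E p s Q) : WP E p s Q :=
  fun hs => h hs hs

theorem WP.of_frame {p : Prog} (h : WP E p s fun s' t => p.Frame s s' → Q s' t) : WP E p s Q :=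
  h.mono fun _ _ _ hF hQ => hQ hF

theorem WP.skip (h : Q s 1) : WP E .skip s Q :=
  fun hs => ⟨s, 1, .skip s, hs, .rfl, h⟩

theorem WP.assign {x : ℕ} {e : Expr} (he : e.Safe E.B s)
    (hv : -(E.B : ℤ) ≤ e.eval s ∧ e.eval s ≤ E.B) (h : Q (s.setReg x (e.eval s)) (e.cost + 1))
    (hd : e.deg ≤ 40 := by decide) : WP E (.assign x e) s Q := fun hs =>
  ⟨_, _, .assign (he.fits hs hd), hs.setReg hv,
    ⟨fun y hy => by simp [Prog.regs] at hy; simp [hy], fun _ _ => rfl⟩, h⟩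

theorem WP.store {r : ℕ} {i e : Expr} (hi : i.Safe E.B s) (he : e.Safe E.B s)
    (hv : -(E.B : ℤ) ≤ e.eval s ∧ e.eval s ≤ E.B)
    (h : Q (s.setCell r (i.eval s) (e.eval s)) (i.cost + e.cost + 1))
    (hd : i.deg ≤ 40 := by decide) (hd' : e.deg ≤ 40 := by decide) :
    WP E (.store r i e) s Q := fun hs =>
  ⟨_, _, .store (hi.fits hs hd) (he.fits hs hd'), hs.setCell hv,
    ⟨fun _ _ => rfl, fun q hq => by simp [Prog.arrs] at hq; simp [State.arr_setCell, hq]⟩, h⟩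

theorem WP.seq {p q : Prog}
    (h : WP E p s fun s₁ t₁ => WP E q s₁ fun s₂ t₂ => Q s₂ (t₁ + t₂)) :
    WP E (.seq p q) s Q := fun hs => by
  obtain ⟨s₁, t₁, h1, h2, h3, h4⟩ := h hs
  obtain ⟨s₂, t₂, g1, g2, g3, g4⟩ := h4 h2
  exact ⟨s₂, t₁ + t₂, .seq h1 g1, g2,
    (h3.mono (List.subset_append_left _ _) (List.subset_append_left _ _)).trans
      (g3.mono (List.subset_append_right _ _) (List.subset_append_right _ _)), g4⟩

theorem WP.assign_seq {x : ℕ} {e : Expr} {q : Prog} (he : e.Safe E.B s)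
    (hv : -(E.B : ℤ) ≤ e.eval s ∧ e.eval s ≤ E.B)
    (h : WP E q (s.setReg x (e.eval s)) fun s' t => Q s' (e.cost + 1 + t))
    (hd : e.deg ≤ 40 := by decide) : WP E (.seq (.assign x e) q) s Q :=
  .seq (.assign he hv h hd)

theorem WP.store_seq {r : ℕ} {i e : Expr} {q : Prog} (hi : i.Safe E.B s) (he : e.Safe E.B s)
    (hv : -(E.B : ℤ) ≤ e.eval s ∧ e.eval s ≤ E.B)
    (h : WP E q (s.setCell r (i.eval s) (e.eval s)) fun s' t => Q s' (i.cost + e.cost + 1 + t))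
    (hd : i.deg ≤ 40 := by decide) (hd' : e.deg ≤ 40 := by decide) :
    WP E (.seq (.store r i e) q) s Q :=
  .seq (.store hi he hv h hd hd')

theorem WP.ite {e : Expr} {p q : Prog} (he : e.Safe E.B s)
    (hp : e.eval s ≠ 0 → WP E p s fun s' t => Q s' (e.cost + 1 + t))
    (hq : e.eval s = 0 → WP E q s fun s' t => Q s' (e.cost + 1 + t))
    (hd : e.deg ≤ 40 := by decide) : WP E (.ite e p q) s Q := fun hs => by
  by_cases h : e.eval s = 0
  · obtain ⟨s', t, h1, h2, h3, h4⟩ := hq h hs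
    exact ⟨s', _, .ite_false (he.fits hs hd) h h1, h2,
      h3.mono (List.subset_append_right _ _) (List.subset_append_right _ _), h4⟩
  · obtain ⟨s', t, h1, h2, h3, h4⟩ := hp h hs
    exact ⟨s', _, .ite_true (he.fits hs hd) h h1, h2,
      h3.mono (List.subset_append_left _ _) (List.subset_append_left _ _), h4⟩

theorem WP.ite_lt {e f : Expr} {p q : Prog} (he : e.Safe E.B s) (hf : f.Safe E.B s)
    (hp : e.eval s < f.eval s → WP E p s fun s' t => Q s' (e.cost + f.cost + 2 + t))
    (hq : f.eval s ≤ e.eval s → WP E q s fun s' t => Q s' (e.cost + f.cost + 2 + t))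
    (hd : (Expr.lt e f).deg ≤ 40 := by decide) : WP E (.ite (.lt e f) p q) s Q :=
  .ite ⟨he, hf⟩ (fun h => hp (by simpa using h)) (fun h => hq (by simpa using h)) hd

theorem WP.call {q : ℕ} (x : E.P.Inst) (hx : E.P.Input x (s.arr q))
    (h : Q (s.setArr 3 (E.O x)) (1 + E.T (E.P.size x) (E.P.weight x))) :
    WP E (.call q 3) s Q := fun hs =>
  ⟨_, _, .call x hx, hs.setArr,
    ⟨fun _ _ => rfl, fun r hr => by simp [Prog.arrs] at hr; simp [hr]⟩, h⟩

theorem WP.loop {e : Expr} {p : Prog} (μ : State → ℕ) (I : State → ℕ → Prop) (h0 : I s 0)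
    (hsafe : ∀ s' t, I s' t → e.Safe E.B s')
    (hstep : ∀ s' t, I s' t → p.Frame s s' → e.eval s' ≠ 0 →
      WP E p s' fun s'' t' => μ s'' < μ s' ∧ I s'' (t + (e.cost + 1 + t')))
    (hend : ∀ s' t, I s' t → p.Frame s s' → e.eval s' = 0 → Q s' (t + (e.cost + 1)))
    (hd : e.deg ≤ 40 := by decide) : WP E (.loop e p) s Q := by
  have key : ∀ k s' t, μ s' = k → I s' t → p.Frame s s' → s'.Bounded E.B →
      ∃ s'' t', Exec E.P E.O E.T E.W (.loop e p) s' s'' t' ∧ s''.Bounded E.B ∧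
        p.Frame s s'' ∧ Q s'' (t + t') := by
    intro k
    induction k using Nat.strong_induction_on with
    | _ k ih =>
      intro s' t hk hI hF hB
      by_cases h : e.eval s' = 0
      · exact ⟨s', _, .loop_done ((hsafe s' t hI).fits hB hd) h, hB, hF, hend s' t hI hF h⟩
      · obtain ⟨s₁, t₁, h1, h2, h3, h4, h5⟩ := hstep s' t hI hF h hB
        obtain ⟨s₂, t₂, g1, g2, g3, g4⟩ := ih _ (hk ▸ h4) s₁ _ rfl h5 (hF.trans h3) h2
        exact ⟨s₂, _, .loop_step ((hsafe s' t hI).fits hB hd) h h1 g1, g2, g3, by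
          convert g4 using 1; ring⟩
  intro hs
  obtain ⟨s'', t', h1, h2, h3, h4⟩ := key _ s 0 rfl h0 .rfl hs
  exact ⟨s'', t', h1, h2, h3, by simpa using h4⟩

end Rules

/-- Run `p` with the register `x` going through all values below the register `y`. -/
def Prog.forTo (x y : ℕ) (p : Prog) : Prog :=
  .seq (.assign x 0) (.loop (.lt (.reg x) (.reg y)) (.seq p (.assign x (.reg x + 1))))

/-- `I k` is asked of the memory in which the counter has just been set to `k`. Each round costs 4
for the test and 4 for the increment; setting the counter and the last test make up the 6. -/
theorem WP.forTo {E : Env} {s : State} {Q : State → ℕ → Prop} {x y : ℕ} {p : Prog} (N : ℕ)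
    (I : ℕ → State → ℕ → Prop)
    (hN : s.reg y = N) (hx : x ≠ y ∧ x ∉ p.regs ∧ y ∉ p.regs)
    (h0 : I 0 (s.setReg x 0) 0)
    (hstep : ∀ k s' t, k < N → I k s' t → s'.reg x = k → (p.forTo x y).Frame s s' →
      WP E p s' fun s'' t' => I (k + 1) (s''.setReg x (k + 1)) (t + t'))
    (hend : ∀ s' t, I N s' t → s'.reg x = N → (p.forTo x y).Frame s s' →
      Q s' (t + (8 * N + 6))) :
    WP E (p.forTo x y) s Q := by
  have hd : (Expr.lt (.reg x) (.reg y)).deg ≤ 40 := by change 2 ≤ 40; norm_num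
  have hd' : (Expr.reg x + 1).deg ≤ 40 := by change 2 ≤ 40; norm_num
  refine .of_bounded fun hs => ?_
  have hb := hs.1 y
  rw [hN] at hb
  have hB := E.eight_le
  refine .assign_seq (by simp) (by simp) ?_
  have hfr : ∀ s', (Prog.seq p (.assign x (.reg x + 1))).Frame (s.setReg x 0) s' →
      (p.forTo x y).Frame s s' := by
    intro s' h
    refine ⟨fun z hz => ?_, fun r hr => ?_⟩
    · have h1 := h.1 z (fun h' => hz (by simp [Prog.forTo, Prog.regs] at h' ⊢; tauto))
      rw [h1, State.reg_setReg, if_neg]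
      rintro rfl
      exact hz (by simp [Prog.forTo, Prog.regs])
    · exact h.2 r (fun h' => hr (by simp [Prog.forTo, Prog.arrs] at h' ⊢; tauto))
  have hyr : ∀ s', (p.forTo x y).Frame s s' → s'.reg y = N := by
    intro s' h
    rw [h.1 y (by simp [Prog.forTo, Prog.regs, hx.1.symm, hx.2.2]), hN]
  refine .loop (fun s' => (N - s'.reg x).toNat)
    (fun s' t => ∃ (k : ℕ) (t₀ : ℕ), k ≤ N ∧ I k s' t₀ ∧ s'.reg x = k ∧ t = t₀ + 8 * k)
    ⟨0, 0, by omega, by simpa using h0, by simp, rfl⟩ (by simp) ?_ ?_ hd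
  · rintro s' t ⟨k, t₀, hk, hI, hxk, rfl⟩ hF hne
    have hF' := hfr s' hF
    have hy' := hyr s' hF'
    have hkN : k < N := by simp [hxk, hy'] at hne; exact hne
    refine .seq ((hstep k s' t₀ hkN hI hxk hF').mono fun s₁ t₁ _ hF1 hI1 => ?_)
    have hx1 : s₁.reg x = k := by rw [hF1.1 x hx.2.1, hxk]
    refine .assign (by simp) (by simp [hx1]; omega) ?_ hd'
    refine ⟨?_, k + 1, t₀ + t₁, hkN, ?_, ?_, ?_⟩
    · simp [hx1, hxk]; omega
    · simpa [hx1] using hI1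
    · simp [hx1]
    · simp; ring
  · rintro s' t ⟨k, t₀, hk, hI, hxk, rfl⟩ hF he
    have hF' := hfr s' hF
    have hy' := hyr s' hF'
    have hkN : k = N := by simp [hxk, hy'] at he; omega
    subst hkN
    have := hend s' t₀ hI hxk hF'
    convert this using 1
    simp; ring

/-- A loop all of whose iterations take time at most `τ`. -/
theorem WP.forTo_le {E : Env} {s : State} {Q : State → ℕ → Prop} {x y : ℕ} {p : Prog} (N τ : ℕ)
    (I : ℕ → State → Prop)
    (hN : s.reg y = N) (hx : x ≠ y ∧ x ∉ p.regs ∧ y ∉ p.regs)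
    (h0 : I 0 (s.setReg x 0))
    (hstep : ∀ k s', k < N → I k s' → s'.reg x = k → (p.forTo x y).Frame s s' →
      WP E p s' fun s'' t' => t' ≤ τ ∧ I (k + 1) (s''.setReg x (k + 1)))
    (hend : ∀ s' t, I N s' → s'.reg x = N → (p.forTo x y).Frame s s' →
      t ≤ N * (τ + 8) + 6 → Q s' t) :
    WP E (p.forTo x y) s Q := by
  refine .forTo N (fun k s t => t ≤ k * τ ∧ I k s) hN hx ⟨by simp, h0⟩ ?_ ?_
  · rintro k s' t hk ⟨ht, hI⟩ hxk hF
    refine (hstep k s' hk hI hxk hF).mono fun s₁ t₁ _ _ h => ⟨?_, h.2⟩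
    rw [add_mul, one_mul]; omega
  · rintro s' t ⟨ht, hI⟩ hxN hF
    exact hend s' _ hI hxN hF (by rw [mul_add]; omega)

/-! ### Walks and distances -/

namespace WDigraph

variable {G : WDigraph}

theorem HasWalk.single {u v : Fin G.n} {a : ℤ} (h : G.w u v = (a : WithTop ℤ)) :
    G.HasWalk u v a := by
  simpa using HasWalk.cons h (.nil v)

theorem HasWalk.trans {u x v : Fin G.n} {c d : ℤ} (h : G.HasWalk u x c) (h' : G.HasWalk x v d) :
    G.HasWalk u v (c + d) := by
  induction h with
  | nil => simpa using h'
  | cons ha _ ih => rw [add_assoc]; exact .cons ha (ih h')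

theorem HasWalk.eq_or_cons {u v : Fin G.n} {c : ℤ} (h : G.HasWalk u v c) :
    (u = v ∧ c = 0) ∨ ∃ (x : Fin G.n) (a d : ℤ), G.w u x = (a : WithTop ℤ) ∧ G.HasWalk x v d ∧
      c = a + d := by
  cases h with
  | nil => exact .inl ⟨rfl, rfl⟩
  | cons ha h => exact .inr ⟨_, _, _, ha, h, rfl⟩

theorem HasWalk.nonneg (hG : G.NonnegWeights) {u v : Fin G.n} {c : ℤ} (h : G.HasWalk u v c) :
    0 ≤ c := by
  induction h with
  | nil => exact le_rfl
  | @cons u x v a c ha _ ih =>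
    have := hG u x
    rw [ha] at this
    have : 0 ≤ a := by exact_mod_cast this
    omega

theorem NonnegWeights.noNegCycle (hG : G.NonnegWeights) : G.NoNegCycle :=
  fun _ _ h => h.nonneg hG

theorem natAbs_le_maxWeight {u v : Fin G.n} {a : ℤ} (h : G.w u v = (a : WithTop ℤ)) :
    a.natAbs ≤ G.maxWeight := by
  have := Finset.le_sup (f := fun p : Fin G.n × Fin G.n => ((G.w p.1 p.2).untopD 0).natAbs)
    (Finset.mem_univ (u, v))
  simpa [h, maxWeight] using this

theorem isDist_coe {u v : Fin G.n} {d : ℤ} (h : G.HasWalk u v d)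
    (h' : ∀ c, G.HasWalk u v c → d ≤ c) : G.IsDist u v (d : WithTop ℤ) := by
  refine IsLeast.isGLB ⟨⟨d, h, rfl⟩, ?_⟩
  rintro _ ⟨c, hc, rfl⟩
  exact_mod_cast h' c hc

theorem isDist_top {u v : Fin G.n} (h : ∀ c, ¬ G.HasWalk u v c) : G.IsDist u v ⊤ :=
  ⟨fun _ ⟨c, hc, _⟩ => (h c hc).elim, fun _ _ => le_top⟩

theorem exists_shortest (hG : G.NonnegWeights) {u v : Fin G.n} {c : ℤ} (h : G.HasWalk u v c) :
    ∃ d : ℤ, G.HasWalk u v d ∧ ∀ c, G.HasWalk u v c → d ≤ c := by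
  obtain ⟨d, h1, h2⟩ := Int.exists_least_of_bdd (P := fun c => G.HasWalk u v c)
    ⟨0, fun z hz => hz.nonneg hG⟩ ⟨c, h⟩
  exact ⟨d, h1, h2⟩

theorem isDist_coe_iff (hG : G.NonnegWeights) {u v : Fin G.n} {d : ℤ} :
    G.IsDist u v (d : WithTop ℤ) ↔ G.HasWalk u v d ∧ ∀ c, G.HasWalk u v c → d ≤ c := by
  refine ⟨fun h => ?_, fun h => isDist_coe h.1 h.2⟩
  by_cases hw : ∃ c, G.HasWalk u v c
  · obtain ⟨c, hc⟩ := hw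
    obtain ⟨e, h1, h2⟩ := exists_shortest hG hc
    have := h.unique (isDist_coe h1 h2)
    have : d = e := by exact_mod_cast this
    exact this ▸ ⟨h1, h2⟩
  · push Not at hw
    exact absurd (h.unique (isDist_top hw)) (WithTop.coe_ne_top)

/-- `G.SimplePath u v c l`: there is a path of weight `c` from `u` to `v` through the distinct
vertices `l`. -/
inductive SimplePath (G : WDigraph) : Fin G.n → Fin G.n → ℤ → List (Fin G.n) → Prop
  | nil (u : Fin G.n) : SimplePath G u u 0 [u]
  | cons {u x v : Fin G.n} {a c : ℤ} {l : List (Fin G.n)} :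
      G.w u x = (a : WithTop ℤ) → SimplePath G x v c l → u ∉ l →
      SimplePath G u v (a + c) (u :: l)

/-! ### Simple paths and their extraction from walks. -/

namespace SimplePath

theorem nodup {u v : Fin G.n} {c : ℤ} {l : List (Fin G.n)} (h : G.SimplePath u v c l) :
    l.Nodup := by
  induction h with
  | nil => simp
  | cons _ _ hu ih => exact List.nodup_cons.2 ⟨hu, ih⟩

theorem mem_head {u v : Fin G.n} {c : ℤ} {l : List (Fin G.n)} (h : G.SimplePath u v c l) :
    u ∈ l := by
  cases h <;> simp

theorem hasWalk {u v : Fin G.n} {c : ℤ} {l : List (Fin G.n)} (h : G.SimplePath u v c l) :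
    G.HasWalk u v c := by
  induction h with
  | nil => exact .nil _
  | cons ha _ _ ih => exact .cons ha ih

theorem length_le {u v : Fin G.n} {c : ℤ} {l : List (Fin G.n)} (h : G.SimplePath u v c l) :
    l.length ≤ G.n := by
  simpa using h.nodup.length_le_card

theorem split {u v y : Fin G.n} {c : ℤ} {l : List (Fin G.n)} (h : G.SimplePath u v c l)
    (hy : y ∈ l) : ∃ (c₁ c₂ : ℤ) (l₂ : List (Fin G.n)),
      G.HasWalk u y c₁ ∧ G.SimplePath y v c₂ l₂ ∧ c = c₁ + c₂ := by
  induction h with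
  | nil u =>
    obtain rfl : y = u := by simpa using hy
    exact ⟨0, 0, _, .nil _, .nil _, rfl⟩
  | @cons u x v a c l ha hp hu ih =>
    rcases List.mem_cons.1 hy with rfl | hy
    · exact ⟨0, a + c, _, .nil _, .cons ha hp hu, by ring⟩
    · obtain ⟨c₁, c₂, l₂, h1, h2, rfl⟩ := ih hy
      exact ⟨a + c₁, c₂, l₂, .cons ha h1, h2, by ring⟩

theorem abs_le {u v : Fin G.n} {c : ℤ} {l : List (Fin G.n)} (h : G.SimplePath u v c l) {M : ℤ}
    (hM : ∀ u v (a : ℤ), G.w u v = (a : WithTop ℤ) → |a| ≤ M) (h0 : 0 ≤ M) : |c| ≤ l.length * M := by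
  induction h with
  | nil u => simpa using h0
  | @cons u x v a c l ha hp hu ih =>
    have h1 := hM _ _ _ ha
    have h2 := abs_add_le a c
    simp only [List.length_cons]
    push_cast
    linarith

end SimplePath

/-- Build the path from the end of the walk. If the new first vertex already lies on the path, drop
the closed walk that leads back to it; its weight is nonnegative. -/
theorem HasWalk.exists_simplePath (hG : G.NoNegCycle) {u v : Fin G.n} {c : ℤ}
    (h : G.HasWalk u v c) : ∃ (d : ℤ) (l : List (Fin G.n)), d ≤ c ∧ G.SimplePath u v d l := by
  induction h with
  | nil u => exact ⟨0, _, le_rfl, .nil u⟩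
  | @cons u x v a c ha hw ih =>
    obtain ⟨d, l, hd, hp⟩ := ih
    by_cases hu : u ∈ l
    · obtain ⟨c₁, c₂, l₂, h1, h2, rfl⟩ := hp.split hu
      have := hG u _ (.cons ha h1)
      exact ⟨c₂, l₂, by omega, h2⟩
    · exact ⟨a + d, _, by omega, .cons ha hp hu⟩

end WDigraph

/-! ### Walks with a given number of steps in a matrix -/

/-- `StepWalk W m k i j c`: there is a walk of `k` steps and weight `c` from `i` to `j` in the
`m × m` matrix `W`. -/
inductive StepWalk (W : ℕ → ℕ → ℤ) (m : ℕ) : ℕ → ℕ → ℕ → ℤ → Prop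
  | nil {i : ℕ} : i < m → StepWalk W m 0 i i 0
  | cons {k i x j : ℕ} {c : ℤ} : i < m → StepWalk W m k x j c → StepWalk W m (k + 1) i j (W i x + c)

namespace StepWalk

variable {W : ℕ → ℕ → ℤ} {m : ℕ}

theorem lt_left {k i j : ℕ} {c : ℤ} (h : StepWalk W m k i j c) : i < m := by
  cases h <;> assumption

theorem append {k l i x j : ℕ} {c d : ℤ} (h : StepWalk W m k i x c) (h' : StepWalk W m l x j d) :
    StepWalk W m (k + l) i j (c + d) := by
  induction h with
  | nil => simpa using h'
  | @cons k i x j c hi _ ih =>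
    rw [show k + 1 + l = k + l + 1 by omega, add_assoc (W i x)]
    exact .cons hi (ih h')

theorem split {l : ℕ} : ∀ {k i j : ℕ} {c : ℤ}, StepWalk W m (k + l) i j c →
    ∃ (x : ℕ) (c₁ c₂ : ℤ), StepWalk W m k i x c₁ ∧ StepWalk W m l x j c₂ ∧ c = c₁ + c₂ := by
  intro k
  induction k with
  | zero =>
    intro i j c h
    rw [Nat.zero_add] at h
    exact ⟨i, 0, c, .nil h.lt_left, h, by ring⟩
  | succ k ih =>
    intro i j c h
    rw [Nat.add_right_comm] at h
    cases h with
    | cons hi h =>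
      obtain ⟨x, c₁, c₂, h1, h2, rfl⟩ := ih h
      exact ⟨x, _, c₂, .cons hi h1, h2, by ring⟩

theorem abs_le {H : ℤ} (hW : ∀ i j, |W i j| ≤ H) {k i j : ℕ} {c : ℤ}
    (h : StepWalk W m k i j c) : |c| ≤ k * H := by
  induction h with
  | nil => simp
  | @cons k i x j c hi _ ih =>
    have h1 := hW i x
    have h2 := abs_add_le (W i x) c
    push_cast
    linarith

end StepWalk

/-- The entries of `A` are the smallest weights of walks with `k` steps in `W`. -/
def IsMinWalk (W : ℕ → ℕ → ℤ) (m k : ℕ) (A : ℕ → ℕ → ℤ) : Prop :=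
  ∀ i j, i < m → j < m → StepWalk W m k i j (A i j) ∧ ∀ c, StepWalk W m k i j c → A i j ≤ c

/-- `C` is the square of `A` with respect to minimum and addition. -/
def IsMinPlusSq (m : ℕ) (A C : ℕ → ℕ → ℤ) : Prop :=
  ∀ i j, i < m → j < m → (∀ k, k < m → C i j ≤ A i k + A k j) ∧ ∃ k, k < m ∧ C i j = A i k + A k j

theorem exists_isMinPlusSq (m : ℕ) (A : ℕ → ℕ → ℤ) : ∃ C, IsMinPlusSq m A C := by
  have : ∀ i j, ∃ c : ℤ, i < m → (∀ k, k < m → c ≤ A i k + A k j) ∧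
      ∃ k, k < m ∧ c = A i k + A k j := by
    intro i j
    by_cases hi : i < m
    · obtain ⟨k, hk, h⟩ := Finset.exists_min_image (Finset.range m) (fun k => A i k + A k j)
        ⟨i, by simpa using hi⟩
      exact ⟨_, fun _ => ⟨fun l hl => h l (by simpa using hl), k, by simpa using hk, rfl⟩⟩
    · exact ⟨0, fun h => (hi h).elim⟩
  choose C hC using this
  exact ⟨C, fun i j hi _ => hC i j hi⟩

theorem isMinWalk_one (W : ℕ → ℕ → ℤ) (m : ℕ) : IsMinWalk W m 1 W := by
  refine fun i j hi hj => ⟨by simpa using StepWalk.cons (W := W) hi (.nil hj), fun c h => ?_⟩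
  cases h with
  | cons _ h => cases h with
    | nil => simp

/-- Cut a walk with `k + k` steps in the middle. -/
theorem IsMinWalk.sq {W A C : ℕ → ℕ → ℤ} {m k : ℕ} (hA : IsMinWalk W m k A)
    (hC : IsMinPlusSq m A C) : IsMinWalk W m (k + k) C := by
  intro i j hi hj
  obtain ⟨h1, x, hx, h2⟩ := hC i j hi hj
  refine ⟨h2 ▸ (hA i x hi hx).1.append (hA x j hx hj).1, fun c hc => ?_⟩
  obtain ⟨y, c₁, c₂, g1, g2, rfl⟩ := hc.split
  have hy := g2.lt_left
  have := h1 y hy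
  have := (hA i y hi hy).2 _ g1
  have := (hA y j hy hj).2 _ g2
  omega

/-! ### Distances as powers of the weight matrix with respect to minimum and addition. -/

namespace WDigraph

/-- The matrix of weights, with zeros on the diagonal and `H` for missing edges and vertices. -/
def finWeight (G : WDigraph) (H : ℤ) (i j : ℕ) : ℤ :=
  if i = j then 0
  else if h : i < G.n ∧ j < G.n then (G.w ⟨i, h.1⟩ ⟨j, h.2⟩).untopD H else H

variable {G : WDigraph} {H M : ℤ} {m : ℕ}

theorem finWeight_cases (i x : ℕ) : (i = x ∧ G.finWeight H i x = 0) ∨ G.finWeight H i x = H ∨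
    ∃ (hi : i < G.n) (hx : x < G.n), G.w ⟨i, hi⟩ ⟨x, hx⟩ = (G.finWeight H i x : WithTop ℤ) := by
  unfold finWeight
  split_ifs with h1 h2
  · exact .inl ⟨h1, rfl⟩
  · cases hw : G.w ⟨i, h2.1⟩ ⟨x, h2.2⟩ with
    | top => exact .inr (.inl rfl)
    | coe a => exact .inr (.inr ⟨h2.1, h2.2, by simp [hw]⟩)
  · exact .inr (.inl rfl)

theorem abs_finWeight_le (hM : ∀ u v (a : ℤ), G.w u v = (a : WithTop ℤ) → |a| ≤ M) (hMH : M ≤ H)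
    (hH : 0 ≤ H) (i j : ℕ) : |G.finWeight H i j| ≤ H := by
  rcases G.finWeight_cases (H := H) i j with h | h | ⟨_, _, h⟩
  · simp [h.2, hH]
  · rw [h, abs_of_nonneg hH]
  · exact (hM _ _ _ h).trans hMH

theorem StepWalk.neg_le (hM : ∀ u v (a : ℤ), G.w u v = (a : WithTop ℤ) → |a| ≤ M) (hM0 : 0 ≤ M)
    (hH : 0 ≤ H) {k i j : ℕ} {c : ℤ} (h : StepWalk (G.finWeight H) m k i j c) :
    -(k * M) ≤ c := by
  induction h with
  | nil => simp
  | @cons k i x j c hi _ ih =>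
    push_cast
    rcases G.finWeight_cases (H := H) i x with h | h | ⟨_, _, h⟩
    · linarith [h.2]
    · linarith
    · linarith [neg_le_of_abs_le (hM _ _ _ h)]

/-- A walk in the matrix that uses no entry `H` is a walk in the graph with some idle steps on the
diagonal. One that does pays `H` once, and each other step gains at most `M`. -/
theorem StepWalk.hasWalk_or (hM : ∀ u v (a : ℤ), G.w u v = (a : WithTop ℤ) → |a| ≤ M) (hM0 : 0 ≤ M)
    (hH : 0 ≤ H) {k i j : ℕ} {c : ℤ} (h : StepWalk (G.finWeight H) m k i j c) (hj : j < G.n) :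
    (∃ hi : i < G.n, G.HasWalk ⟨i, hi⟩ ⟨j, hj⟩ c) ∨ H - k * M ≤ c := by
  induction h with
  | nil => exact .inl ⟨hj, .nil _⟩
  | @cons k i x j c hi hw ih =>
    rcases ih hj with ⟨hx, ih⟩ | ih
    · rcases G.finWeight_cases (H := H) i x with ⟨rfl, h⟩ | h | ⟨h1, h2, h⟩
      · exact .inl ⟨hx, by simpa [h] using ih⟩
      · have := StepWalk.neg_le hM hM0 hH hw
        right; push_cast; linarith
      · exact .inl ⟨h1, .cons h ih⟩
    · right
      push_cast
      rcases G.finWeight_cases (H := H) i x with h | h | ⟨_, _, h⟩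
      · linarith [h.2]
      · linarith
      · linarith [neg_le_of_abs_le (hM _ _ _ h)]

/-- The zero diagonal allows an idle step, so short walks can be padded to any larger number of
steps. -/
theorem StepWalk.succ {k i j : ℕ} {c : ℤ} (h : StepWalk (G.finWeight H) m k i j c) :
    StepWalk (G.finWeight H) m (k + 1) i j c := by
  have := StepWalk.cons h.lt_left h
  simpa [finWeight] using this

theorem StepWalk.of_le {k l i j : ℕ} {c : ℤ} (h : StepWalk (G.finWeight H) m k i j c)
    (hkl : k ≤ l) : StepWalk (G.finWeight H) m l i j c := by
  induction hkl with
  | refl => exact h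
  | step _ ih => exact StepWalk.succ ih

/-- The number of steps is the number of vertices, one more than that of edges, so an idle step is
added at the end. Since the vertices are distinct, no edge of the path is a loop, whose weight
`finWeight` would replace by zero. -/
theorem SimplePath.stepWalk (hm : G.n ≤ m) {u v : Fin G.n} {c : ℤ} {l : List (Fin G.n)}
    (h : G.SimplePath u v c l) : StepWalk (G.finWeight H) m l.length u v c := by
  induction h with
  | nil u => exact StepWalk.succ (.nil (u.2.trans_le hm))
  | @cons u x v a c l ha hp hu ih =>
    have hne : (u : ℕ) ≠ x := fun h => hu (Fin.ext h ▸ hp.mem_head)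
    have : G.finWeight H u x = a := by simp [finWeight, hne, ha]
    rw [← this]
    exact .cons (u.2.trans_le hm) ih

/-- The distances are the smallest weights of walks with `N ≥ n` steps in the matrix of weights,
unless they are large. -/
theorem isDist_of_isMinWalk (hG : G.NoNegCycle)
    (hM : ∀ u v (a : ℤ), G.w u v = (a : WithTop ℤ) → |a| ≤ M) (hM0 : 0 ≤ M) {N : ℕ} (hN : G.n ≤ N)
    (hm : G.n ≤ m) {A : ℕ → ℕ → ℤ}
    (hA : IsMinWalk (G.finWeight (2 * (N * M) + 1)) m N A) (u v : Fin G.n) :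
    G.IsDist u v (if A u v ≤ N * M then (A u v : WithTop ℤ) else ⊤) := by
  have hNM : 0 ≤ N * M := by positivity
  obtain ⟨h1, h2⟩ := hA u v (u.2.trans_le hm) (v.2.trans_le hm)
  -- Any walk can be shortened to a simple path, whose weight is at most `N * M` and which can be
  -- padded to `N` steps.
  have key : ∀ c, G.HasWalk u v c → A u v ≤ c ∧ A u v ≤ N * M := by
    intro c hc
    obtain ⟨d, l, hd, hp⟩ := hc.exists_simplePath hG
    have hl := hp.length_le
    have h3 := h2 _ (StepWalk.of_le (hp.stepWalk hm) (hl.trans hN))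
    have h4 := hp.abs_le hM hM0
    have h5 : (l.length : ℤ) * M ≤ N * M :=
      mul_le_mul_of_nonneg_right (by exact_mod_cast hl.trans hN) hM0
    exact ⟨h3.trans hd, h3.trans (((le_abs_self d).trans h4).trans h5)⟩
  split_ifs with h
  · refine isDist_coe ?_ fun c hc => (key c hc).1
    -- A walk through a missing edge weighs at least `2 * (N * M) + 1 - N * M`, which is just above
    -- the threshold `N * M`.
    rcases StepWalk.hasWalk_or hM hM0 (by omega) h1 v.2 with ⟨_, h3⟩ | h3
    · exact h3
    · omega
  · exact isDist_top fun c hc => h (key c hc).2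

end WDigraph

/-! ### A graph whose diameter endpoints reveal negative triangles -/

/-- The weights of the edges between the vertices `x` and `y` of the triangle graph. There are four
groups of `s` vertices and one more vertex. The first group is joined to the second one, the second
to the third, and the third to the fourth by the weights `P`, `Q` and `-E`, all raised by `K`. From
a vertex of the first group it takes less than `3 * K` to reach anything but its copy in the fourth
group; all other edges have weight `3 * K`. -/
def triangleWeight (s K : ℤ) (P Q E : ℤ → ℤ → ℤ) (x y : ℤ) : ℤ :=
  if x < s then
    if y < s then 3 * K - 1
    else if y < 2 * s then K + P x (y - s)
    else if y = x + 3 * s then 3 * K else 3 * K - 1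
  else if x < 2 * s then
    if 2 * s ≤ y ∧ y < 3 * s then K + Q (x - s) (y - 2 * s) else 3 * K
  else if x < 3 * s then
    if 3 * s ≤ y ∧ y < 4 * s then K - E (y - 3 * s) (x - 2 * s) else 3 * K
  else 3 * K

/-- The triangle graph. -/
def triangleGraph (s : ℕ) (K : ℤ) (P Q E : ℤ → ℤ → ℤ) : WDigraph where
  n := 4 * s + 1
  w x y := (triangleWeight s K P Q E (x : ℕ) (y : ℕ) : WithTop ℤ)

section Triangle

variable {s : ℕ} {K : ℤ} {P Q E : ℤ → ℤ → ℤ}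

/-- The entries of the three `s × s` matrices are less than `K` in absolute value. -/
structure TriangleBounds (s : ℕ) (K : ℤ) (P Q E : ℤ → ℤ → ℤ) : Prop where
  left : ∀ x z : ℤ, 0 ≤ x → x < s → 0 ≤ z → z < s → -K < P x z ∧ P x z < K
  right : ∀ z y : ℤ, 0 ≤ z → z < s → 0 ≤ y → y < s → -K < Q z y ∧ Q z y < K
  base : ∀ x y : ℤ, 0 ≤ x → x < s → 0 ≤ y → y < s → -K < E x y ∧ E x y < K

theorem TriangleBounds.pos (h : TriangleBounds s K P Q E) (hs : 0 < s) : 0 < K := by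
  have := h.left 0 0 le_rfl (by exact_mod_cast hs) le_rfl (by exact_mod_cast hs)
  omega

/-- The lower bound 1 makes the edges of weight `3 * K - 1` useless for shortcuts: one more edge
brings the total to `3 * K`. The upper bound gives the diameter, because every pair of vertices is
joined by an edge. -/
theorem TriangleBounds.weight_mem (h : TriangleBounds s K P Q E) (hs : 0 < s) {x y : ℤ}
    (hx : 0 ≤ x) :
    1 ≤ triangleWeight s K P Q E x y ∧ triangleWeight s K P Q E x y ≤ 3 * K := by
  have hK := h.pos hs
  unfold triangleWeight
  split_ifs with h1 h2 h3 h4 h5 h6 h7 h8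
  · omega
  · have := h.left x (y - s) hx h1 (by omega) (by omega); omega
  · omega
  · omega
  · have := h.right (x - s) (y - 2 * s) (by omega) (by omega) (by omega) (by omega); omega
  · omega
  · have := h.base (y - 3 * s) (x - 2 * s) (by omega) (by omega) (by omega) (by omega); omega
  · omega
  · omega

local notation "Γ" => triangleGraph s K P Q E

theorem triangleGraph_nonneg (h : TriangleBounds s K P Q E) (hs : 0 < s) :
    (Γ).NonnegWeights := fun u v => by
  have := (h.weight_mem hs (x := (u : ℕ)) (y := (v : ℕ)) (by positivity)).1
  change (0 : WithTop ℤ) ≤ ((triangleWeight s K P Q E (u : ℕ) (v : ℕ) : ℤ) : WithTop ℤ)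
  exact_mod_cast (by omega : 0 ≤ triangleWeight s K P Q E (u : ℕ) (v : ℕ))

theorem triangleGraph_maxWeight_le (h : TriangleBounds s K P Q E) (hs : 0 < s) :
    (Γ).maxWeight ≤ (3 * K).natAbs := by
  refine Finset.sup_le fun p _ => ?_
  have := h.weight_mem hs (x := (p.1 : ℕ)) (y := (p.2 : ℕ)) (by positivity)
  change (triangleWeight s K P Q E (p.1 : ℕ) (p.2 : ℕ)).natAbs ≤ _
  omega

theorem triangleGraph_edge (u v : Fin (Γ).n) :
    (Γ).HasWalk u v (triangleWeight s K P Q E (u : ℕ) (v : ℕ)) := .single rfl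

/-- A walk between distinct vertices begins with an edge of positive weight. -/
theorem triangleGraph_walk_cases {u v : Fin (Γ).n} {c : ℤ} (hw : (Γ).HasWalk u v c) :
    u = v ∨ ∃ (x : Fin (Γ).n) (d : ℤ), (Γ).HasWalk x v d ∧
      c = triangleWeight s K P Q E (u : ℕ) (x : ℕ) + d := by
  rcases hw.eq_or_cons with ⟨h, _⟩ | ⟨x, a, d, ha, hd, rfl⟩
  · exact .inl h
  · refine .inr ⟨x, d, hd, ?_⟩
    have : a = triangleWeight s K P Q E (u : ℕ) (x : ℕ) := (WithTop.coe_inj.1 ha).symm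
    rw [this]

/-- The edges into the last vertex weigh `3 * K - 1` from the first group and `3 * K` from the
others. A detour pays at least 1 before it arrives at such an edge, so it never gets below `3 * K`.
-/
theorem triangleGraph_dist_last (h : TriangleBounds s K P Q E) (hs : 0 < s) {u v : Fin (Γ).n}
    {c : ℤ} (hw : (Γ).HasWalk u v c) (hv : (v : ℕ) = 4 * s) (hu : u ≠ v) :
    3 * K - 1 ≤ c ∧ (s ≤ (u : ℕ) → 3 * K ≤ c) := by
  have hG := triangleGraph_nonneg h hs
  induction hw with
  | nil => exact absurd rfl hu
  | @cons u x v a c ha hw ih =>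
    have ha : a = triangleWeight s K P Q E (u : ℕ) (x : ℕ) := (WithTop.coe_inj.1 ha).symm
    have h1 := h.weight_mem hs (x := (u : ℕ)) (y := (x : ℕ)) (by positivity)
    have hun : (u : ℕ) < 4 * s + 1 := u.2
    have huv : (u : ℕ) ≠ v := fun h => hu (Fin.ext h)
    by_cases hx : x = v
    · have h2 := hw.nonneg hG
      subst hx
      rw [triangleWeight] at ha
      split_ifs at ha <;> omega
    · have := (ih hv hx).1
      omega

theorem triangleGraph_walk_far (h : TriangleBounds s K P Q E) (hs : 0 < s) {u v : Fin (Γ).n}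
    (hu : 3 * s ≤ (u : ℕ)) (huv : u ≠ v) {c : ℤ} (hw : (Γ).HasWalk u v c) : 3 * K ≤ c := by
  rcases triangleGraph_walk_cases hw with rfl | ⟨x, d, hd, rfl⟩
  · exact absurd rfl huv
  · have := hd.nonneg (triangleGraph_nonneg h hs)
    rw [triangleWeight, if_neg (by omega), if_neg (by omega), if_neg (by omega)]
    omega

/-- Leaving the third group for anything but the fourth costs `3 * K` at once, and so does leaving a
wrong vertex of the fourth group. -/
theorem triangleGraph_walk_third (h : TriangleBounds s K P Q E) (hs : 0 < s) {u v : Fin (Γ).n}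
    (hu : 2 * s ≤ (u : ℕ)) (hu' : (u : ℕ) < 3 * s) (hv : 3 * s ≤ (v : ℕ)) (hv' : (v : ℕ) < 4 * s)
    {c : ℤ} (hw : (Γ).HasWalk u v c) (hc : c < 3 * K) :
    K - E ((v : ℕ) - 3 * s) ((u : ℕ) - 2 * s) ≤ c := by
  rcases triangleGraph_walk_cases hw with rfl | ⟨x, d, hd, rfl⟩
  · omega
  · have h0 := hd.nonneg (triangleGraph_nonneg h hs)
    have h1 := (h.weight_mem hs (x := (u : ℕ)) (y := (x : ℕ)) (by positivity)).1
    by_cases hx : x = v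
    · subst hx
      rw [triangleWeight, if_neg (by omega), if_neg (by omega), if_pos (by omega),
        if_pos (by omega)]
      omega
    · exfalso
      by_cases hx3 : 3 * s ≤ (x : ℕ)
      · have := triangleGraph_walk_far h hs hx3 hx hd
        omega
      · rw [triangleWeight, if_neg (by omega), if_neg (by omega), if_pos (by omega),
          if_neg (by omega)] at hc
        omega

theorem triangleGraph_walk_second (h : TriangleBounds s K P Q E) (hs : 0 < s) {u v : Fin (Γ).n}
    (hu : s ≤ (u : ℕ)) (hu' : (u : ℕ) < 2 * s) (hv : 3 * s ≤ (v : ℕ)) (hv' : (v : ℕ) < 4 * s)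
    {c : ℤ} (hw : (Γ).HasWalk u v c) (hc : c < 3 * K) :
    ∃ y : ℕ, y < s ∧ K + Q ((u : ℕ) - s) y + (K - E ((v : ℕ) - 3 * s) y) ≤ c := by
  rcases triangleGraph_walk_cases hw with rfl | ⟨x, d, hd, rfl⟩
  · omega
  · have h0 := hd.nonneg (triangleGraph_nonneg h hs)
    have h1 := (h.weight_mem hs (x := (u : ℕ)) (y := (x : ℕ)) (by positivity)).1
    by_cases hx : 2 * s ≤ (x : ℕ) ∧ (x : ℕ) < 3 * s
    · have h2 := triangleGraph_walk_third h hs hx.1 hx.2 hv hv' hd (by omega)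
      rw [triangleWeight, if_neg (by omega), if_pos (by omega), if_pos (by omega)]
      refine ⟨(x : ℕ) - 2 * s, by omega, ?_⟩
      rw [Nat.cast_sub hx.1]
      push_cast
      omega
    · rw [triangleWeight, if_neg (by omega), if_pos (by omega), if_neg (by omega)] at hc
      omega

/-- A first edge outside the second group either costs `3 * K` or costs `3 * K - 1` and must be
followed by another edge of positive weight. So a cheap walk passes through the second, third and
fourth group in order, and its weight is at least `3 * K` plus the weight of a triangle. -/
theorem triangleGraph_walk_first (h : TriangleBounds s K P Q E) (hs : 0 < s) {u v : Fin (Γ).n}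
    (hu : (u : ℕ) < s) (hv : (v : ℕ) = u + 3 * s)
    {c : ℤ} (hw : (Γ).HasWalk u v c) (hc : c < 3 * K) :
    ∃ y z : ℕ, y < s ∧ z < s ∧ P (u : ℕ) z + Q z y < E (u : ℕ) y := by
  rcases triangleGraph_walk_cases hw with rfl | ⟨x, d, hd, rfl⟩
  · omega
  · have hG := triangleGraph_nonneg h hs
    have h0 := hd.nonneg hG
    have h1 := (h.weight_mem hs (x := (u : ℕ)) (y := (x : ℕ)) (by positivity)).1
    by_cases hx : s ≤ (x : ℕ) ∧ (x : ℕ) < 2 * s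
    · obtain ⟨y, hy, h2⟩ :=
        triangleGraph_walk_second h hs hx.1 hx.2 (by omega) (by omega) hd (by omega)
      refine ⟨y, (x : ℕ) - s, hy, by omega, ?_⟩
      rw [triangleWeight, if_pos (by omega), if_neg (by omega), if_pos (by omega)] at hc
      rw [Nat.cast_sub hx.1]
      have h3 : ((v : ℕ) : ℤ) - 3 * s = (u : ℕ) := by omega
      rw [h3] at h2
      omega
    · exfalso
      have h4 : triangleWeight s K P Q E (u : ℕ) (x : ℕ) =
          if ((x : ℕ) : ℤ) = (u : ℕ) + 3 * s then 3 * K else 3 * K - 1 := by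
        unfold triangleWeight
        split_ifs <;> omega
      split_ifs at h4 with h5
      · omega
      · rcases triangleGraph_walk_cases hd with rfl | ⟨y, e, he, rfl⟩
        · omega
        · have := he.nonneg hG
          have := (h.weight_mem hs (x := (x : ℕ)) (y := (y : ℕ))
            (by positivity)).1
          omega

theorem triangleGraph_isDist_le (h : TriangleBounds s K P Q E) (hs : 0 < s) (u v : Fin (Γ).n) :
    ∃ d : ℤ, (Γ).IsDist u v d ∧ d ≤ 3 * K ∧ (Γ).HasWalk u v d ∧
      ∀ c, (Γ).HasWalk u v c → d ≤ c := by
  have hG := triangleGraph_nonneg h hs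
  have he := triangleGraph_edge (s := s) (K := K) (P := P) (Q := Q) (E := E) u v
  obtain ⟨d, h1, h2⟩ := WDigraph.exists_shortest hG he
  exact ⟨d, WDigraph.isDist_coe h1 h2, (h2 _ he).trans
    (h.weight_mem hs (by positivity)).2, h1, h2⟩

theorem triangleGraph_isDist_eq (h : TriangleBounds s K P Q E) (hs : 0 < s) {u v : Fin (Γ).n}
    (hc : ∀ c, (Γ).HasWalk u v c → 3 * K ≤ c) : (Γ).IsDist u v (3 * K : ℤ) := by
  obtain ⟨d, h1, h2, h3, h4⟩ := triangleGraph_isDist_le h hs u v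
  have := hc d h3
  obtain rfl : d = 3 * K := by omega
  exact h1

theorem triangleGraph_isDiameter (h : TriangleBounds s K P Q E) (hs : 0 < s) :
    (Γ).IsDiameter (3 * K : ℤ) := by
  -- All edges that leave the last vertex have weight `3 * K`, so it realizes the diameter with any
  -- other vertex.
  refine ⟨⟨⟨4 * s, by simp [triangleGraph]⟩, ⟨0, by simp [triangleGraph]⟩,
    triangleGraph_isDist_eq h hs fun c hc => ?_⟩, ?_⟩
  · exact triangleGraph_walk_far h hs (by simp; omega)
      (fun h => by have := Fin.mk.inj_iff.1 h; omega) hc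
  · rintro z ⟨x, y, hz⟩
    obtain ⟨d, h1, h2, -⟩ := triangleGraph_isDist_le h hs x y
    rw [hz.unique h1]
    exact_mod_cast h2

/-- A vertex is not an endpoint of a diameter if and only if it lies in the first group and in a
negative triangle. -/
theorem triangleGraph_not_isDiameterVertex (h : TriangleBounds s K P Q E) (hs : 0 < s)
    (u : Fin (Γ).n) : ¬ (Γ).IsDiameterVertex u ↔
      (u : ℕ) < s ∧ ∃ y z : ℕ, y < s ∧ z < s ∧ P (u : ℕ) z + Q z y < E (u : ℕ) y := by
  have hG := triangleGraph_nonneg h hs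
  have hD := triangleGraph_isDiameter h hs
  have hun : (u : ℕ) < 4 * s + 1 := u.2
  constructor
  · intro hu
    by_contra hcon
    apply hu
    by_cases hus : (u : ℕ) < s
    · refine ⟨⟨(u : ℕ) + 3 * s, by change _ < 4 * s + 1; omega⟩, _,
        triangleGraph_isDist_eq h hs fun c hc => ?_, hD⟩
      by_contra! hlt
      exact hcon ⟨hus, triangleGraph_walk_first h hs hus rfl hc hlt⟩
    -- Outside the first group, the last vertex is at distance `3 * K`; the last vertex itself uses
    -- vertex 0.
    by_cases hu4 : (u : ℕ) = 4 * s
    · exact ⟨⟨0, by simp [triangleGraph]⟩, _, triangleGraph_isDist_eq h hs fun c hc =>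
        triangleGraph_walk_far h hs (by omega) (fun h => by rw [h] at hu4; simp at hu4; omega) hc, hD⟩
    · exact ⟨⟨4 * s, by simp [triangleGraph]⟩, _, triangleGraph_isDist_eq h hs fun c hc =>
        (triangleGraph_dist_last h hs hc rfl (fun h => hu4 (by rw [h]))).2 (by omega), hD⟩
  · rintro ⟨hus, y, z, hy, hz, hlt⟩ ⟨v, d, hd, hd'⟩
    obtain rfl : d = ((3 * K : ℤ) : WithTop ℤ) := hd'.unique hD
    obtain ⟨-, h2⟩ := (WDigraph.isDist_coe_iff hG).1 hd
    by_cases hv : (v : ℕ) = u + 3 * s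
    · have w1 := triangleGraph_edge (s := s) (K := K) (P := P) (Q := Q) (E := E)
        u ⟨s + z, by change _ < 4 * s + 1; omega⟩
      have w2 := triangleGraph_edge (s := s) (K := K) (P := P) (Q := Q) (E := E)
        ⟨s + z, by change _ < 4 * s + 1; omega⟩ ⟨2 * s + y, by change _ < 4 * s + 1; omega⟩
      have w3 := triangleGraph_edge (s := s) (K := K) (P := P) (Q := Q) (E := E)
        ⟨2 * s + y, by change _ < 4 * s + 1; omega⟩ v
      have h3 := h2 _ (w1.trans (w2.trans w3))
      have e1 : triangleWeight s K P Q E (u : ℕ) ((s + z : ℕ) : ℤ) = K + P (u : ℕ) z := by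
        rw [triangleWeight, if_pos (by omega), if_neg (by omega), if_pos (by omega)]
        congr 2; push_cast; ring
      have e2 : triangleWeight s K P Q E ((s + z : ℕ) : ℤ) ((2 * s + y : ℕ) : ℤ) = K + Q z y := by
        rw [triangleWeight, if_neg (by omega), if_pos (by omega), if_pos (by omega)]
        congr 2 <;> push_cast <;> ring
      have e3 : triangleWeight s K P Q E ((2 * s + y : ℕ) : ℤ) (v : ℕ) = K - E (u : ℕ) y := by
        rw [triangleWeight, if_neg (by omega), if_neg (by omega), if_pos (by omega),
          if_pos (by omega)]
        congr 2
        · rw [hv]; push_cast; ring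
        · push_cast; ring
      change 3 * K ≤ triangleWeight s K P Q E (u : ℕ) ((s + z : ℕ) : ℤ) +
        (triangleWeight s K P Q E ((s + z : ℕ) : ℤ) ((2 * s + y : ℕ) : ℤ) +
          triangleWeight s K P Q E ((2 * s + y : ℕ) : ℤ) (v : ℕ)) at h3
      rw [e1, e2, e3] at h3
      omega
    -- Only the edge to the copy of `u` in the fourth group is as heavy as the diameter.
    · have h3 := h2 _ (triangleGraph_edge u v)
      have hK := h.pos hs
      rw [triangleWeight, if_pos (by omega)] at h3
      split_ifs at h3 with h4 h5 h6
      · omega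
      · have := h.left (u : ℕ) ((v : ℕ) - s) (by omega) (by omega) (by omega) (by omega)
        omega
      · omega
      · omega

end Triangle

open FineGrained.Expr (reg cell)

/-! ### Solving CoDiameter with all-pairs shortest paths -/

/-- The sum of the values in array `3` plus one, in register `2`. -/
def sumProg : Prog := .forTo 5 1 (.assign 2 (reg 2 + cell 3 (2 * reg 5 + 1)))

/-- The distances, with infinity replaced by register `2`, in array `4`, and their maximum in
register `3`. -/
def maxProg : Prog := .forTo 5 1 <|
  .seq (.ite (cell 3 (2 * reg 5)) (.assign 6 (cell 3 (2 * reg 5 + 1))) (.assign 6 (reg 2))) <|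
  .seq (.ite (.lt (reg 3) (reg 6)) (.assign 3 (reg 6)) .skip) (.store 4 (reg 5) (reg 6))

/-- Mark the rows of array `4` that contain register `3` in array `5`. -/
def markProg : Prog := .forTo 5 1 <|
  .ite (cell 4 (reg 5) - reg 3) .skip (.store 5 (reg 5 / reg 0) 1)

/-- Find an unmarked row. -/
def findProg : Prog := .forTo 5 0 <| .ite (cell 5 (reg 5)) .skip (.assign 4 (reg 5))

/-- Register 0 holds n, register 1 holds n², register 2 the substitute for infinity, register 3 the
largest distance, and register 4 the answer, which is -1 unless an unmarked row turns up. -/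
def coDiameterProg : Prog :=
  .seq (.call 0 3) <|
  .seq (.assign 0 (cell 0 0)) <|
  .seq (.assign 1 (reg 0 * reg 0)) <|
  .seq (.assign 2 1) <|
  .seq sumProg <|
  .seq (.assign 3 0) <|
  .seq maxProg <|
  .seq markProg <|
  .seq (.assign 4 (.const (-1))) <|
  .seq findProg (.store 1 0 (reg 4))

section

variable {E : Env} {s : State} {Q : State → ℕ → Prop}

theorem sumProg_wp {N : ℕ} {V : ℕ → ℤ} (hN : s.reg 1 = N) (h2 : s.reg 2 = 1)
    (hV : ∀ k < N, s.arr 3 (2 * k + 1) = V k) (hV0 : ∀ k < N, 0 ≤ V k)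
    (hB : 1 + ∑ k ∈ Finset.range N, V k ≤ E.B)
    (h : ∀ s' t, sumProg.Frame s s' → s'.reg 2 = 1 + ∑ k ∈ Finset.range N, V k →
      t ≤ 17 * N + 6 → Q s' t) : WP E sumProg s Q := by
  have hle : ∀ k ≤ N, ∑ i ∈ Finset.range k, V i ≤ ∑ i ∈ Finset.range N, V i := fun k hk =>
    Finset.sum_le_sum_of_subset_of_nonneg (Finset.range_mono hk) fun i hi _ => hV0 i (by simpa using hi)
  have hpos : ∀ k ≤ N, 0 ≤ ∑ i ∈ Finset.range k, V i := fun k hk =>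
    Finset.sum_nonneg fun i hi => hV0 i (by simp at hi; omega)
  refine .forTo_le N 9 (fun k s => s.reg 2 = 1 + ∑ i ∈ Finset.range k, V i) hN (by decide)
    (by simpa using h2) ?_ fun s' t hI _ hF ht => h s' t hF hI (by omega)
  intro k s' hk hI hx hF
  have h3 : s'.arr 3 (2 * k + 1) = V k := by rw [hF.2 3 (by decide), hV k hk]
  have hsum : ∑ i ∈ Finset.range (k + 1), V i = ∑ i ∈ Finset.range k, V i + V k :=
    Finset.sum_range_succ _ _
  have := hle (k + 1) hk
  have := hpos k hk.le
  have := hV0 k hk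
  refine .assign ?_ ?_ ?_
  · simp [hx, h3]; omega
  · simp [hx, h3, hI]; omega
  · simp [hx, h3, hI]; omega

theorem maxProg_wp {N : ℕ} {F V X : ℕ → ℤ} {big : ℤ} (hN : s.reg 1 = N) (h2 : s.reg 2 = big)
    (h3 : s.reg 3 = 0)
    (hF : ∀ k < N, s.arr 3 (2 * k) = F k) (hV : ∀ k < N, s.arr 3 (2 * k + 1) = V k)
    (hX : ∀ k < N, X k = if F k = 0 then big else V k)
    (hF1 : ∀ k < N, F k = 0 ∨ F k = 1) (hV0 : ∀ k < N, 0 ≤ V k ∧ V k ≤ E.B)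
    (hb : 0 ≤ big)
    (h : ∀ s' t, maxProg.Frame s s' → (∀ k < N, s'.arr 4 k = X k) → (∀ k < N, X k ≤ s'.reg 3) →
      (0 < N → ∃ k < N, X k = s'.reg 3) → t ≤ 36 * N + 6 → Q s' t) : WP E maxProg s Q := by
  refine .of_bounded fun hbd => ?_
  have hB := E.eight_le
  have hbB := hbd.1 2
  refine .forTo_le N 28 (fun k s => (∀ i < k, s.arr 4 i = X i) ∧ (∀ i < k, X i ≤ s.reg 3) ∧
    0 ≤ s.reg 3 ∧ (s.reg 3 = 0 ∨ ∃ i < k, X i = s.reg 3)) hN (by decide)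
    (by simp [h3]) ?_ ?_
  · rintro k s' hk ⟨i1, i2, i3, i4⟩ hx hFr
    have a3 := hFr.2 3 (by decide)
    have r2 := hFr.1 2 (by decide)
    have hk0 := hV0 k hk
    have hk1 := hF1 k hk
    have hXk := hX k hk
    have hFk : s'.arr 3 (2 * k) = F k := by rw [a3, hF k hk]
    have hVk : s'.arr 3 (2 * k + 1) = V k := by rw [a3, hV k hk]
    have hXB : 0 ≤ X k ∧ X k ≤ E.B := by rw [hXk]; split <;> omega
    have h6 : WP E (.ite (cell 3 (2 * reg 5)) (.assign 6 (cell 3 (2 * reg 5 + 1)))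
        (.assign 6 (reg 2))) s' fun s'' t => s'' = s'.setReg 6 (X k) ∧ t ≤ 15 := by
      refine .ite ?_ (fun hc => ?_) (fun hc => ?_)
      · simp [hx, hFk]; omega
      · refine .assign ?_ ?_ ?_
        · simp [hx, hVk]; omega
        · simp [hx, hVk]; omega
        · simp [hx, hFk] at hc
          simp [hx, hVk, hXk, hc]
      · refine .assign (by simp) ?_ ?_
        · simp [r2]; omega
        · simp [hx, hFk] at hc
          simp [r2, h2, hXk, hc]
    refine .seq (h6.mono ?_)
    rintro _ t1 - - ⟨rfl, ht1⟩
    have h7 : WP E (.ite (.lt (reg 3) (reg 6)) (.assign 3 (reg 6)) .skip) (s'.setReg 6 (X k))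
        fun s'' t => s''.arr = s'.arr ∧ s''.reg 6 = X k ∧ s''.reg 5 = k ∧ X k ≤ s''.reg 3 ∧
          s'.reg 3 ≤ s''.reg 3 ∧ (s''.reg 3 = s'.reg 3 ∨ s''.reg 3 = X k) ∧ t ≤ 8 := by
      refine .ite_lt (by simp) (by simp) (fun hc => ?_) (fun hc => ?_)
      · simp at hc
        refine .assign (by simp) (by simp; omega) ?_
        simp [hx]; exact ⟨rfl, hc.le⟩
      · simp at hc
        refine .skip ?_
        simp [hx]; exact ⟨rfl, hc⟩
    refine .seq (h7.mono ?_)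
    rintro s'' t2 - - ⟨ha, g6, g5, g1, g2, g3, ht2⟩
    refine .store (by simp) (by simp) (by simp [g6]; omega) ?_
    simp [g6, g5, ha]
    refine ⟨by omega, fun i hi => ?_, fun i hi => ?_, by omega, ?_⟩
    · by_cases hik : i = k
      · subst hik; simp
      · rw [Function.update_of_ne (by exact_mod_cast hik), i1 i (by omega)]
    · by_cases hik : i = k
      · subst hik; exact g1
      · exact (i2 i (by omega)).trans g2
    · rcases g3 with g3 | g3
      · rcases i4 with i4 | ⟨i, hi, i4⟩
        · left; omega
        · right; exact ⟨i, by omega, by omega⟩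
      · right; exact ⟨k, by omega, by omega⟩
  · rintro s' t ⟨i1, i2, i3, i4⟩ - hFr ht
    refine h s' t hFr i1 i2 (fun hN0 => ?_) (by omega)
    rcases i4 with i4 | i4
    · have h5 := i2 0 hN0
      have h6 : 0 ≤ X 0 := by
        rw [hX 0 hN0]; split
        · exact hb
        · exact (hV0 0 hN0).1
      exact ⟨0, hN0, by omega⟩
    · exact i4

theorem markProg_wp {n : ℕ} {X : ℕ → ℤ} (h0 : s.reg 0 = n) (hN : s.reg 1 = (n * n : ℕ))
    (hX : ∀ k < n * n, s.arr 4 k = X k) (h5 : ∀ i, s.arr 5 i = 0)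
    (h : ∀ s' t, markProg.Frame s s' →
      (∀ u : ℕ, s'.arr 5 u ≠ 0 ↔ ∃ k < n * n, X k = s.reg 3 ∧ k / n = u) →
      t ≤ 20 * (n * n) + 6 → Q s' t) : WP E markProg s Q := by
  refine .forTo_le (n * n) 12 (fun k s' => ∀ u : ℕ, s'.arr 5 u ≠ 0 ↔
    ∃ i < k, X i = s.reg 3 ∧ i / n = u) hN (by decide)
    (by simp [h5]) ?_ fun s' t hI _ hF ht => h s' t hF hI (by omega)
  intro k s' hk hI hx hFr
  have a4 : s'.arr 4 k = X k := by rw [hFr.2 4 (by decide), hX k hk]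
  have r0 := hFr.1 0 (by decide)
  have r3 := hFr.1 3 (by decide)
  have hB := E.eight_le
  refine .ite (by simp) (fun hc => ?_) (fun hc => ?_)
  · simp [hx, a4, r3] at hc
    refine .skip ⟨by simp, fun u => ?_⟩
    rw [State.arr_setReg, hI u]
    constructor
    · rintro ⟨i, hi, h⟩; exact ⟨i, by omega, h⟩
    · rintro ⟨i, hi, h⟩
      refine ⟨i, ?_, h⟩
      rcases Nat.lt_succ_iff_lt_or_eq.1 hi with h' | rfl
      · exact h'
      · exact absurd h.1 (by omega)
  · simp [hx, a4, r3] at hc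
    refine .store (by simp) (by simp) (by simp; omega) ⟨by simp, fun u => ?_⟩
    simp only [State.arr_setReg, State.arr_setCell_same, Expr.eval_div, Expr.eval_reg,
      Expr.eval_ofNat, hx, r0, h0]
    by_cases hu : k / n = u
    · rw [← hu]; push_cast
      simp only [Function.update_self]
      simp
      exact ⟨k, by omega, by omega, rfl⟩
    · have hu' : (u : ℤ) ≠ (k : ℤ) / n := fun h => hu (by exact_mod_cast h.symm)
      rw [Function.update_of_ne hu', hI u]
      constructor
      · rintro ⟨i, hi, h⟩; exact ⟨i, by omega, h⟩
      · rintro ⟨i, hi, h⟩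
        refine ⟨i, ?_, h⟩
        rcases Nat.lt_succ_iff_lt_or_eq.1 hi with h' | rfl
        · exact h'
        · exact absurd h.2 hu

theorem findProg_wp {n : ℕ} (h0 : s.reg 0 = n) (h4 : s.reg 4 = -1)
    (h : ∀ s' t, findProg.Frame s s' →
      ((∃ u < n, s'.reg 4 = (u : ℕ) ∧ s.arr 5 u = 0) ∨
        (s'.reg 4 = -1 ∧ ∀ u : ℕ, u < n → s.arr 5 u ≠ 0)) →
      t ≤ 20 * n + 6 → Q s' t) : WP E findProg s Q := by
  refine .forTo_le n 12 (fun k s' => ((∃ u < k, s'.reg 4 = (u : ℕ) ∧ s.arr 5 u = 0) ∨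
        (s'.reg 4 = -1 ∧ ∀ u : ℕ, u < k → s.arr 5 u ≠ 0))) h0 (by decide)
    (by simp [h4]) ?_ fun s' t hI _ hF ht => h s' t hF hI (by omega)
  intro k s' hk hI hx hFr
  have a5 := hFr.2 5 (by decide)
  refine .of_bounded fun hbd => ?_
  have h5B := hbd.1 5
  refine .ite (by simp) (fun hc => ?_) (fun hc => ?_)
  · simp [hx, a5] at hc
    refine .skip ⟨by simp, ?_⟩
    simp only [State.reg_setReg]
    rcases hI with ⟨u, hu, h⟩ | ⟨h1, h2⟩
    · exact .inl ⟨u, by omega, h⟩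
    · refine .inr ⟨h1, fun u hu => ?_⟩
      rcases Nat.lt_succ_iff_lt_or_eq.1 hu with h' | rfl
      · exact h2 u h'
      · exact hc
  · simp [hx, a5] at hc
    refine .assign (by simp) (by simp; omega) ⟨by simp, .inl ⟨k, by omega, ?_⟩⟩
    simp [hx, hc]

theorem WDigraph.IsDist.unique_mat {G : WDigraph} {D : Fin G.n → Fin G.n → WithTop ℤ}
    (hD : ∀ u v, G.IsDist u v (D u v)) {u v : Fin G.n} {z : WithTop ℤ} (h : G.IsDist u v z) :
    z = D u v := IsGLB.unique h (hD u v)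

/-- If the distances are at most `b` or infinite, then replacing infinity by something larger than
`b` does not affect which vertices are endpoints of a diameter. -/
theorem WDigraph.isDiameterVertex_iff {G : WDigraph} {D : Fin G.n → Fin G.n → WithTop ℤ}
    (hD : ∀ u v, G.IsDist u v (D u v)) {X : Fin G.n → Fin G.n → ℤ} {big : ℤ}
    (hX : ∀ u v, (D u v = ⊤ ∧ X u v = big) ∨ (D u v = X u v ∧ X u v < big)) {m : ℤ}
    (hm : ∀ u v, X u v ≤ m) (hm' : ∃ u v, X u v = m) (u : Fin G.n) :
    G.IsDiameterVertex u ↔ ∃ v, X u v = m := by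
  have hle : ∀ u v u' v', X u v ≤ X u' v' → D u v ≤ D u' v' := by
    intro u v u' v' h
    rcases hX u' v' with h1 | h1
    · rw [h1.1]; exact le_top
    · rcases hX u v with h2 | h2
      · omega
      · rw [h1.1, h2.1]; exact_mod_cast h
  have heq : ∀ u v u' v', D u v = D u' v' → X u v = X u' v' := by
    intro u v u' v' h
    rcases hX u' v' with h1 | h1 <;> rcases hX u v with h2 | h2
    · omega
    · rw [h1.1, h2.1] at h; simp at h
    · rw [h1.1, h2.1] at h; simp at h
    · rw [h1.1, h2.1] at h; exact_mod_cast h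
  obtain ⟨u₀, v₀, h0⟩ := hm'
  have hdiam : G.IsDiameter (D u₀ v₀) := by
    refine ⟨⟨u₀, v₀, hD _ _⟩, ?_⟩
    rintro z ⟨x, y, hz⟩
    rw [IsDist.unique_mat hD hz]
    exact hle _ _ _ _ (by rw [h0]; exact hm _ _)
  constructor
  · rintro ⟨v, d, h1, h2⟩
    refine ⟨v, ?_⟩
    rw [← h0]
    apply heq
    rw [← IsDist.unique_mat hD h1]
    exact h2.unique hdiam
  · rintro ⟨v, hv⟩
    refine ⟨v, _, hD u v, ?_⟩
    rw [le_antisymm (hle u v u₀ v₀ (by omega)) (hle u₀ v₀ u v (by omega))]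
    exact hdiam

/-- The distance is at most the weight of a simple path. This bounds the sum of all distances
polynomially, so that it fits into the memory bound. -/
theorem WDigraph.dist_mem {G : WDigraph} (hG : G.NonnegWeights) {u v : Fin G.n} {d : ℤ}
    (hd : G.IsDist u v d) : 0 ≤ d ∧ d ≤ (G.n * G.maxWeight : ℕ) := by
  obtain ⟨h1, h2⟩ := (isDist_coe_iff hG).1 hd
  refine ⟨h1.nonneg hG, ?_⟩
  obtain ⟨c, l, hc, hp⟩ := h1.exists_simplePath hG.noNegCycle
  have h3 := h2 _ hp.hasWalk
  have h4 := hp.abs_le (M := G.maxWeight) (fun u v a h => by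
    rw [Int.abs_eq_natAbs]; exact_mod_cast natAbs_le_maxWeight h) (by positivity)
  have h5 : (l.length : ℤ) * G.maxWeight ≤ G.n * G.maxWeight :=
    mul_le_mul_of_nonneg_right (by exact_mod_cast hp.length_le) (by positivity)
  push_cast
  exact h3.trans ((le_abs_self c).trans (h4.trans h5))

theorem State.start_bounded (B : ℕ) (a : ℤ → ℤ) : (State.start a).Bounded B := by
  refine ⟨fun x => by simp [State.start], fun r h0 _ i => ?_⟩
  simp [State.start, Function.update_of_ne h0]

theorem rowMajor_lt {m n i j : ℕ} (hi : i < m) (hj : j < n) : i * n + j < m * n := by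
  have := Nat.mul_le_mul_right n (Nat.succ_le_of_lt hi)
  rw [Nat.succ_mul] at this
  omega

/-- Every finite distance is at most the sum `S` of all finite ones, so `1 + S` is a legitimate
substitute for infinity. The second bound on `B` makes room for `1 + S`, since there are n²
distances of size at most n times the largest weight. -/
theorem coDiameterProg_wp {O : APSP.Inst → ℤ → ℤ} {T : ℕ → ℕ → ℕ} {W B : ℕ} (h8 : 8 ≤ B)
    (hW : B ^ 40 ≤ W) (hO : IsOracle APSP O) (G : WDigraph) (hG : G.NonnegWeights) {a : ℤ → ℤ}
    (ha : HoldsGraph a G) (hB : G.n * G.n ≤ B) (hB' : 1 + G.n * G.n * (G.n * G.maxWeight) ≤ B) :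
    WP ⟨APSP, O, T, W, B, h8, hW⟩ coDiameterProg (State.start a) fun s t =>
      CoDiameter.Output ⟨G, hG⟩ (s.arr 1) ∧
        t ≤ T G.n G.maxWeight + 200 * (G.n + 1) * (G.n + 1) := by
  obtain ⟨D, hD, hHold⟩ : ∃ D : Fin G.n → Fin G.n → WithTop ℤ,
      (∀ u v, G.IsDist u v (D u v)) ∧ HoldsMatrix (O ⟨G, hG.noNegCycle⟩) 0 D := hO ⟨G, hG.noNegCycle⟩
  set A := O ⟨G, hG.noNegCycle⟩ with hA
  set b : ℕ := G.n * G.maxWeight with hb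
  have hdiv : ∀ k, k < G.n * G.n → k / G.n < G.n ∧ k % G.n < G.n ∧ k / G.n * G.n + k % G.n = k := fun k hk =>
    ⟨Nat.div_lt_of_lt_mul hk, Nat.mod_lt _ (Nat.pos_of_ne_zero fun h => by rw [h] at hk; omega),
      Nat.div_add_mod' k G.n⟩
  have hent : ∀ i j : Fin G.n, ∀ k : ℕ, (i : ℕ) * G.n + j = k →
      (D i j = ⊤ ∧ A (2 * k) = 0 ∧ A (2 * k + 1) = 0) ∨
      (D i j = A (2 * k + 1) ∧ A (2 * k) = 1 ∧ 0 ≤ A (2 * k + 1) ∧ A (2 * k + 1) ≤ b) := by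
    rintro i j k rfl
    obtain ⟨e1, e2⟩ := hHold i j
    rw [zero_add] at e1 e2
    have hdist : G.IsDist i j (D i j) := hD i j
    push_cast
    rw [e1, e2]
    cases hd : D i j with
    | top => simp
    | coe d =>
      rw [hd] at hdist
      have := WDigraph.dist_mem hG hdist
      right
      simpa [hb] using this
  have hentk : ∀ k < G.n * G.n, (A (2 * k) = 0 ∨ A (2 * k) = 1) ∧ 0 ≤ A (2 * k + 1) ∧
      A (2 * k + 1) ≤ b := by
    intro k hk
    obtain ⟨h1, h2, h3⟩ := hdiv k hk
    rcases hent ⟨_, h1⟩ ⟨_, h2⟩ k h3 with h | h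
    · rw [h.2.1, h.2.2]; simp
    · rw [h.2.1]; simp [h.2.2]
  have hsum : ∑ k ∈ Finset.range (G.n * G.n), A (2 * k + 1) ≤ (G.n * G.n) * b := by
    have := Finset.sum_le_card_nsmul (Finset.range (G.n * G.n)) (fun k : ℕ => A (2 * k + 1)) b
      fun k hk => (hentk k (by simpa using hk)).2.2
    simpa using this
  have hlt : ∀ k < G.n * G.n, A (2 * k + 1) ≤ ∑ k ∈ Finset.range (G.n * G.n), A (2 * k + 1) :=
    fun k hk => Finset.single_le_sum (f := fun k : ℕ => A (2 * k + 1))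
      (fun i hi => (hentk i (by simpa using hi)).2.1) (by simpa using hk)
  have hsum0 : 0 ≤ ∑ k ∈ Finset.range (G.n * G.n), A (2 * k + 1) :=
    Finset.sum_nonneg fun i hi => (hentk i (by simpa using hi)).2.1
  set S := ∑ k ∈ Finset.range (G.n * G.n), A (2 * k + 1) with hS
  have hB1 : (G.n : ℤ) * G.n ≤ B := by exact_mod_cast hB
  have hB2 : 1 + ((G.n : ℤ) * G.n) * b ≤ B := by exact_mod_cast hB'
  have hnB : (G.n : ℤ) ≤ B := by nlinarith [(by positivity : (0 : ℤ) ≤ G.n)]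
  have hn0 : (0 : ℤ) ≤ G.n := by positivity
  have hnn0 : (0 : ℤ) ≤ G.n * G.n := by positivity
  have hh8 : (8 : ℤ) ≤ B := by exact_mod_cast h8
  have ha0 : a 0 = G.n := ha.1
  refine .seq (.call (⟨G, hG.noNegCycle⟩ : APSP.Inst) (show HoldsGraph ((State.start a).arr 0) G by simpa [State.start] using ha) ?_)
  change WP _ _ ((State.start a).setArr 3 A) _
  set s0 := (State.start a).setArr 3 A with hs0
  have s0r : ∀ x, s0.reg x = 0 := fun x => rfl
  have s0a0 : s0.arr 0 = a := by simp [hs0, State.start]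
  have s0a3 : s0.arr 3 = A := by simp [hs0]
  have s0a5 : s0.arr 5 = fun _ => 0 := by simp [hs0, State.start]
  clear_value s0
  refine .assign_seq (by simp [s0a0, ha0]; omega) (by simp [s0a0, ha0]; omega) ?_
  refine .assign_seq (by simp) (by simp [s0a0, ha0]; omega) ?_
  refine .assign_seq (by simp) (by simp; omega) ?_
  simp only [Expr.eval_cell, Expr.eval_ofNat, Expr.eval_mul, Expr.eval_reg, State.reg_setReg,
    s0a0, ha0, Nat.cast_zero, Nat.cast_one, if_true]
  refine .seq (sumProg_wp (N := G.n * G.n) (V := fun k => A (2 * k + 1)) (by simp) (by simp)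
    (fun k _ => by simp [s0a3]) (fun k hk => (hentk k hk).2.1) (by simp; omega) ?_)
  intro s1 t1 f1 r12 ht1
  have r10 := f1.1 0 (by decide)
  have r11 := f1.1 1 (by decide)
  have a13 := f1.2 3 (by decide)
  have a15 := f1.2 5 (by decide)
  simp at r10 r11 a13 a15
  refine .assign_seq (by simp) (by simp) ?_
  refine .seq (maxProg_wp (N := G.n * G.n) (F := fun k => A (2 * k)) (V := fun k => A (2 * k + 1))
    (X := fun k => if A (2 * k) = 0 then 1 + S else A (2 * k + 1)) (big := 1 + S)
    (by simp [r11]) (by simpa using r12) (by simp)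
    (fun k _ => by simp [a13, s0a3]) (fun k _ => by simp [a13, s0a3]) (fun k _ => rfl)
    (fun k hk => (hentk k hk).1) (fun k hk => ⟨(hentk k hk).2.1, by
      have := hlt k hk; simp; omega⟩) (by omega) ?_)
  intro s2 t2 f2 x2 m2 m2' ht2
  have r20 := f2.1 0 (by decide)
  have r21 := f2.1 1 (by decide)
  have a25 := f2.2 5 (by decide)
  simp [r10, r11, a15, s0a5] at r20 r21 a25
  set X : ℕ → ℤ := fun k => if A (2 * k) = 0 then 1 + S else A (2 * k + 1) with hX
  refine .seq (markProg_wp (n := G.n) (X := X) r20 (by simp [r21]) x2 (by simp [a25]) ?_)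
  intro s3 t3 f3 h3 ht3
  have r30 := f3.1 0 (by decide)
  rw [r20] at r30
  refine .assign_seq (by simp) (by simp; omega) ?_
  refine .seq (findProg_wp (n := G.n) (by simp [r30]) (by simp) ?_)
  intro s4 t4 f4 h4 ht4
  refine .of_bounded fun hbd => ?_
  refine .store (by simp) (by simp) (hbd.1 4) ?_
  have hXD : ∀ u v : Fin G.n, (D u v = ⊤ ∧ X (u * G.n + v) = 1 + S) ∨
      (D u v = X (u * G.n + v) ∧ X (u * G.n + v) < 1 + S) := by
    intro u v
    have huv : (u : ℕ) * G.n + v < G.n * G.n := rowMajor_lt u.2 v.2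
    have := hlt _ huv
    rcases hent u v _ rfl with h | h
    · left; simp only [hX]; rw [if_pos h.2.1]; exact ⟨h.1, rfl⟩
    · right; simp only [hX]; rw [if_neg (by rw [h.2.1]; simp)]; exact ⟨h.1, by omega⟩
  have hrow : ∀ u : Fin G.n, (∃ k < G.n * G.n, X k = s2.reg 3 ∧ k / G.n = u) ↔
      ∃ v : Fin G.n, X (u * G.n + v) = s2.reg 3 := by
    intro u
    constructor
    · rintro ⟨k, hk, h1, h2⟩
      obtain ⟨g1, g2, g3⟩ := hdiv k hk
      exact ⟨⟨_, g2⟩, by simp only; rw [← h2, g3, h1]⟩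
    · rintro ⟨v, hv⟩
      have h1 := u.2
      have h2 := v.2
      refine ⟨_, rowMajor_lt h1 h2, hv, ?_⟩
      rw [mul_comm, Nat.mul_add_div (by omega), Nat.div_eq_of_lt h2, add_zero]
  have hvert : ∀ u : Fin G.n, G.IsDiameterVertex u ↔ s3.arr 5 ((u : ℕ) : ℤ) ≠ 0 := by
    intro u
    have hu := u.2
    rw [h3, hrow]
    refine WDigraph.isDiameterVertex_iff (D := D) hD (X := fun u v => X (u * G.n + v)) hXD
      (fun u v => m2 _ ?_) ?_ u
    · exact rowMajor_lt u.2 v.2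
    · obtain ⟨k, hk, h⟩ := m2' (by have := Nat.mul_self_le_mul_self (Nat.one_le_of_lt hu); omega)
      obtain ⟨g1, g2, g3⟩ := hdiv k hk
      exact ⟨⟨_, g1⟩, ⟨_, g2⟩, by simp only; rw [g3]; exact h⟩
  have hout : ∀ r : ℤ → ℤ, r 0 = s4.reg 4 → CoDiameter.Output ⟨G, hG⟩ r := by
    intro r hr
    rcases h4 with ⟨u, hu, h5, h6⟩ | ⟨h5, h6⟩
    · refine Or.inl ⟨⟨u, hu⟩, by rw [hr, h5], ?_⟩
      rw [hvert]; simpa using h6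
    · exact Or.inr ⟨by rw [hr, h5], fun u => (hvert u).2 (h6 u u.2)⟩
  refine ⟨hout _ (by simp), ?_⟩
  simp only [Expr.cost_cell, Expr.cost_ofNat, Expr.cost_mul, Expr.cost_reg, Expr.cost_const]
  change 1 + T G.n G.maxWeight + _ ≤ _
  have : 200 * (G.n + 1) * (G.n + 1) = 200 * (G.n * G.n) + 400 * G.n + 200 := by ring
  omega

end

/-- CoDiameter reduces to all-pairs shortest paths. -/
theorem coDiameter_reducible_APSP : SubcubicReducible CoDiameter APSP := by
  -- The memory bound is `(n + 2) ^ (c + 4)`: the sum of the distances contributes n³ times the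
  -- largest weight. Expressions of degree up to 40 account for the factor 40.
  refine ⟨coDiameterProg, fun c => ⟨(c + 4) * 40, fun T hT => ?_⟩⟩
  obtain ⟨ε, hε, C, hC⟩ := hT c
  -- Capping ε at 1 keeps the exponent at least 2, so that the quadratic work outside the call is
  -- covered.
  refine ⟨min ε 1, by positivity, |C| + 200, fun O hO x hx a ha => ?_⟩
  obtain ⟨G, hG⟩ := x
  change G.maxWeight ≤ (G.n + 2) ^ c at hx
  have hp : (G.n + 2) ^ (c + 4) = (G.n + 2) ^ c * (G.n + 2) ^ 4 := pow_add _ _ _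
  have hc1 : 1 ≤ (G.n + 2) ^ c := Nat.one_le_pow _ _ (by omega)
  have h16 : 16 ≤ (G.n + 2) ^ 4 := (by norm_num : 16 ≤ 2 ^ 4).trans
    (Nat.pow_le_pow_left (by omega) 4)
  have hnn : G.n * G.n ≤ (G.n + 2) ^ 4 := by nlinarith [Nat.zero_le (G.n * G.n * G.n)]
  have hn3 : 1 + G.n * G.n * G.n ≤ (G.n + 2) ^ 4 := by
    nlinarith [Nat.zero_le (G.n * G.n * G.n), Nat.zero_le (G.n * G.n * G.n * G.n)]
  obtain ⟨s, t, h1, -, -, h2, h3⟩ := coDiameterProg_wp (T := T) (W := (G.n + 2) ^ ((c + 4) * 40))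
    (B := (G.n + 2) ^ (c + 4)) (by rw [hp]; nlinarith) (by rw [pow_mul]) hO G hG ha
    (by rw [hp]; nlinarith)
    (by
      rw [hp]
      have : G.n * G.n * (G.n * G.maxWeight) ≤ (G.n + 2) ^ c * (G.n * G.n * G.n) := by
        calc G.n * G.n * (G.n * G.maxWeight) = G.maxWeight * (G.n * G.n * G.n) := by ring
          _ ≤ _ := Nat.mul_le_mul_right _ hx
      nlinarith)
    (State.start_bounded _ a)
  refine ⟨s, t, h1, h2, ?_⟩
  change (t : ℝ) ≤ (|C| + 200) * ((G.n : ℝ) + 1) ^ (3 - min ε 1)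
  have hn1 : (1 : ℝ) ≤ (G.n : ℝ) + 1 := by linarith [(by positivity : (0 : ℝ) ≤ G.n)]
  have e1 : ((G.n : ℝ) + 1) ^ (3 - ε) ≤ ((G.n : ℝ) + 1) ^ (3 - min ε 1) :=
    Real.rpow_le_rpow_of_exponent_le hn1 (by linarith [min_le_left ε 1])
  have e2 : ((G.n : ℝ) + 1) ^ (2 : ℝ) ≤ ((G.n : ℝ) + 1) ^ (3 - min ε 1) :=
    Real.rpow_le_rpow_of_exponent_le hn1 (by linarith [min_le_right ε 1])
  have e3 : (t : ℝ) ≤ T G.n G.maxWeight + 200 * ((G.n : ℝ) + 1) ^ (2 : ℝ) := by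
    rw [Real.rpow_two]
    have : (t : ℝ) ≤ ((T G.n G.maxWeight + 200 * (G.n + 1) * (G.n + 1) : ℕ) : ℝ) := by
      exact_mod_cast h3
    push_cast at this
    linarith
  have e4 := hC G.n G.maxWeight hx
  have e5 : C * ((G.n : ℝ) + 1) ^ (3 - ε) ≤ |C| * ((G.n : ℝ) + 1) ^ (3 - min ε 1) :=
    (mul_le_mul_of_nonneg_right (le_abs_self C) (by positivity)).trans
      (mul_le_mul_of_nonneg_left e1 (abs_nonneg C))
  linarith

/-! ### Searching a block for negative triangles -/

/-- The weight of the edge from register `29` to register `30` of the triangle graph, in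
register `31`. -/
def weightProg : Prog :=
  .ite (.lt (reg 29) (reg 1))
    (.ite (.lt (reg 30) (reg 1)) (.assign 31 (3 * reg 12 - 1))
      (.ite (.lt (reg 30) (2 * reg 1))
        (.assign 31 (reg 12 + cell 4 ((reg 26 + reg 29) * reg 2 + (reg 28 + (reg 30 - reg 1)))))
        (.ite (reg 30 - (reg 29 + 3 * reg 1)) (.assign 31 (3 * reg 12 - 1))
          (.assign 31 (3 * reg 12)))))
    (.ite (.lt (reg 29) (2 * reg 1))
      (.ite (.lt (reg 30) (2 * reg 1)) (.assign 31 (3 * reg 12))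
        (.ite (.lt (reg 30) (3 * reg 1))
          (.assign 31 (reg 12 +
            cell 4 ((reg 28 + (reg 29 - reg 1)) * reg 2 + (reg 27 + (reg 30 - 2 * reg 1)))))
          (.assign 31 (3 * reg 12))))
      (.ite (.lt (reg 29) (3 * reg 1))
        (.ite (.lt (reg 30) (3 * reg 1)) (.assign 31 (3 * reg 12))
          (.ite (.lt (reg 30) (4 * reg 1))
            (.assign 31 (reg 12 - (cell 5 ((reg 26 + (reg 30 - 3 * reg 1)) * reg 2 +
              (reg 27 + (reg 29 - 2 * reg 1))) - reg 9)))
            (.assign 31 (3 * reg 12))))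
        (.assign 31 (3 * reg 12))))

/-- Store the triangle graph of the block in array `2`. -/
def buildProg : Prog :=
  .seq (.store 2 0 (reg 10)) <| .forTo 24 11 <|
  .seq (.assign 29 (reg 24 / reg 10)) <|
  .seq (.assign 30 (reg 24 - reg 29 * reg 10)) <|
  .seq weightProg <|
  .seq (.store 2 (2 * reg 24 + 1) 1) (.store 2 (2 * reg 24 + 2) (reg 31))

/-- Lower the entries of array `5` in the row given by register `33` that are too large because of
the block. -/
def rowProg : Prog :=
  .forTo 25 13 <|
  .seq (.assign 29 (reg 25 / reg 1)) <|
  .seq (.assign 30 (reg 25 - reg 29 * reg 1)) <|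
  .seq (.assign 31 (cell 5 (reg 33 * reg 2 + (reg 27 + reg 29)) - reg 9)) <|
  .ite (.lt (cell 4 (reg 33 * reg 2 + (reg 28 + reg 30)) +
      cell 4 ((reg 28 + reg 30) * reg 2 + (reg 27 + reg 29))) (reg 31))
    (.store 5 (reg 33 * reg 2 + (reg 27 + reg 29)) (reg 31)) .skip

/-- The registers that hold the sizes. -/
structure Sizes (σ : ℕ) (R : ℤ) (s : State) : Prop where
  r1 : s.reg 1 = σ
  r2 : s.reg 2 = (σ ^ 3 : ℕ)
  r3 : s.reg 3 = (σ ^ 3 * σ ^ 3 : ℕ)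
  r10 : s.reg 10 = (4 * σ + 1 : ℕ)
  r11 : s.reg 11 = ((4 * σ + 1) * (4 * σ + 1) : ℕ)
  r12 : s.reg 12 = 4 * R
  r13 : s.reg 13 = (σ * σ : ℕ)

theorem Sizes.congr {σ : ℕ} {R : ℤ} {s s' : State} (h : Sizes σ R s)
    (h' : ∀ x ∈ [1, 2, 3, 10, 11, 12, 13], s'.reg x = s.reg x) : Sizes σ R s' := by
  simp only [List.mem_cons, List.not_mem_nil, or_false, forall_eq_or_imp, forall_eq] at h'
  obtain ⟨h1, h2, h3, h4, h5, h6, h7⟩ := h'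
  exact ⟨h1 ▸ h.r1, h2 ▸ h.r2, h3 ▸ h.r3, h4 ▸ h.r10, h5 ▸ h.r11, h6 ▸ h.r12, h7 ▸ h.r13⟩

theorem Sizes.of_frame {σ : ℕ} {R : ℤ} {s s' : State} {p : Prog} (h : Sizes σ R s)
    (hF : p.Frame s s') (hp : ∀ x ∈ [1, 2, 3, 10, 11, 12, 13], x ∉ p.regs) : Sizes σ R s' :=
  h.congr fun x hx => hF.1 x (hp x hx)

/-- The matrix that is stored in an array in row-major order. -/
def mat (a : ℤ → ℤ) (m : ℤ) (i j : ℤ) : ℤ := a (i * m + j)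

section

variable {E : Env} {s : State} {Q : State → ℕ → Prop} {σ : ℕ} {R h : ℤ} {p q r : ℤ}

/-- The matrices and numbers of the block in memory, with bounds for their sizes. -/
structure Block (E : Env) (σ : ℕ) (R h p q r : ℤ) (s : State) : Prop where
  sizes : Sizes σ R s
  r9 : s.reg 9 = h
  r26 : s.reg 26 = p
  r27 : s.reg 27 = q
  r28 : s.reg 28 = r
  pos : 0 < R
  h_pos : 0 < h
  h_le : h ≤ R
  le : 12 * R ≤ E.B
  sq_le : (4 * σ + 1) * (4 * σ + 1) ≤ E.B
  a4 : ∀ c, -R ≤ s.arr 4 c ∧ s.arr 4 c ≤ R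
  a5 : ∀ c, -(2 * R) ≤ s.arr 5 c ∧ s.arr 5 c ≤ R

theorem Block.of_frame {s' : State} {P : Prog} (hb : Block E σ R h p q r s) (hF : P.Frame s s')
    (hp : ∀ x ∈ [1, 2, 3, 10, 11, 12, 13], x ∉ P.regs)
    (hp' : ∀ x ∈ [9, 26, 27, 28], x ∉ P.regs) (h4 : 4 ∉ P.arrs)
    (h5 : ∀ c, -(2 * R) ≤ s'.arr 5 c ∧ s'.arr 5 c ≤ R) : Block E σ R h p q r s' where
  sizes := hb.sizes.of_frame hF hp
  r9 := (hF.1 9 (hp' 9 (by simp))).trans hb.r9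
  r26 := (hF.1 26 (hp' 26 (by simp))).trans hb.r26
  r27 := (hF.1 27 (hp' 27 (by simp))).trans hb.r27
  r28 := (hF.1 28 (hp' 28 (by simp))).trans hb.r28
  pos := hb.pos
  h_pos := hb.h_pos
  h_le := hb.h_le
  le := hb.le
  sq_le := hb.sq_le
  a4 := by rw [hF.2 4 h4]; exact hb.a4
  a5 := h5

/-- The triangle graph of the block. -/
def Block.graph (σ : ℕ) (R h p q r : ℤ) (s : State) : WDigraph :=
  triangleGraph σ (4 * R) (fun x z => mat (s.arr 4) (σ ^ 3 : ℕ) (p + x) (r + z))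
    (fun z y => mat (s.arr 4) (σ ^ 3 : ℕ) (r + z) (q + y))
    (fun x y => mat (s.arr 5) (σ ^ 3 : ℕ) (p + x) (q + y) - h)

/-- Entries of array `4` are at most `R` in absolute value, and entries of array `5` minus `h` lie
between `-3 * R` and `R`, so `K = 4 * R` dominates both strictly. The weights of the graph then
reach `3 * K = 12 * R`, which explains the field `Block.le`. -/
theorem Block.bounds (hb : Block E σ R h p q r s) :
    TriangleBounds σ (4 * R) (fun x z => mat (s.arr 4) (σ ^ 3 : ℕ) (p + x) (r + z))
    (fun z y => mat (s.arr 4) (σ ^ 3 : ℕ) (r + z) (q + y))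
    (fun x y => mat (s.arr 5) (σ ^ 3 : ℕ) (p + x) (q + y) - h) := by
  have h1 := hb.pos
  have h2 := hb.h_pos
  have h3 := hb.h_le
  refine ⟨fun x z _ _ _ _ => ?_, fun x z _ _ _ _ => ?_, fun x z _ _ _ _ => ?_⟩
  · have := hb.a4 ((p + x) * (σ ^ 3 : ℕ) + (r + z)); simp only [mat]; omega
  · have := hb.a4 ((r + x) * (σ ^ 3 : ℕ) + (q + z)); simp only [mat]; omega
  · have := hb.a5 ((p + x) * (σ ^ 3 : ℕ) + (q + z)); simp only [mat]; omega

/-- The branches take different times. The postcondition is therefore required at time 0 only, and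
`hmono` transfers it to any time up to 60. -/
theorem weightProg_wp (hb : Block E σ R h p q r s) {x y : ℤ} (hx : s.reg 29 = x)
    (hy : s.reg 30 = y)
    (hQ : Q (s.setReg 31 (triangleWeight σ (4 * R)
      (fun x z => mat (s.arr 4) (σ ^ 3 : ℕ) (p + x) (r + z))
      (fun z y => mat (s.arr 4) (σ ^ 3 : ℕ) (r + z) (q + y))
      (fun x y => mat (s.arr 5) (σ ^ 3 : ℕ) (p + x) (q + y) - h) x y)) 0)
    (hmono : ∀ s' t, t ≤ 60 → Q s' 0 → Q s' t) : WP E weightProg s Q := by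
  have b0 := hb.pos
  have b1 := hb.h_pos
  have b2 := hb.h_le
  have b3 := hb.le
  have e1 := hb.sizes.r1
  have e2 := hb.sizes.r2
  have e12 := hb.sizes.r12
  have e9 := hb.r9
  have e26 := hb.r26
  have e27 := hb.r27
  have e28 := hb.r28
  have b4 := hb.a4
  have b5 := hb.a5
  unfold triangleWeight at hQ
  refine .ite_lt (by simp) (by simp) (fun c1 => ?_) (fun c1 => ?_) <;>
    simp only [Expr.eval_reg, hx, e1] at c1
  · rw [if_pos c1] at hQ
    refine .ite_lt (by simp) (by simp) (fun c2 => ?_) (fun c2 => ?_) <;>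
      simp only [Expr.eval_reg, hy, e1] at c2
    · rw [if_pos c2] at hQ
      refine .assign (by simp) (by simp [e12]; omega) (hmono _ _ (by simp) ?_)
      simpa [e12] using hQ
    · rw [if_neg (by omega)] at hQ
      refine .ite_lt (by simp) (by simp) (fun c3 => ?_) (fun c3 => ?_) <;>
        simp [hy, e1] at c3
      · rw [if_pos c3] at hQ
        refine .assign (by simp) ?_ (hmono _ _ (by simp) ?_)
        · simp [e12, hx, hy]; have := b4 ((s.reg 26 + x) * s.reg 2 + (s.reg 28 + (y - s.reg 1)))
          omega
        · simpa [e12, hx, hy, e1, e2, e26, e28, mat] using hQ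
      · rw [if_neg (by omega)] at hQ
        refine .ite (by simp) (fun c4 => ?_) (fun c4 => ?_) <;> simp [hx, hy, e1] at c4
        · rw [if_neg (by omega)] at hQ
          refine .assign (by simp) (by simp [e12]; omega) (hmono _ _ (by simp) ?_)
          simpa [e12] using hQ
        · rw [if_pos (by omega)] at hQ
          refine .assign (by simp) (by simp [e12]; omega) (hmono _ _ (by simp) ?_)
          simpa [e12] using hQ
  · rw [if_neg (by omega)] at hQ
    refine .ite_lt (by simp) (by simp) (fun c2 => ?_) (fun c2 => ?_) <;> simp [hx, e1] at c2
    · rw [if_pos c2] at hQ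
      refine .ite_lt (by simp) (by simp) (fun c3 => ?_) (fun c3 => ?_) <;> simp [hy, e1] at c3
      · rw [if_neg (by omega)] at hQ
        refine .assign (by simp) (by simp [e12]; omega) (hmono _ _ (by simp) ?_)
        simpa [e12] using hQ
      refine .ite_lt (by simp) (by simp) (fun c4 => ?_) (fun c4 => ?_) <;> simp [hy, e1] at c4
      · rw [if_pos (by omega)] at hQ
        refine .assign (by simp) ?_ (hmono _ _ (by simp) ?_)
        · simp [e12, hx, hy]
          have := b4 ((s.reg 28 + (x - s.reg 1)) * s.reg 2 + (s.reg 27 + (y - 2 * s.reg 1)))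
          omega
        · simpa [e12, hx, hy, e1, e2, e27, e28, mat] using hQ
      · rw [if_neg (by omega)] at hQ
        refine .assign (by simp) (by simp [e12]; omega) (hmono _ _ (by simp) ?_)
        simpa [e12] using hQ
    · rw [if_neg (by omega)] at hQ
      refine .ite_lt (by simp) (by simp) (fun c3 => ?_) (fun c3 => ?_) <;> simp [hx, e1] at c3
      · rw [if_pos c3] at hQ
        refine .ite_lt (by simp) (by simp) (fun c4 => ?_) (fun c4 => ?_) <;> simp [hy, e1] at c4
        · rw [if_neg (by omega)] at hQ
          refine .assign (by simp) (by simp [e12]; omega) (hmono _ _ (by simp) ?_)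
          simpa [e12] using hQ
        refine .ite_lt (by simp) (by simp) (fun c5 => ?_) (fun c5 => ?_) <;> simp [hy, e1] at c5
        · rw [if_pos (by omega)] at hQ
          refine .assign (by simp) ?_ (hmono _ _ (by simp) ?_)
          · simp [e12, hx, hy, e9]
            have := b5 ((s.reg 26 + (y - 3 * s.reg 1)) * s.reg 2 +
              (s.reg 27 + (x - 2 * s.reg 1)))
            omega
          · simpa [e12, hx, hy, e1, e2, e26, e27, e9, mat] using hQ
        · rw [if_neg (by omega)] at hQ
          refine .assign (by simp) (by simp [e12]; omega) (hmono _ _ (by simp) ?_)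
          simpa [e12] using hQ
      · rw [if_neg (by omega)] at hQ
        refine .assign (by simp) (by simp [e12]; omega) (hmono _ _ (by simp) ?_)
        simpa [e12] using hQ

theorem Block.congr {s' : State} (hb : Block E σ R h p q r s)
    (h' : ∀ x ∈ [1, 2, 3, 10, 11, 12, 13, 9, 26, 27, 28], s'.reg x = s.reg x)
    (h4 : s'.arr 4 = s.arr 4) (h5 : s'.arr 5 = s.arr 5) : Block E σ R h p q r s' where
  sizes := hb.sizes.congr fun x hx => h' x (by simp at hx ⊢; tauto)
  r9 := (h' 9 (by simp)).trans hb.r9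
  r26 := (h' 26 (by simp)).trans hb.r26
  r27 := (h' 27 (by simp)).trans hb.r27
  r28 := (h' 28 (by simp)).trans hb.r28
  pos := hb.pos
  h_pos := hb.h_pos
  h_le := hb.h_le
  le := hb.le
  sq_le := hb.sq_le
  a4 := h4 ▸ hb.a4
  a5 := h5 ▸ hb.a5

theorem rowMajor_div {n i j : ℕ} (hj : j < n) : (i * n + j) / n = i := by
  rw [mul_comm, Nat.mul_add_div (by omega), Nat.div_eq_of_lt hj, add_zero]

theorem rowMajor_mod {n i j : ℕ} (hj : j < n) : (i * n + j) % n = j := by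
  rw [mul_comm, Nat.mul_add_mod, Nat.mod_eq_of_lt hj]

theorem natCast_sub_ediv_mul (k v : ℕ) : (k : ℤ) - ((k / v : ℕ) : ℤ) * v = (k % v : ℕ) := by
  have := Nat.div_add_mod' k v
  have h2 : ((k / v : ℕ) : ℤ) * v + (k % v : ℕ) = k := by exact_mod_cast this
  linarith

theorem buildProg_wp (hb : Block E σ R h p q r s) (hσ : 0 < σ)
    (hQ : ∀ s' t, buildProg.Frame s s' → HoldsGraph (s'.arr 2) (Block.graph σ R h p q r s) →
      t ≤ (4 * σ + 1) * (4 * σ + 1) * 108 + 9 → Q s' t) : WP E buildProg s Q := by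
  have e10 := hb.sizes.r10
  have e11 := hb.sizes.r11
  have b3 := hb.le
  have b0 := hb.pos
  have hB := E.eight_le
  have hbounds := hb.bounds
  set tw : ℤ → ℤ → ℤ := triangleWeight σ (4 * R)
      (fun x z => mat (s.arr 4) (σ ^ 3 : ℕ) (p + x) (r + z))
      (fun z y => mat (s.arr 4) (σ ^ 3 : ℕ) (r + z) (q + y))
      (fun x y => mat (s.arr 5) (σ ^ 3 : ℕ) (p + x) (q + y) - h) with htw
  have hgraph : ∀ u v : Fin (Block.graph σ R h p q r s).n,
      (Block.graph σ R h p q r s).w u v = (tw (u : ℕ) (v : ℕ) : WithTop ℤ) := fun u v => rfl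
  have hsq := hb.sq_le
  obtain ⟨v, hv⟩ : ∃ v, v = 4 * σ + 1 := ⟨_, rfl⟩
  rw [← hv] at e10 e11 hsq hQ
  have hvB : v ≤ E.B := le_trans (by nlinarith) hsq
  refine .of_frame (.store_seq (by simp) (by simp) (by simp [e10]; omega) ?_)
  simp only [Expr.eval_ofNat, Expr.eval_reg, e10, Nat.cast_zero]
  have hb0 : Block E σ R h p q r (s.setCell 2 0 v) :=
    hb.congr (by simp) (by simp [State.arr_setCell]) (by simp [State.arr_setCell])
  refine .forTo_le (v * v) 100 (fun k s' => s'.arr 2 0 = v ∧ ∀ i < k, s'.arr 2 (2 * i + 1) = 1 ∧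
    s'.arr 2 (2 * i + 2) = tw (i / v : ℕ) (i % v : ℕ)) (by simpa using e11) (by decide)
    (by simp) ?_ ?_
  · rintro k s' hk ⟨i0, i1⟩ hx hFr
    have hkB : k / v ≤ E.B := (Nat.div_le_self _ _).trans (by omega)
    have hkm := natCast_sub_ediv_mul k v
    have hkm2 : k % v < v := Nat.mod_lt _ (by omega)
    have hkv : (k : ℤ) / v = (k / v : ℕ) := by push_cast; rfl
    have g4 : s'.arr 4 = s.arr 4 := by rw [hFr.2 4 (by decide)]; simp [State.arr_setCell]
    have g5 : s'.arr 5 = s.arr 5 := by rw [hFr.2 5 (by decide)]; simp [State.arr_setCell]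
    have hb1 : Block E σ R h p q r s' :=
      hb0.of_frame hFr (by decide) (by decide) (by decide) (by rw [g5]; exact hb.a5)
    have g10 : s'.reg 10 = v := by rw [hb1.sizes.r10, hv]
    have hb' : Block E σ R h p q r ((s'.setReg 29 (k / v : ℕ)).setReg 30 (k % v : ℕ)) :=
      hb1.congr (by simp) rfl rfl
    have htwB := hbounds.weight_mem hσ (x := (k / v : ℕ)) (y := (k % v : ℕ)) (by positivity)
    rw [← htw] at htwB
    have hkz : (k : ℤ) % v = (k % v : ℕ) := by push_cast; rfl
    -- From here on row and column are opaque numbers, which keeps the arithmetic linear.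
    generalize k / v = y at *
    generalize k % v = z at *
    refine .assign_seq (by simp) (by simp only [Expr.eval_div, Expr.eval_reg, hx, g10, hkv]; omega) ?_
    simp only [Expr.eval_div, Expr.eval_reg, hx, g10, hkv]
    refine .assign_seq (by simp) (by simp [hx, g10, hkm]; omega) ?_
    simp [hx, g10, hkm, -Nat.cast_ite]
    refine .seq ((weightProg_wp (Q := fun s'' t => t ≤ 60 ∧
      s'' = ((s'.setReg 29 y).setReg 30 z).setReg 31 (tw y z)) hb' (x := y) (y := z)
      (by simp) (by simp) ?_ ?_).mono ?_)
    · simp only [State.arr_setReg, g4, g5, htw]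
      exact ⟨by simp, trivial⟩
    · exact fun _ _ h1 h2 => ⟨h1, h2.2⟩
    rintro _ t1 - - ⟨ht1, rfl⟩
    refine .store_seq (by simp) (by simp) (by simp; omega) ?_
    refine .store (by simp) (by simp) (by simp; omega) ?_
    simp [hx, Function.update_apply]
    -- Pair `k` occupies the cells `2 * k + 1` and `2 * k + 2`, so neither the number of vertices in
    -- cell 0 nor an earlier pair is overwritten.
    refine ⟨by omega, by rw [if_neg (by omega), if_neg (by omega), i0], fun i hi => ?_⟩
    rw [if_neg (by omega)]
    by_cases hik : i = k
    · subst hik; simp [hkv, hkz]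
    · rw [if_neg hik, if_neg hik, if_neg (by omega)]
      simpa using i1 i (by omega)
  · rintro s' t ⟨i0, i1⟩ - - ht hF
    refine hQ s' _ hF ⟨?_, ?_⟩ (by simp; omega)
    · rw [i0, hv]; rfl
    · intro i j
      have hi : (i : ℕ) < 4 * σ + 1 := i.2
      have hj : (j : ℕ) < 4 * σ + 1 := j.2
      rw [← hv] at hi hj
      obtain ⟨g1, g2⟩ := i1 _ (rowMajor_lt hi hj)
      rw [rowMajor_div hj, rowMajor_mod hj] at g2
      have hn : (((Block.graph σ R h p q r s).n : ℕ) : ℤ) = v := by rw [hv]; rfl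
      rw [hgraph, if_neg (WithTop.coe_ne_top), WithTop.untopD_coe, hn]
      push_cast at g1 g2
      exact ⟨(congrArg _ (by ring)).trans g1, (congrArg _ (by ring)).trans g2⟩

end

section

variable {E : Env} {s : State} {Q : State → ℕ → Prop} {σ : ℕ} {R h : ℤ} {p q r : ℤ}

/-- What happens to array `5` (from `u` to `u'`) when the row `i` is updated. -/
structure RowUpdate (σ : ℕ) (h i q r : ℤ) (a u u' : ℤ → ℤ) : Prop where
  step : ∀ c, u' c = u c ∨ u' c ≤ u c - h
  reason : ∀ c, u' c ≠ u c → ∃ y < σ, ∃ z < σ, c = i * (σ ^ 3 : ℕ) + (q + y) ∧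
    mat a (σ ^ 3 : ℕ) i (r + z) + mat a (σ ^ 3 : ℕ) (r + z) (q + y) < u' c
  found : ∀ y z : ℕ, y < σ → z < σ →
    mat a (σ ^ 3 : ℕ) i (r + z) + mat a (σ ^ 3 : ℕ) (r + z) (q + y) <
      mat u (σ ^ 3 : ℕ) i (q + y) - h →
    mat u' (σ ^ 3 : ℕ) i (q + y) ≤ mat u (σ ^ 3 : ℕ) i (q + y) - h

/-- Each entry is compared in its current state and may be lowered several times. A new value always
exceeds a sum of two entries of array `4`; this keeps it above `-2 * R` and later yields that it
exceeds the entry of the square. -/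
theorem rowProg_wp (hb : Block E σ R h p q r s) {i : ℤ} (hi : s.reg 33 = i)
    (hQ : ∀ s' t, rowProg.Frame s s' → Block E σ R h p q r s' →
      RowUpdate σ h i q r (s.arr 4) (s.arr 5) (s'.arr 5) → t ≤ (σ * σ) * 98 + 6 → Q s' t) :
    WP E rowProg s Q := by
  have b0 := hb.pos
  have b1 := hb.h_pos
  have b2 := hb.h_le
  have b3 := hb.le
  have hB := E.eight_le
  have hσB : σ * σ ≤ E.B := by have := hb.sq_le; nlinarith
  set a := s.arr 4 with ha
  set u := s.arr 5 with hu
  set m : ℤ := ((σ ^ 3 : ℕ) : ℤ) with hm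
  have b4 := hb.a4
  rw [← ha] at b4
  refine .forTo_le (σ * σ) 90 (fun k s' => (∀ c, -(2 * R) ≤ s'.arr 5 c ∧ s'.arr 5 c ≤ R) ∧
    (∀ c, s'.arr 5 c = u c ∨ s'.arr 5 c ≤ u c - h) ∧
    (∀ c, s'.arr 5 c ≠ u c → ∃ y < σ, ∃ z < σ, c = i * m + (q + y) ∧
      a (i * m + (r + z)) + a ((r + z) * m + (q + y)) < s'.arr 5 c) ∧
    (∀ l < k, a (i * m + (r + (l % σ : ℕ))) + a ((r + (l % σ : ℕ)) * m + (q + (l / σ : ℕ))) <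
        u (i * m + (q + (l / σ : ℕ))) - h →
      s'.arr 5 (i * m + (q + (l / σ : ℕ))) ≤ u (i * m + (q + (l / σ : ℕ))) - h))
    hb.sizes.r13 (by decide) ?_ ?_ ?_
  · exact ⟨hb.a5, fun c => .inl rfl, fun c hc => absurd rfl hc, fun l hl => absurd hl (by omega)⟩
  · rintro k s' hk ⟨i0, i1, i2, i3⟩ hx hF
    have hb1 : Block E σ R h p q r s' :=
      hb.of_frame hF (by decide) (by decide) (by decide) i0
    have g4 : s'.arr 4 = a := hF.2 4 (by decide)
    have g33 : s'.reg 33 = i := (hF.1 33 (by decide)).trans hi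
    have g1 := hb1.sizes.r1
    have g2 : s'.reg 2 = m := hb1.sizes.r2
    have g9 := hb1.r9
    have g27 := hb1.r27
    have g28 := hb1.r28
    have hkB : k / σ ≤ E.B := (Nat.div_le_self _ _).trans (by omega)
    have hσ0 : 0 < σ := Nat.pos_of_ne_zero (by rintro rfl; simp at hk)
    have hy : k / σ < σ := Nat.div_lt_of_lt_mul hk
    have hz : k % σ < σ := Nat.mod_lt _ hσ0
    have hkm := natCast_sub_ediv_mul k σ
    have hkv : (k : ℤ) / σ = (k / σ : ℕ) := by push_cast; rfl
    have hkz : (k : ℤ) % σ = (k % σ : ℕ) := by push_cast; rfl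
    generalize hyk : k / σ = y at *
    generalize hzk : k % σ = z at *
    have hσB2 : σ ≤ E.B := le_trans (by nlinarith) hσB
    refine .assign_seq (by simp)
      (by simp only [Expr.eval_div, Expr.eval_reg, hx, g1, hkv]; omega) ?_
    simp only [Expr.eval_div, Expr.eval_reg, hx, g1, hkv]
    refine .assign_seq (by simp) (by simp [hx, g1, hkm]; omega) ?_
    simp [hx, g1, hkm]
    have hc5 := i0 (i * m + (q + y))
    refine .assign_seq (by simp) (by simp [g2, g9, g27, g33]; omega) ?_
    simp [g2, g9, g27, g33]
    refine .ite_lt (by simp) (by simp) (fun hc => ?_) (fun hc => ?_) <;>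
      simp [g2, g27, g33, g28, g4] at hc
    · have h1 := b4 (i * m + (r + z))
      have h2 := b4 ((r + z) * m + (q + y))
      refine .store (by simp) (by simp) (by simp; omega) ?_
      simp only [Expr.eval_add, Expr.eval_mul, Expr.eval_reg, State.reg_setReg, State.arr_setReg,
        State.arr_setCell_same]
      simp [g2, g27, g33]
      refine ⟨fun c => ?_, fun c => ?_, fun c => ?_, fun l hl hlt => ?_⟩ <;>
        rw [Function.update_apply]
      · split
        · omega
        · exact i0 c
      · split
        · next hce => subst hce; rcases i1 (i * m + (q + y)) with h' | h' <;> omega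
        · exact i1 c
      · split
        · next hce => exact fun _ => ⟨y, hy, z, hz, hce, hc⟩
        · exact i2 c
      · split
        -- The cell has just been lowered by `h` from a value that was at most the original one,
        -- whichever column `z` caused it.
        · next hce => rw [hce]; rcases i1 (i * m + (q + y)) with h' | h' <;> omega
        · next hce =>
          refine i3 l ?_ (by simpa using hlt)
          rcases Nat.lt_succ_iff_lt_or_eq.1 (show l < k + 1 by omega) with h' | rfl
          · exact h'
          · exact absurd (by rw [← hyk]; push_cast; rfl) hce
    · refine .skip ?_
      simp only [State.arr_setReg]
      refine ⟨by simp, i0, i1, i2, fun l hl hlt => ?_⟩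
      rcases Nat.lt_succ_iff_lt_or_eq.1 (show l < k + 1 by omega) with h' | rfl
      · exact i3 l h' hlt
      · rw [hkv, hkz] at hlt
        rw [hkv]
        -- The test failed although the original entry is too large, so the entry must have been
        -- lowered before.
        rcases i1 (i * m + (q + y)) with h' | h'
        · omega
        · exact h'
  · rintro s' t ⟨i0, i1, i2, i3⟩ - hF ht
    refine hQ s' t hF (hb.of_frame hF (by decide) (by decide) (by decide) i0) ⟨i1, i2, ?_⟩
      (by omega)
    intro y z hy hz
    have := i3 (y * σ + z) (rowMajor_lt hy hz)
    rw [rowMajor_div hz, rowMajor_mod hz] at this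
    exact this

end

/-! ### Removing all negative triangles from one block. -/

/-- Lower the entries of array `5` until the block has no negative triangles. -/
def blockProg : Prog :=
  .seq (.assign 32 1) <| .loop (reg 32) <|
  .seq buildProg <|
  .seq (.call 2 3) <|
  .ite (.lt (cell 3 0) 0) (.assign 32 0) (.seq (.assign 33 (reg 26 + cell 3 0)) rowProg)

/-- Calls with a graph with `v` vertices return correct answers for CoDiameter within time `τ`. -/
def SolvesCoDiameter (E : Env) (v τ : ℕ) : Prop :=
  ∀ (s : State) (Q : State → ℕ → Prop) (G : WDigraph), G.NonnegWeights → G.n = v →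
    G.maxWeight ≤ E.B → HoldsGraph (s.arr 2) G →
    (∀ o t, ((∃ u : Fin G.n, o 0 = ((u : ℕ) : ℤ) ∧ ¬ G.IsDiameterVertex u) ∨
      (o 0 = -1 ∧ ∀ u : Fin G.n, G.IsDiameterVertex u)) → t ≤ 1 + τ → Q (s.setArr 3 o) t) →
    WP E (.call 2 3) s Q

/-- A bound for the time that it takes to search a block once. -/
def searchTime (σ τ : ℕ) : ℕ := (4 * σ + 1) * (4 * σ + 1) * 108 + σ * σ * 98 + τ + 40

/-- The sum of array `5` is the potential that pays for the successful searches. -/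
theorem sum_add_le_of_step {u u' : ℤ → ℤ} {h : ℤ} (hh : 0 ≤ h) {N c : ℕ} (hc : c < N)
    (hstep : ∀ c, u' c = u c ∨ u' c ≤ u c - h) (hdec : u' c ≤ u c - h) :
    ∑ i ∈ Finset.range N, u' i + h ≤ ∑ i ∈ Finset.range N, u i := by
  have hle : ∀ i ∈ Finset.range N, u' i + (if i = c then h else 0) ≤ u i := by
    intro i _
    split_ifs with hi
    · subst hi; omega
    · rcases hstep i with h1 | h1 <;> omega
  have := Finset.sum_le_sum hle
  rwa [Finset.sum_add_distrib, Finset.sum_ite_eq', if_pos (by simpa using hc)] at this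

section

variable {E : Env} {s : State} {Q : State → ℕ → Prop} {σ τ : ℕ} {R h : ℤ} {p q r : ℕ}
  {C : ℕ → ℕ → ℤ}

/-- A changed entry exceeds `A i k + A k j` for some `k`, and this sum is at least the entry of the
square. Since the column offset stays below σ³, the position of the cell determines row and column.
-/
theorem RowUpdate.low {i : ℕ} {a u u' : ℤ → ℤ} (hu : RowUpdate σ h i q r a u u')
    (hi : i < σ ^ 3) (hq : q + σ ≤ σ ^ 3) (hr : r + σ ≤ σ ^ 3)
    (hC : IsMinPlusSq (σ ^ 3) (fun i j => mat a (σ ^ 3 : ℕ) i j) C)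
    (hlow : ∀ i j : ℕ, i < σ ^ 3 → j < σ ^ 3 → C i j < mat u (σ ^ 3 : ℕ) i j)
    (i' j' : ℕ) (hi' : i' < σ ^ 3) (hj' : j' < σ ^ 3) : C i' j' < mat u' (σ ^ 3 : ℕ) i' j' := by
  by_cases heq : u' (i' * (σ ^ 3 : ℕ) + j') = u (i' * (σ ^ 3 : ℕ) + j')
  · have := hlow i' j' hi' hj'
    rw [mat] at this ⊢
    rwa [heq]
  · obtain ⟨y, hy, z, hz, h1, h2⟩ := hu.reason _ heq
    have h3 : i' * σ ^ 3 + j' = i * σ ^ 3 + (q + y) := by exact_mod_cast h1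
    have h4 : i' = i := by
      rw [← rowMajor_div hj' (i := i'), h3, rowMajor_div (by omega)]
    have h5 : j' = q + y := by
      rw [← rowMajor_mod hj' (i := i'), h3, rowMajor_mod (by omega)]
    subst h4 h5
    have h6 := (hC i' (q + y) hi' hj').1 (r + z) (by omega)
    push_cast at h6 h2
    exact h6.trans_lt h2

theorem Block.congr_arr3 (hb : Block E σ R h p q r s) {o : ℤ → ℤ} :
    Block E σ R h p q r (s.setArr 3 o) := hb.congr (by simp) (by simp) (by simp)

/-- One search of the block: either it has no negative triangles and register `32` becomes `0`, or
some entries of array `5` are lowered. -/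
theorem searchBlock_wp (hs : SolvesCoDiameter E (4 * σ + 1) τ)
    (hb : Block E σ R h p q r s) (hσ : 0 < σ) (hp : p + σ ≤ σ ^ 3) (hq : q + σ ≤ σ ^ 3)
    (hr : r + σ ≤ σ ^ 3)
    (hC : IsMinPlusSq (σ ^ 3) (fun i j => mat (s.arr 4) (σ ^ 3 : ℕ) i j) C)
    (hlow : ∀ i j : ℕ, i < σ ^ 3 → j < σ ^ 3 → C i j < mat (s.arr 5) (σ ^ 3 : ℕ) i j)
    (hdone : ∀ s' t, Block E σ R h p q r s' → s'.reg 32 = 0 → s'.arr 5 = s.arr 5 →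
      (∀ x y z : ℕ, x < σ → y < σ → z < σ →
        mat (s.arr 5) (σ ^ 3 : ℕ) (p + x) (q + y) - h ≤
          mat (s.arr 4) (σ ^ 3 : ℕ) (p + x) (r + z) + mat (s.arr 4) (σ ^ 3 : ℕ) (r + z) (q + y)) →
      t + 5 ≤ searchTime σ τ → Q s' t)
    (hfound : ∀ s' t, Block E σ R h p q r s' → s'.reg 32 = s.reg 32 →
      (∀ c, s'.arr 5 c ≤ s.arr 5 c) →
      (∀ i j : ℕ, i < σ ^ 3 → j < σ ^ 3 → C i j < mat (s'.arr 5) (σ ^ 3 : ℕ) i j) →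
      ∑ c ∈ Finset.range (σ ^ 3 * σ ^ 3), s'.arr 5 c + h ≤
        ∑ c ∈ Finset.range (σ ^ 3 * σ ^ 3), s.arr 5 c →
      t + 5 ≤ searchTime σ τ → Q s' t) :
    WP E (.seq buildProg <| .seq (.call 2 3) <|
      .ite (.lt (cell 3 0) 0) (.assign 32 0)
        (.seq (.assign 33 (reg 26 + cell 3 0)) rowProg)) s Q := by
  have b0 := hb.pos
  have b1 := hb.h_pos
  have b3 := hb.le
  have hB := E.eight_le
  have hσB : (4 * (σ : ℤ) + 1) * (4 * σ + 1) ≤ E.B := by exact_mod_cast hb.sq_le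
  have hσB2 : 4 * (σ : ℤ) + 1 ≤ E.B := by nlinarith
  refine .seq (buildProg_wp hb hσ fun s₁ t₁ hF₁ hG ht₁ => ?_)
  have g45 : s₁.arr 4 = s.arr 4 ∧ s₁.arr 5 = s.arr 5 :=
    ⟨hF₁.2 4 (by decide), hF₁.2 5 (by decide)⟩
  have hb₁ : Block E σ R h p q r s₁ :=
    hb.of_frame hF₁ (by decide) (by decide) (by decide) (by rw [g45.2]; exact hb.a5)
  have g32 : s₁.reg 32 = s.reg 32 := hF₁.1 32 (by decide)
  have hmax := triangleGraph_maxWeight_le hb.bounds hσ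
  have hspec := triangleGraph_not_isDiameterVertex hb.bounds hσ
  refine .seq (hs _ _ _ (triangleGraph_nonneg hb.bounds hσ) rfl (by omega) hG
    fun o t₂ ho ht₂ => ?_)
  have hb₂ := hb₁.congr_arr3 (o := o)
  rcases ho with ⟨w, hw, hw'⟩ | ⟨hw, hall⟩
  · have hww := (hspec w).1 hw'
    obtain ⟨hwσ, y, z, hy, hz, hlt⟩ := hww
    refine .of_bounded fun hbd => ?_
    have hm := (hbd.1 2).2
    rw [hb₂.sizes.r2] at hm
    have hm' : σ ^ 3 ≤ E.B := by exact_mod_cast hm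
    refine .ite_lt (by simp [hw]; omega) (by simp) (fun hc => ?_) (fun _ => ?_)
    · simp [hw] at hc; omega
    have e26 : s₁.reg 26 = p := hb₁.r26
    refine .assign_seq (by simp [hw]; omega) (by simp [hw, e26]; omega) ?_
    simp only [Expr.eval_add, Expr.eval_reg, Expr.eval_cell, State.arr_setArr, State.reg_setArr,
      if_true, Expr.eval_ofNat, Nat.cast_zero, hw, e26]
    have hb₃ : Block E σ R h p q r ((s₁.setArr 3 o).setReg 33 (p + (w : ℕ))) :=
      hb₂.congr (by simp) rfl rfl
    refine rowProg_wp hb₃ (i := ((p + (w : ℕ) : ℕ) : ℤ)) (by simp) fun s₄ t₄ hF₄ hb₄ hu ht₄ => ?_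
    simp only [State.arr_setReg, State.arr_setArr, Nat.reduceEqDiff, if_false,
      g45.1, g45.2] at hu
    -- The negative triangle at the vertex returned by the oracle guarantees that scanning its row
    -- lowers at least one entry.
    have hfd := hu.found y z hy hz (by push_cast; exact hlt)
    refine hfound s₄ _ hb₄ ?_ (fun c => by rcases hu.step c with h1 | h1 <;> omega)
      (fun i j hi hj => hu.low (by omega) hq hr hC hlow i j hi hj) ?_ ?_
    · rw [hF₄.1 32 (by decide)]; simp [g32]
    · refine sum_add_le_of_step b1.le (c := (p + w) * σ ^ 3 + (q + y))
        (rowMajor_lt (by omega) (by omega)) hu.step ?_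
      simp only [mat] at hfd
      exact_mod_cast hfd
    · simp [searchTime]; omega
  · have e0 : (s₁.setArr 3 o).arr 3 0 = -1 := by simp [hw]
    refine .ite_lt (by simp [hw]; omega) (by simp) (fun _ => ?_) (fun hc => ?_)
    · refine .assign (by simp) (by simp) ?_
      refine hdone _ _ (hb₂.congr (by simp) rfl rfl) (by simp) (by simp [g45.2]) ?_ ?_
      -- A negative triangle would give a vertex that is not an endpoint of a diameter, contrary to
      -- the answer -1.
      · intro x y z hx hy hz
        by_contra! hlt
        refine (hspec ⟨x, by change x < 4 * σ + 1; omega⟩).2 ⟨hx, y, z, hy, hz, ?_⟩ (hall _)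
        exact hlt
      · simp [searchTime]; omega
    · simp [hw] at hc

/-- Here `f` counts the successful searches. Each lowers the sum of array `5` by at least `h`, and a
single unsuccessful search ends the loop, so there are `f + 1` searches. Since `f` is controlled by
the drop of the sum, it can later be added up over all blocks. -/
theorem blockProg_wp (hs : SolvesCoDiameter E (4 * σ + 1) τ)
    (hb : Block E σ R h p q r s) (hσ : 0 < σ) (hp : p + σ ≤ σ ^ 3) (hq : q + σ ≤ σ ^ 3)
    (hr : r + σ ≤ σ ^ 3)
    (hC : IsMinPlusSq (σ ^ 3) (fun i j => mat (s.arr 4) (σ ^ 3 : ℕ) i j) C)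
    (hlow : ∀ i j : ℕ, i < σ ^ 3 → j < σ ^ 3 → C i j < mat (s.arr 5) (σ ^ 3 : ℕ) i j)
    (hQ : ∀ s' t (f : ℕ), blockProg.Frame s s' → Block E σ R h p q r s' →
      (∀ c, s'.arr 5 c ≤ s.arr 5 c) →
      (∀ i j : ℕ, i < σ ^ 3 → j < σ ^ 3 → C i j < mat (s'.arr 5) (σ ^ 3 : ℕ) i j) →
      ∑ c ∈ Finset.range (σ ^ 3 * σ ^ 3), s'.arr 5 c + h * f ≤
        ∑ c ∈ Finset.range (σ ^ 3 * σ ^ 3), s.arr 5 c →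
      (∀ x y z : ℕ, x < σ → y < σ → z < σ →
        mat (s'.arr 5) (σ ^ 3 : ℕ) (p + x) (q + y) - h ≤
          mat (s.arr 4) (σ ^ 3 : ℕ) (p + x) (r + z) + mat (s.arr 4) (σ ^ 3 : ℕ) (r + z) (q + y)) →
      t ≤ searchTime σ τ * (f + 1) + 4 → Q s' t) :
    WP E blockProg s Q := by
  have b1 := hb.h_pos
  have hB := E.eight_le
  refine .of_frame (.assign_seq (by simp) (by simp; omega) ?_)
  simp only [Expr.eval_ofNat, Nat.cast_one]
  set K := searchTime σ τ with hK
  set N := σ ^ 3 * σ ^ 3 with hN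
  have hb' : Block E σ R h p q r (s.setReg 32 1) := hb.congr (by simp) rfl rfl
  refine .loop
    -- Adding `2 * R` makes the terms nonnegative. A successful search decreases the sum; an
    -- unsuccessful one leaves it and clears register `32`.
    (fun s' => (∑ c ∈ Finset.range N, (s'.arr 5 c + 2 * R)).toNat + (s'.reg 32).toNat)
    (fun s' t => ∃ f : ℕ, Block E σ R h p q r s' ∧
      (∀ c, s'.arr 5 c ≤ s.arr 5 c) ∧
      (∀ i j : ℕ, i < σ ^ 3 → j < σ ^ 3 → C i j < mat (s'.arr 5) (σ ^ 3 : ℕ) i j) ∧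
      ∑ c ∈ Finset.range N, s'.arr 5 c + h * f ≤ ∑ c ∈ Finset.range N, s.arr 5 c ∧
      ((s'.reg 32 = 1 ∧ t ≤ K * f) ∨ (s'.reg 32 = 0 ∧ t ≤ K * (f + 1) ∧
        ∀ x y z : ℕ, x < σ → y < σ → z < σ →
        mat (s'.arr 5) (σ ^ 3 : ℕ) (p + x) (q + y) - h ≤
          mat (s.arr 4) (σ ^ 3 : ℕ) (p + x) (r + z) +
            mat (s.arr 4) (σ ^ 3 : ℕ) (r + z) (q + y))))
    ⟨0, hb', fun c => le_rfl, hlow, by simp, .inl (by simp)⟩ (by simp) ?_ ?_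
  · rintro s' t ⟨f, i1, i2, i3, i4, i5⟩ hF hne
    rcases i5 with ⟨i5, i6⟩ | ⟨i5, -⟩
    swap
    · exact absurd i5 (by simpa using hne)
    have g4 : s'.arr 4 = s.arr 4 := hF.2 4 (by decide)
    refine searchBlock_wp hs i1 hσ hp hq hr (by rw [g4]; exact hC) i3 ?_ ?_
    · intro s₁ t₁ j1 j2 j3 j4 j5
      rw [← hK] at j5
      refine ⟨by rw [j3, j2, i5]; simp, f, j1, by rw [j3]; exact i2, by rw [j3]; exact i3,
        by rw [j3]; exact i4, .inr ⟨j2, ?_, ?_⟩⟩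
      · simp; rw [mul_add]; omega
      · rw [j3, ← g4]; exact j4
    · intro s₁ t₁ j1 j2 j3 j4 j5 j6
      rw [← hN] at j5
      rw [← hK] at j6
      refine ⟨?_, f + 1, j1, fun c => (j3 c).trans (i2 c), j4, ?_, .inl ⟨by rw [j2, i5], ?_⟩⟩
      · rw [j2]
        have h0 : 0 ≤ ∑ c ∈ Finset.range N, (s₁.arr 5 c + 2 * R) :=
          Finset.sum_nonneg fun c _ => by have := (j1.a5 c).1; omega
        rw [Finset.sum_add_distrib] at h0 ⊢
        rw [Finset.sum_add_distrib]
        omega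
      · push_cast; rw [mul_add]; omega
      · simp; rw [mul_add]; omega
  · rintro s' t ⟨f, i1, i2, i3, i4, i5⟩ - he hF
    rcases i5 with ⟨i5, i6⟩ | ⟨i5, i6, i7⟩
    · simp [i5] at he
    · exact hQ s' _ f hF i1 i2 i3 i4 i7 (by simp; omega)

end

/-! ### Squaring with respect to minimum and addition by a simultaneous binary search. -/

/-- Search all blocks; register `23` encodes the block. -/
def phaseProg : Prog :=
  .forTo 23 3 <|
  .seq (.assign 34 (reg 23 / reg 13)) <|
  .seq (.assign 28 ((reg 23 - reg 34 * reg 13) * reg 1)) <|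
  .seq (.assign 35 (reg 34 / reg 13)) <|
  .seq (.assign 27 ((reg 34 - reg 35 * reg 13) * reg 1)) <|
  .seq (.assign 26 (reg 35 * reg 1)) blockProg

/-- Square the matrix in array `4` with respect to minimum and addition, by a binary search for all
entries at once. -/
def squareProg : Prog :=
  .seq (.forTo 22 3 (.store 5 (reg 22) (reg 6))) <|
  .seq (.assign 9 (reg 6)) <|
  .seq (.forTo 21 7 (.seq phaseProg (.assign 9 (reg 9 / 2)))) <|
  .forTo 22 3 (.store 4 (reg 22) (cell 5 (reg 22) - 1))

section

variable {E : Env} {s : State} {Q : State → ℕ → Prop} {σ τ : ℕ} {R h : ℤ}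
  {C : ℕ → ℕ → ℤ}

theorem Block.rebase {s' : State} {p q r p' q' r' : ℤ} (hb : Block E σ R h p q r s)
    (h' : ∀ x ∈ [1, 2, 3, 10, 11, 12, 13, 9], s'.reg x = s.reg x)
    (h4 : s'.arr 4 = s.arr 4) (h5 : s'.arr 5 = s.arr 5) (h26 : s'.reg 26 = p')
    (h27 : s'.reg 27 = q') (h28 : s'.reg 28 = r') : Block E σ R h p' q' r' s' where
  sizes := hb.sizes.congr fun x hx => h' x (by simp at hx ⊢; tauto)
  r9 := (h' 9 (by simp)).trans hb.r9
  r26 := h26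
  r27 := h27
  r28 := h28
  pos := hb.pos
  h_pos := hb.h_pos
  h_le := hb.h_le
  le := hb.le
  sq_le := hb.sq_le
  a4 := h4 ▸ hb.a4
  a5 := h5 ▸ hb.a5

theorem add_le_pow_three {p x σ : ℕ} (hp : p < σ * σ) (hx : x = p * σ) : x + σ ≤ σ ^ 3 := by
  have := Nat.mul_le_mul_right σ (Nat.succ_le_of_lt hp)
  rw [Nat.succ_mul, ← hx] at this
  calc x + σ ≤ σ * σ * σ := this
    _ = σ ^ 3 := by ring

/-- With `g = σ * σ` intervals, a block is a number below `g * g * g` with three digits in base `g`: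
row, column and middle interval. Every triple of indices lies in exactly one block, so once all
blocks are finished, the index `k` that attains the minimum for `i, j` gives the bound by `C i j +
h`. -/
theorem phaseProg_wp (hs : SolvesCoDiameter E (4 * σ + 1) τ)
    (hb : Block E σ R h (s.reg 26) (s.reg 27) (s.reg 28) s)
    (hC : IsMinPlusSq (σ ^ 3) (fun i j => mat (s.arr 4) (σ ^ 3 : ℕ) i j) C)
    (hlow : ∀ i j : ℕ, i < σ ^ 3 → j < σ ^ 3 → C i j < mat (s.arr 5) (σ ^ 3 : ℕ) i j)
    (hQ : ∀ s' t (f : ℕ), phaseProg.Frame s s' →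
      Block E σ R h (s'.reg 26) (s'.reg 27) (s'.reg 28) s' →
      (∀ i j : ℕ, i < σ ^ 3 → j < σ ^ 3 → C i j < mat (s'.arr 5) (σ ^ 3 : ℕ) i j) →
      (∀ i j : ℕ, i < σ ^ 3 → j < σ ^ 3 → mat (s'.arr 5) (σ ^ 3 : ℕ) i j ≤ C i j + h) →
      ∑ c ∈ Finset.range (σ ^ 3 * σ ^ 3), s'.arr 5 c + h * f ≤
        ∑ c ∈ Finset.range (σ ^ 3 * σ ^ 3), s.arr 5 c →
      t ≤ searchTime σ τ * (f + σ ^ 3 * σ ^ 3) + 60 * (σ ^ 3 * σ ^ 3) + 6 → Q s' t) :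
    WP E phaseProg s Q := by
  have b1 := hb.h_pos
  have hB := E.eight_le
  have hB2 : σ * σ ≤ E.B := by have := hb.sq_le; nlinarith
  set K := searchTime σ τ with hK
  obtain ⟨N, hN⟩ : ∃ N, N = σ ^ 3 * σ ^ 3 := ⟨_, rfl⟩
  obtain ⟨m, hm⟩ : ∃ m, m = σ ^ 3 := ⟨_, rfl⟩
  obtain ⟨g, hg⟩ : ∃ g, g = σ * σ := ⟨_, rfl⟩
  have hNg : N = g * g * g := by rw [hN, hg]; ring
  have hmg : m = g * σ := by rw [hm, hg]; ring
  rw [← hN] at hQ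
  refine .forTo N (fun k s' t => ∃ f : ℕ,
      Block E σ R h (s'.reg 26) (s'.reg 27) (s'.reg 28) s' ∧
      (∀ i j : ℕ, i < σ ^ 3 → j < σ ^ 3 → C i j < mat (s'.arr 5) (σ ^ 3 : ℕ) i j) ∧
      ∑ c ∈ Finset.range N, s'.arr 5 c + h * f ≤ ∑ c ∈ Finset.range N, s.arr 5 c ∧
      (∀ l < k, ∀ x y z : ℕ, x < σ → y < σ → z < σ →
        mat (s'.arr 5) (σ ^ 3 : ℕ) ((l / g / g * σ : ℕ) + x) ((l / g % g * σ : ℕ) + y) - h ≤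
          mat (s.arr 4) (σ ^ 3 : ℕ) ((l / g / g * σ : ℕ) + x) ((l % g * σ : ℕ) + z) +
          mat (s.arr 4) (σ ^ 3 : ℕ) ((l % g * σ : ℕ) + z) ((l / g % g * σ : ℕ) + y)) ∧
      t ≤ K * (f + k) + 52 * k) (by rw [hN]; exact hb.sizes.r3) (by decide) ?_ ?_ ?_
  · exact ⟨0, hb.congr (by simp) rfl rfl, hlow, by simp, by simp, by simp⟩
  · rintro k s₁ t₁ hk ⟨f, i1, i2, i3, i4, i5⟩ hx hF
    have hg0 : 0 < g := Nat.pos_of_ne_zero (by rintro rfl; simp [hNg] at hk)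
    have hσ : 0 < σ := Nat.pos_of_ne_zero (by rintro rfl; simp at hg; omega)
    have g4 : s₁.arr 4 = s.arr 4 := hF.2 4 (by decide)
    have r13 : s₁.reg 13 = g := by rw [i1.sizes.r13, hg]
    have r1 := i1.sizes.r1
    refine .of_bounded fun hbd => ?_
    have hNB : N ≤ E.B := by
      have := (hbd.1 3).2
      rw [i1.sizes.r3, ← hN] at this
      exact_mod_cast this
    have hmB : m ≤ E.B := by
      have := (hbd.1 2).2
      rw [i1.sizes.r2, ← hm] at this
      exact_mod_cast this
    obtain ⟨e, he⟩ : ∃ e, e = k / g := ⟨_, rfl⟩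
    obtain ⟨r, hr⟩ : ∃ r, r = k % g := ⟨_, rfl⟩
    obtain ⟨p, hp⟩ : ∃ p, p = e / g := ⟨_, rfl⟩
    obtain ⟨q, hq⟩ : ∃ q, q = e % g := ⟨_, rfl⟩
    have hrg : r < g := hr ▸ Nat.mod_lt _ hg0
    have hqg : q < g := hq ▸ Nat.mod_lt _ hg0
    have heg : e < g * g := he ▸ Nat.div_lt_of_lt_mul (by rw [hNg] at hk; linarith)
    have hpg : p < g := hp ▸ Nat.div_lt_of_lt_mul heg
    have c1 : (k : ℤ) / g = e := by rw [he]; push_cast; rfl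
    have c2 : (k : ℤ) - e * g = r := by rw [he, hr]; exact natCast_sub_ediv_mul k g
    have c3 : (e : ℤ) / g = p := by rw [hp]; push_cast; rfl
    have c4 : (e : ℤ) - p * g = q := by rw [hp, hq]; exact natCast_sub_ediv_mul e g
    have heB : (e : ℤ) ≤ E.B := by
      have : k / g ≤ k := Nat.div_le_self _ _
      omega
    have hgB : g ≤ E.B := by omega
    have hle : ∀ w : ℕ, w < g → w * σ + σ ≤ m := fun w hw => by
      rw [hm]; exact add_le_pow_three (hg ▸ hw) rfl
    have h1 := hle p hpg
    have h2 := hle q hqg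
    have h3 := hle r hrg
    have z1 : (0 : ℤ) ≤ (p : ℤ) * σ := by positivity
    have z2 : (0 : ℤ) ≤ (q : ℤ) * σ := by positivity
    have z3 : (0 : ℤ) ≤ (r : ℤ) * σ := by positivity
    have h1' : (p : ℤ) * σ + σ ≤ m := by exact_mod_cast h1
    have h2' : (q : ℤ) * σ + σ ≤ m := by exact_mod_cast h2
    have h3' : (r : ℤ) * σ + σ ≤ m := by exact_mod_cast h3
    refine .assign_seq (by simp) (by simp only [Expr.eval_div, Expr.eval_reg, hx, r13, c1]; omega) ?_
    simp only [Expr.eval_div, Expr.eval_reg, hx, r13, c1]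
    refine .assign_seq (by simp) (by simp [hx, r13, r1, c2]; omega) ?_
    simp only [Expr.eval_reg, Expr.eval_sub, Expr.eval_mul, State.reg_setReg, Nat.reduceEqDiff,
      if_true, if_false, hx, r13, r1, c2]
    refine .assign_seq (by simp) (by simp [r13, c3]; omega) ?_
    simp only [Expr.eval_reg, Expr.eval_div, State.reg_setReg, Nat.reduceEqDiff, if_true, if_false,
      r13, c3]
    refine .assign_seq (by simp) (by simp [r13, r1, c4]; omega) ?_
    simp only [Expr.eval_reg, Expr.eval_sub, Expr.eval_mul, State.reg_setReg, Nat.reduceEqDiff,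
      if_true, if_false, r13, r1, c4]
    refine .assign_seq (by simp) (by simp [r1]; omega) ?_
    simp only [Expr.eval_reg, Expr.eval_mul, State.reg_setReg, Nat.reduceEqDiff, if_true, if_false,
      r1]
    set s₂ := ((((s₁.setReg 34 e).setReg 28 (r * σ)).setReg 35 p).setReg 27 (q * σ)).setReg 26
      (p * σ) with hs₂
    have hb₂ : Block E σ R h (p * σ : ℕ) (q * σ : ℕ) (r * σ : ℕ) s₂ :=
      i1.rebase (by simp [hs₂]) rfl rfl (by simp [hs₂]) (by simp [hs₂]) (by simp [hs₂])
    have a4 : s₂.arr 4 = s.arr 4 := g4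
    have a5 : s₂.arr 5 = s₁.arr 5 := rfl
    refine blockProg_wp hs hb₂ hσ (hm ▸ h1) (hm ▸ h2) (hm ▸ h3) (by rw [a4]; exact hC)
      (by rw [a5]; exact i2) fun s₃ t₃ f₃ hF₃ hb₃ j1 j2 j3 j4 ht₃ => ?_
    rw [a5] at j1 j3
    rw [a4] at j4
    rw [← hN] at j3
    refine ⟨f + f₃, hb₃.rebase (by simp) rfl rfl rfl rfl rfl, j2, ?_, ?_, ?_⟩
    · simp only [State.arr_setReg]; push_cast; rw [mul_add]; omega
    · intro l hl x y z hx' hy' hz'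
      rcases Nat.lt_succ_iff_lt_or_eq.1 (show l < k + 1 from hl) with h' | rfl
      -- Finished blocks stay finished, because entries of array `5` never increase.
      · refine le_trans ?_ (i4 l h' x y z hx' hy' hz')
        exact sub_le_sub_right (j1 _) h
      · rw [← hr, ← he, ← hp, ← hq]
        exact j4 x y z hx' hy' hz'
    · rw [← hK] at ht₃
      have : K * (f + f₃ + (k + 1)) = K * (f + k) + K * (f₃ + 1) := by ring
      simp only [Expr.cost_reg, Expr.cost_div, Expr.cost_mul, Expr.cost_sub]
      omega
  · rintro s' t ⟨f, i1, i2, i3, i4, i5⟩ - hF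
    refine hQ s' _ f hF i1 i2 ?_ i3 (by omega)
    intro i j hi hj
    obtain ⟨k, hk, hCk⟩ := (hC i j hi hj).2
    rw [← hm] at hi hj hk
    have hσ : 0 < σ := Nat.pos_of_ne_zero (by rintro rfl; simp at hm; omega)
    have hdv : ∀ w < m, w / σ < g := fun w hw => Nat.div_lt_of_lt_mul (by rw [hmg] at hw; linarith)
    have e1 := hdv i hi
    have e2 := hdv j hj
    have e3 := hdv k hk
    -- The number of the block that contains the triple `i, j, k`.
    have := i4 ((i / σ * g + j / σ) * g + k / σ)
      (by rw [hNg]; exact rowMajor_lt (rowMajor_lt e1 e2) e3)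
      (i % σ) (j % σ) (k % σ) (Nat.mod_lt _ hσ) (Nat.mod_lt _ hσ) (Nat.mod_lt _ hσ)
    rw [rowMajor_div e3, rowMajor_div e2, rowMajor_mod e2, rowMajor_mod e3] at this
    have hcast : ∀ w : ℕ, ((w / σ * σ : ℕ) : ℤ) + (w % σ : ℕ) = w := fun w => by
      exact_mod_cast Nat.div_add_mod' w σ
    rw [hcast, hcast, hcast] at this
    rw [hCk]
    simp only
    omega

/-- The memory during the repeated squaring. -/
structure Work (E : Env) (σ e : ℕ) (s : State) : Prop where
  sizes : Sizes σ (2 ^ e) s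
  r6 : s.reg 6 = 2 ^ e
  r7 : s.reg 7 = (e + 1 : ℕ)
  le : 12 * (2 : ℤ) ^ e ≤ E.B
  sq_le : (4 * σ + 1) * (4 * σ + 1) ≤ E.B
  a4 : ∀ c, -(2 : ℤ) ^ e ≤ s.arr 4 c ∧ s.arr 4 c ≤ 2 ^ e
  a5 : ∀ c, -(2 * (2 : ℤ) ^ e) ≤ s.arr 5 c ∧ s.arr 5 c ≤ 2 ^ e

/-- After `k` phases, `C < D ≤ C + 2 ^ (e + 1 - k)` holds entrywise. This is true at the start with
`D = 2 ^ e` by the bounds on `C`, whose upper one has to be strict. After `e + 1` phases the gap is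
exactly 1. -/
theorem squareProg_wp {e : ℕ} (hs : SolvesCoDiameter E (4 * σ + 1) τ) (hw : Work E σ e s)
    (hC : IsMinPlusSq (σ ^ 3) (fun i j => mat (s.arr 4) (σ ^ 3 : ℕ) i j) C)
    (hCR : ∀ i j : ℕ, i < σ ^ 3 → j < σ ^ 3 → -(2 : ℤ) ^ e ≤ C i j ∧ C i j < 2 ^ e)
    (hQ : ∀ s' t, squareProg.Frame s s' → Work E σ e s' →
      (∀ i j : ℕ, i < σ ^ 3 → j < σ ^ 3 → mat (s'.arr 4) (σ ^ 3 : ℕ) i j = C i j) →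
      t ≤ (e + 1) * (3 * searchTime σ τ * (σ ^ 3 * σ ^ 3) + 60 * (σ ^ 3 * σ ^ 3) + 20) +
        40 * (σ ^ 3 * σ ^ 3) + 30 → Q s' t) :
    WP E squareProg s Q := by
  have hB := E.eight_le
  have w1 := hw.le
  obtain ⟨N, hN⟩ : ∃ N, N = σ ^ 3 * σ ^ 3 := ⟨_, rfl⟩
  obtain ⟨m, hm⟩ : ∃ m, m = σ ^ 3 := ⟨_, rfl⟩
  set K := searchTime σ τ with hK
  have hRpos : (0 : ℤ) < 2 ^ e := by positivity
  rw [← hN] at hQ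
  have hNm : N = m * m := by rw [hN, hm]
  have hcell : ∀ c < N, c / m < m ∧ c % m < m ∧ c / m * m + c % m = c := by
    intro c hc
    rw [hNm] at hc
    exact ⟨Nat.div_lt_of_lt_mul hc,
      Nat.mod_lt _ (Nat.pos_of_ne_zero (by rintro rfl; simp at hc)), Nat.div_add_mod' c m⟩
  have hmatc : ∀ (a : ℤ → ℤ), ∀ c < N, a c = mat a m (c / m : ℕ) (c % m : ℕ) := by
    intro a c hc
    rw [mat]
    congr 1
    exact_mod_cast (hcell c hc).2.2.symm
  rw [← hm] at hC hCR hQ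
  have hr3 := hw.sizes.r3
  rw [← hN] at hr3
  refine .of_frame (.seq (.forTo_le N 3 (fun k s' =>
    (∀ c, -(2 * (2 : ℤ) ^ e) ≤ s'.arr 5 c ∧ s'.arr 5 c ≤ 2 ^ e) ∧ ∀ c < k, s'.arr 5 c = 2 ^ e)
    hr3 (by decide) ⟨hw.a5, by simp⟩ ?_ ?_))
  · rintro k s₁ hk ⟨i1, i2⟩ hx hF
    have g6 : s₁.reg 6 = 2 ^ e := (hF.1 6 (by decide)).trans hw.r6
    refine .store (by simp) (by simp) (by simp [g6]; omega) ⟨by simp, ?_, ?_⟩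
    · intro c
      simp only [State.arr_setReg, State.arr_setCell_same, Function.update_apply, Expr.eval_reg, g6]
      split
      · omega
      · exact i1 c
    · intro c hc
      simp only [State.arr_setReg, State.arr_setCell_same, Function.update_apply, Expr.eval_reg, g6,
        hx]
      split
      · rfl
      · exact i2 c (by omega)
  rintro s₁ t₁ ⟨i1, i2⟩ - hF₁ ht₁
  have z1 := hw.sizes.of_frame hF₁ (by decide)
  have a14 : s₁.arr 4 = s.arr 4 := hF₁.2 4 (by decide)
  have r16 : s₁.reg 6 = 2 ^ e := (hF₁.1 6 (by decide)).trans hw.r6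
  have r17 : s₁.reg 7 = (e + 1 : ℕ) := (hF₁.1 7 (by decide)).trans hw.r7
  refine .assign_seq (by simp) (by simp [r16]; omega) ?_
  simp only [Expr.eval_reg, r16]
  refine .seq (.forTo_le (e + 1) (3 * K * N + 60 * N + 12) (fun k s' =>
    -- The step of phase `k` is `2 ^ (e - k)`. Writing it as a rounded quotient also covers the end
    -- of the loop, where the register has become 0.
    Sizes σ (2 ^ e) s' ∧ s'.reg 9 = ((2 ^ (e + 1 - k) / 2 : ℕ) : ℤ) ∧
    (∀ c, -(2 * (2 : ℤ) ^ e) ≤ s'.arr 5 c ∧ s'.arr 5 c ≤ 2 ^ e) ∧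
    ∀ i j : ℕ, i < m → j < m → C i j < mat (s'.arr 5) m i j ∧
      mat (s'.arr 5) m i j ≤ C i j + 2 ^ (e + 1 - k))
    (by simpa using r17) (by decide) ?_ ?_ ?_)
  · refine ⟨z1.congr (by simp), ?_, i1, fun i j hi hj => ?_⟩
    · rw [State.reg_setReg, if_neg (by decide), State.reg_setReg, if_pos rfl, Nat.sub_zero, pow_succ,
        Nat.mul_div_cancel _ (by norm_num)]
      push_cast; rfl
    · have h1 := i2 (i * m + j) (by rw [hNm]; exact rowMajor_lt hi hj)
      have h2 := hCR i j hi hj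
      simp only [State.arr_setReg, mat]
      push_cast at h1
      rw [h1, Nat.sub_zero, pow_succ]
      omega
  · rintro k s₂ hk ⟨j1, j2, j3, j4⟩ hx hF
    have hk1 : e + 1 - k = e - k + 1 := by omega
    have g4 : s₂.arr 4 = s.arr 4 := (hF.2 4 (by decide)).trans a14
    rw [hk1, pow_succ, Nat.mul_div_cancel _ (by norm_num)] at j2
    push_cast at j2
    have hh1 : (1 : ℤ) ≤ 2 ^ (e - k) := one_le_pow₀ (by norm_num)
    have hh2 : (2 : ℤ) ^ (e - k) ≤ 2 ^ e := pow_le_pow_right₀ (by norm_num) (by omega)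
    have hb₂ : Block E σ (2 ^ e) (2 ^ (e - k)) (s₂.reg 26) (s₂.reg 27) (s₂.reg 28) s₂ :=
      ⟨j1, j2, rfl, rfl, rfl, hRpos, by omega, hh2, hw.le, hw.sq_le, by rw [g4]; exact hw.a4, j3⟩
    refine .seq (phaseProg_wp hs hb₂ (C := C) (by rw [g4, ← hm]; exact hC)
      (by rw [← hm]; exact fun i j hi hj => (j4 i j hi hj).1) ?_)
    intro s₃ t₃ f hF₃ hb₃ l1 l2 l3 ht₃
    rw [← hN] at l3 ht₃
    rw [← hK] at ht₃
    rw [← hm] at l1 l2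
    have r9 := hb₃.r9
    have hdivle : (2 : ℤ) ^ (e - k) / 2 ≤ 2 ^ (e - k) := Int.ediv_le_self _ (by omega)
    have hdiv0 : (0 : ℤ) ≤ (2 : ℤ) ^ (e - k) / 2 := by positivity
    refine .assign (by simp) (by simp [r9]; omega) ⟨?_, ?_, ?_, ?_, ?_⟩
    · have hsum : ∑ c ∈ Finset.range N, s₂.arr 5 c ≤
          ∑ c ∈ Finset.range N, (s₃.arr 5 c + 2 ^ (e - k) * 2) := by
        refine Finset.sum_le_sum fun c hc => ?_
        have hc : c < N := by simpa using hc
        have hcc := hcell c hc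
        rw [hmatc (s₂.arr 5) c hc, hmatc (s₃.arr 5) c hc]
        have h1 := (j4 _ _ hcc.1 hcc.2.1).2
        have h2 := l1 _ _ hcc.1 hcc.2.1
        rw [hk1, pow_succ] at h1
        omega
      rw [Finset.sum_add_distrib, Finset.sum_const, Finset.card_range, nsmul_eq_mul] at hsum
      -- With step `h`, each of the `N` entries drops by at most `2 * h` during the phase, and each
      -- successful search uses up `h` of the total. Together with one unsuccessful search for each
      -- of the `N` blocks this makes at most `3 * N` searches.
      have hf : (f : ℤ) ≤ 2 * N := by
        by_contra! hcon
        have : (2 : ℤ) ^ (e - k) * (2 * N + 1) ≤ 2 ^ (e - k) * f :=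
          mul_le_mul_of_nonneg_left (by omega) (by omega)
        have h3 : (2 : ℤ) ^ (e - k) * (2 * N + 1) = N * (2 ^ (e - k) * 2) + 2 ^ (e - k) := by ring
        omega
      have hf' : f ≤ 2 * N := by exact_mod_cast hf
      have h4 : K * (f + N) ≤ K * (3 * N) := Nat.mul_le_mul_left _ (by omega)
      have h5 : K * (3 * N) = 3 * K * N := by ring
      simp
      omega
    · exact hb₃.sizes.congr (by simp)
    · have h1 : e + 1 - (k + 1) = e - k := by omega
      rw [h1]
      simp [r9]
    · exact hb₃.a5
    · intro i j hi hj
      have h1 : e + 1 - (k + 1) = e - k := by omega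
      rw [h1]
      exact ⟨l1 i j hi hj, l2 i j hi hj⟩
  rintro s₂ t₂ ⟨j1, -, j3, j4⟩ - hF₂ ht₂
  have a24 : s₂.arr 4 = s.arr 4 := (hF₂.2 4 (by decide)).trans a14
  have r26 : s₂.reg 6 = 2 ^ e := (hF₂.1 6 (by decide)).trans (by simpa using r16)
  have r27 : s₂.reg 7 = (e + 1 : ℕ) := (hF₂.1 7 (by decide)).trans (by simpa using r17)
  have r23 := j1.r3
  rw [← hN] at r23
  have hval : ∀ c < N, s₂.arr 5 c - 1 = C (c / m) (c % m) := by
    intro c hc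
    have hcc := hcell c hc
    have := j4 _ _ hcc.1 hcc.2.1
    rw [hmatc (s₂.arr 5) c hc]
    simp only [Nat.sub_self, pow_zero] at this
    omega
  refine .forTo_le N 8 (fun k s' =>
    (∀ c, -(2 : ℤ) ^ e ≤ s'.arr 4 c ∧ s'.arr 4 c ≤ 2 ^ e) ∧
      ∀ c < k, s'.arr 4 c = C (c / m) (c % m)) r23 (by decide) ?_ ?_ ?_
  · exact ⟨by simp only [State.arr_setReg, a24]; exact hw.a4, by simp⟩
  · rintro k s₃ hk ⟨l1, l2⟩ hx hF
    have g5 : s₃.arr 5 = s₂.arr 5 := hF.2 5 (by decide)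
    have hkc := hcell k hk
    have hv := hval k hk
    have hCk := hCR _ _ hkc.1 hkc.2.1
    refine .store (by simp) (by simp) (by simp [hx, g5, hv]; omega) ⟨by simp, ?_, ?_⟩
    · intro c
      simp only [State.arr_setReg, State.arr_setCell_same, Function.update_apply, Expr.eval_reg,
        Expr.eval_sub, Expr.eval_cell, Expr.eval_ofNat, hx, g5, Nat.cast_one, hv]
      split
      · omega
      · exact l1 c
    · intro c hc
      simp only [State.arr_setReg, State.arr_setCell_same, Function.update_apply, Expr.eval_reg,
        Expr.eval_sub, Expr.eval_cell, Expr.eval_ofNat, hx, g5, Nat.cast_one, hv]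
      split
      · next hck => rw [show c = k by exact_mod_cast hck]
      · exact l2 c (by omega)
  · rintro s₃ t₃ ⟨l1, l2⟩ - hF₃ ht₃ hF
    refine hQ s₃ _ hF ⟨j1.of_frame hF₃ (by decide), (hF₃.1 6 (by decide)).trans r26,
      (hF₃.1 7 (by decide)).trans r27, hw.le, hw.sq_le, l1, ?_⟩ ?_ ?_
    · rw [hF₃.2 5 (by decide)]; exact j3
    · intro i j hi hj
      have := l2 (i * m + j) (by rw [hNm]; exact rowMajor_lt hi hj)
      rw [rowMajor_div hj, rowMajor_mod hj] at this
      rw [mat, ← this]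
      push_cast; rfl
    · have h6 : (e + 1) * (3 * K * N + 60 * N + 12 + 8) = (e + 1) * (3 * K * N + 60 * N + 20) := rfl
      simp
      omega

end

/-! ### Solving all-pairs shortest paths with CoDiameter -/

/-- Compute the sizes: register `1` becomes the cube root of the number of vertices, rounded up. -/
def sizeProg : Prog :=
  .seq (.assign 0 (cell 0 0)) <|
  .seq (.loop (.lt (reg 1 * reg 1 * reg 1) (reg 0)) (.assign 1 (reg 1 + 1))) <|
  .seq (.assign 2 (reg 1 * reg 1 * reg 1)) <|
  .seq (.assign 3 (reg 2 * reg 2)) <|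
  .seq (.assign 10 (4 * reg 1 + 1)) <|
  .seq (.assign 11 (reg 10 * reg 10)) (.assign 13 (reg 1 * reg 1))

/-- Add the squares of all weights to register `15`. -/
def normProg : Prog :=
  .seq (.assign 34 (reg 0 * reg 0)) <| .forTo 20 34 <|
  .seq (.assign 26 (cell 0 (2 * reg 20 + 2))) (.assign 15 (reg 15 + reg 26 * reg 26))

/-- Find the first power of two that is at least register `y`. The power goes to register `x` and
its exponent to register `l`. -/
def powerProg (x l y : ℕ) : Prog :=
  .seq (.assign x 1) <| .seq (.assign l 0) <|
  .loop (.lt (reg x) (reg y)) (.seq (.assign x (reg x + reg x)) (.assign l (reg l + 1)))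

/-- Store the weights in array `4`, with register `5` for infinity. -/
def fillProg : Prog :=
  .forTo 20 3 <|
  .seq (.assign 26 (reg 20 / reg 2)) <|
  .seq (.assign 27 (reg 20 - reg 26 * reg 2)) <|
  .seq (.assign 28 (reg 5)) <|
  .seq (.ite (reg 26 - reg 27)
    (.ite (.lt (reg 26) (reg 0)) (.ite (.lt (reg 27) (reg 0))
      (.ite (cell 0 (2 * (reg 26 * reg 0 + reg 27) + 1))
        (.assign 28 (cell 0 (2 * (reg 26 * reg 0 + reg 27) + 2))) .skip) .skip) .skip)
    (.assign 28 0)) <|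
  .store 4 (reg 20) (reg 28)

/-- Output the matrix in array `4`, where entries above register `4` stand for infinity. -/
def outputProg : Prog :=
  .seq (.assign 34 (reg 0 * reg 0)) <| .forTo 20 34 <|
  .seq (.assign 26 (reg 20 / reg 0)) <|
  .seq (.assign 27 (reg 20 - reg 26 * reg 0)) <|
  .seq (.assign 28 (cell 4 (reg 26 * reg 2 + reg 27))) <|
  .ite (.lt (reg 4) (reg 28))
    (.seq (.store 1 (2 * reg 20) 0) (.store 1 (2 * reg 20 + 1) 0))
    (.seq (.store 1 (2 * reg 20) 1) (.store 1 (2 * reg 20 + 1) (reg 28)))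

section

variable {E : Env} {s : State} {Q : State → ℕ → Prop} {G : WDigraph} {n m : ℕ}

/-- The loop stops at the first σ with `n ≤ σ ^ 3`. Rounding the cube root up at most doubles it,
hence the factor 8. -/
theorem sizeProg_wp (ha : s.arr 0 0 = n) (h1 : s.reg 1 = 0)
    (hB : 64 * (n + 1) * (n + 1) ≤ E.B)
    (hQ : ∀ s' t σ, sizeProg.Frame s s' → n ≤ σ ^ 3 → σ ^ 3 ≤ 8 * n → σ ≤ n → s'.reg 0 = n →
      s'.reg 1 = σ → s'.reg 2 = (σ ^ 3 : ℕ) → s'.reg 3 = (σ ^ 3 * σ ^ 3 : ℕ) →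
      s'.reg 10 = (4 * σ + 1 : ℕ) → s'.reg 11 = ((4 * σ + 1) * (4 * σ + 1) : ℕ) →
      s'.reg 13 = (σ * σ : ℕ) → t ≤ 12 * n + 60 → Q s' t) : WP E sizeProg s Q := by
  refine .of_frame ?_
  have hB1 : 64 * (n * n) + 128 * n + 64 ≤ E.B := by linarith
  refine .assign_seq (by simp [ha]; omega) (by simp [ha]; omega) ?_
  simp only [Expr.eval_cell, Expr.eval_ofNat, Nat.cast_zero, ha]
  refine .seq (.loop (fun s' => (n - s'.reg 1).toNat)
    (fun s' t => ∃ k : ℕ, s'.reg 1 = k ∧ k ^ 3 ≤ 8 * n ∧ k ≤ n ∧ t = 12 * k)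
    ⟨0, by simp [h1], by simp, by simp, by simp⟩ (by simp) ?_ ?_)
  · rintro s₁ t₁ ⟨k, hk, hk3, hkn, rfl⟩ hF hc
    have r0 : s₁.reg 0 = n := (hF.1 0 (by decide)).trans (by simp)
    have hlt : k * k * k < n := by
      simp [hk, r0] at hc; exact_mod_cast hc
    have hkn' : k < n := by
      rcases Nat.eq_zero_or_pos k with rfl | hk0
      · simpa using hlt
      · nlinarith [Nat.mul_le_mul hk0 hk0]
    -- For `k > 0` this uses `k + 1 ≤ 2 * k`; for `k = 0` it uses `0 < n`.
    have hcub : (k + 1) ^ 3 ≤ 8 * n := by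
      rcases Nat.eq_zero_or_pos k with rfl | hk0
      · omega
      · calc (k + 1) ^ 3 ≤ (2 * k) ^ 3 := Nat.pow_le_pow_left (by omega) 3
          _ = 8 * (k * k * k) := by ring
          _ ≤ 8 * n := by omega
    refine .assign (by simp) (by simp [hk]; omega) ⟨?_, k + 1, by simp [hk], hcub, hkn', ?_⟩
    · simp [hk]; omega
    · simp; ring
  rintro s₁ t₁ ⟨σ, hσ, hσ3, hσn, rfl⟩ hF hc
  have r0 : s₁.reg 0 = n := (hF.1 0 (by decide)).trans (by simp)
  have hge : n ≤ σ * σ * σ := by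
    simp [hσ, r0] at hc; exact_mod_cast hc
  have hp3 : σ ^ 3 = σ * σ * σ := by ring
  rw [hp3] at hσ3
  have e1 : (σ * σ * σ) * (σ * σ * σ) ≤ E.B := by
    have : (σ * σ * σ) * (σ * σ * σ) ≤ (8 * n) * (8 * n) := Nat.mul_le_mul hσ3 hσ3
    have : (8 * n) * (8 * n) = 64 * (n * n) := by ring
    omega
  have e2 : (4 * σ + 1) * (4 * σ + 1) ≤ E.B := by
    have : (4 * σ + 1) * (4 * σ + 1) ≤ (4 * n + 1) * (4 * n + 1) :=
      Nat.mul_le_mul (by omega) (by omega)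
    have : (4 * n + 1) * (4 * n + 1) = 16 * (n * n) + 8 * n + 1 := by ring
    omega
  have e3 : σ * σ ≤ E.B := by
    have : σ * σ ≤ n * n := Nat.mul_le_mul hσn hσn
    omega
  have e1' : ((σ : ℤ) * σ * σ) * (σ * σ * σ) ≤ E.B := by exact_mod_cast e1
  have e2' : (4 * (σ : ℤ) + 1) * (4 * σ + 1) ≤ E.B := by exact_mod_cast e2
  have e3' : (σ : ℤ) * σ ≤ E.B := by exact_mod_cast e3
  have e4' : (σ : ℤ) * σ * σ ≤ 8 * n := by exact_mod_cast hσ3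
  have p1 : (0 : ℤ) ≤ ((σ : ℤ) * σ * σ) * (σ * σ * σ) := by positivity
  have p2 : (0 : ℤ) ≤ (4 * (σ : ℤ) + 1) * (4 * σ + 1) := by positivity
  have p3 : (0 : ℤ) ≤ (σ : ℤ) * σ := by positivity
  have p4 : (0 : ℤ) ≤ (σ : ℤ) * σ * σ := by positivity
  refine .assign_seq (by simp) (by simp [hσ]; omega) ?_
  refine .assign_seq (by simp) (by simp [hσ]; omega) ?_
  refine .assign_seq (by simp) (by simp [hσ]; omega) ?_
  refine .assign_seq (by simp) (by simp [hσ]; omega) ?_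
  refine .assign (by simp) (by simp [hσ]; omega) fun hF' => ?_
  refine hQ _ _ σ hF' (by omega) (by omega) hσn (by simp [r0]) (by simp [hσ]) (by simp [hσ]; ring)
    (by simp [hσ]; ring) (by simp [hσ]) (by simp [hσ]) (by simp [hσ]) ?_
  simp
  omega

/-- A reading of the cells of the input graph. -/
theorem HoldsGraph.entry {a : ℤ → ℤ} (ha : HoldsGraph a G) (i j : Fin G.n) :
    (G.w i j = ⊤ ∧ a (2 * ((i : ℤ) * G.n + j) + 1) = 0 ∧ a (2 * ((i : ℤ) * G.n + j) + 2) = 0) ∨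
    (G.w i j = a (2 * ((i : ℤ) * G.n + j) + 2) ∧ a (2 * ((i : ℤ) * G.n + j) + 1) = 1 ∧
      |a (2 * ((i : ℤ) * G.n + j) + 2)| ≤ G.maxWeight) := by
  obtain ⟨h1, h2⟩ := ha.2 i j
  rw [add_comm 1] at h1 h2
  rw [add_assoc, one_add_one_eq_two] at h2
  cases hw : G.w i j with
  | top => rw [hw] at h1 h2; exact .inl ⟨rfl, by simpa using h1, by simpa using h2⟩
  | coe d =>
    rw [hw] at h1 h2
    have h2 : a (2 * ((i : ℤ) * G.n + j) + 2) = d := h2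
    rw [h2]
    exact .inr ⟨rfl, by simpa using h1, by
      rw [Int.abs_eq_natAbs]; exact_mod_cast WDigraph.natAbs_le_maxWeight hw⟩

theorem HoldsGraph.abs_le {a : ℤ → ℤ} (ha : HoldsGraph a G) {k : ℕ} (hk : k < G.n * G.n) :
    |a (2 * k + 2)| ≤ G.maxWeight := by
  have h1 : k / G.n < G.n := Nat.div_lt_of_lt_mul hk
  have h2 : k % G.n < G.n :=
    Nat.mod_lt _ (Nat.pos_of_ne_zero fun h => by rw [h] at hk; omega)
  have h3 : ((k / G.n : ℕ) : ℤ) * G.n + (k % G.n : ℕ) = k := by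
    exact_mod_cast Nat.div_add_mod' k G.n
  rcases ha.entry ⟨_, h1⟩ ⟨_, h2⟩ with h | h
  · simp only [h3] at h; rw [h.2.2]; simp
  · simp only [h3] at h; exact h.2.2

/-- An integer is at most its square in absolute value, so the sum of squares bounds all weights
without computing absolute values or a maximum. It is larger than necessary, but still polynomial.
-/
theorem normProg_wp (ha : HoldsGraph (s.arr 0) G) (h0 : s.reg 0 = G.n) (h15 : s.reg 15 = 0)
    (hn : G.n * G.n ≤ E.B) (hM : G.maxWeight ≤ E.B)
    (hB : G.n * G.n * (G.maxWeight * G.maxWeight) ≤ E.B)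
    (hQ : ∀ s' t (M : ℕ), normProg.Frame s s' → s'.reg 15 = M →
      M ≤ G.n * G.n * (G.maxWeight * G.maxWeight) →
      (∀ u v (a : ℤ), G.w u v = (a : WithTop ℤ) → |a| ≤ M) →
      t ≤ 30 * (G.n * G.n) + 10 → Q s' t) : WP E normProg s Q := by
  have hn' : (G.n : ℤ) * G.n ≤ E.B := by exact_mod_cast hn
  have hn0 : (0 : ℤ) ≤ (G.n : ℤ) * G.n := by positivity
  refine .of_frame (.assign_seq (by simp) (by simp [h0]; omega) ?_)
  simp only [Expr.eval_mul, Expr.eval_reg, h0]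
  refine .forTo_le (G.n * G.n) 22 (fun k s' => ∃ M : ℕ, s'.reg 15 = M ∧
    M ≤ k * (G.maxWeight * G.maxWeight) ∧
    ∀ l < k, |s.arr 0 (2 * l + 2)| ≤ M) (by simp) (by decide)
    ⟨0, by simp [h15], by simp, by simp⟩ ?_ ?_
  · rintro k s₁ hk ⟨M, r15, hMk, hl⟩ hx hF
    have a0 : s₁.arr 0 = s.arr 0 := hF.2 0 (by decide)
    have hw := ha.abs_le hk
    obtain ⟨w, hweq⟩ : ∃ w, w = s.arr 0 (2 * k + 2) := ⟨_, rfl⟩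
    rw [← hweq] at hw
    have hw' := abs_le.1 hw
    obtain ⟨v, hv⟩ : ∃ v : ℕ, v = w.natAbs := ⟨_, rfl⟩
    have hvv : w * w = ((v * v : ℕ) : ℤ) := by rw [hv]; push_cast; simp
    have hvM : v * v ≤ G.maxWeight * G.maxWeight := Nat.mul_le_mul (by omega) (by omega)
    have hsucc : M + v * v ≤ (k + 1) * (G.maxWeight * G.maxWeight) := by rw [add_mul]; omega
    have hle : (k + 1) * (G.maxWeight * G.maxWeight) ≤ E.B :=
      (Nat.mul_le_mul_right _ hk).trans hB
    have hvself : v ≤ v * v := Nat.le_mul_self v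
    have hwv : |w| = v := by rw [hv, Int.abs_eq_natAbs]
    refine .assign_seq (by simp [a0, hx, ← hweq]; omega) (by simp [a0, hx, ← hweq]; omega) ?_
    simp only [Expr.eval_cell, Expr.eval_add, Expr.eval_mul, Expr.eval_ofNat, Expr.eval_reg, a0, hx,
      Nat.cast_ofNat, ← hweq]
    refine .assign (by simp) (by simp [r15, hvv]; omega) ⟨by simp, M + v * v, ?_, hsucc, ?_⟩
    · simp [r15, hvv]
    · intro l hlk
      rcases Nat.lt_succ_iff_lt_or_eq.1 hlk with h | rfl
      · have := hl l h; push_cast; nlinarith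
      · rw [← hweq, hwv]; exact_mod_cast hvself.trans (by omega)
  · rintro s₁ t₁ ⟨M, r15, hMk, hl⟩ - - ht₁ hF
    refine hQ _ _ M hF r15 hMk (fun u v a huv => ?_) (by simp; omega)
    rcases ha.entry u v with h | h
    · rw [h.1] at huv; simp at huv
    · rw [h.1] at huv
      have huv : (s.arr 0 (2 * ((u : ℤ) * G.n + v) + 2)) = a := by exact_mod_cast huv
      have := hl (u * G.n + v) (rowMajor_lt u.2 v.2)
      push_cast at this
      rw [huv] at this
      exact this

/-- The last doubling starts below `N`. The additional 1 in the upper bound is for `N = 0`, where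
the power is 1. -/
theorem powerProg_wp {x l y : ℕ} {N : ℕ} (hxl : x ≠ l) (hxy : x ≠ y) (hly : l ≠ y)
    (hN : s.reg y = N) (hB : 2 * N + 1 ≤ E.B)
    (hQ : ∀ s' t (e : ℕ), (powerProg x l y).Frame s s' → s'.reg x = 2 ^ e → s'.reg l = e →
      N ≤ 2 ^ e → 2 ^ e ≤ 2 * N + 1 → t ≤ 12 * e + 10 → Q s' t) : WP E (powerProg x l y) s Q := by
  have hB8 := E.eight_le
  refine .of_frame (.assign_seq (by simp) (by simp; omega) ?_ (by decide))
  refine .assign_seq (by simp) (by simp) ?_ (by decide)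
  have hd : (Expr.lt (reg x) (reg y)).deg ≤ 40 := by change 2 ≤ 40; norm_num
  have hd1 : (reg x + reg x).deg ≤ 40 := by change 2 ≤ 40; norm_num
  have hd2 : (reg l + 1).deg ≤ 40 := by change 2 ≤ 40; norm_num
  simp only [Expr.eval_ofNat]
  refine .loop (fun s' => (N - s'.reg x).toNat)
    (fun s' t => ∃ e : ℕ, s'.reg x = 2 ^ e ∧ s'.reg l = e ∧ s'.reg y = N ∧ 2 ^ e ≤ 2 * N + 1 ∧
      t = 12 * e) ⟨0, by simp [hxl], by simp, by simp [hxy.symm, hly.symm, hN], by simp, by simp⟩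
    (by simp) ?_ ?_ hd
  · rintro s₁ t₁ ⟨e, rx, rl, ry, hle, rfl⟩ hF hc
    have hlt : 2 ^ e < N := by simp [rx, ry] at hc; exact_mod_cast hc
    have hee : e < 2 ^ e := Nat.lt_two_pow_self
    have hp : (2 : ℤ) ^ e + 2 ^ e = 2 ^ (e + 1) := by ring
    have hp' : (2 : ℕ) ^ e + 2 ^ e = 2 ^ (e + 1) := by ring
    have hlt' : (2 : ℤ) ^ e < N := by exact_mod_cast hlt
    have hpos : (0 : ℤ) < 2 ^ e := by positivity
    refine .assign_seq (by simp) (by simp [rx]; omega) ?_ hd1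
    refine .assign (by simp) (by simp [hxl.symm, rl]; omega) ⟨?_, e + 1, ?_, ?_, ?_, ?_, ?_⟩ hd2
    · simp [hxl, rx]; omega
    · simp [hxl, rx, hp]
    · simp [hxl.symm, rl]
    · simp [hxy.symm, hly.symm, ry]
    · omega
    · simp; ring
  · rintro s₁ t₁ ⟨e, rx, rl, ry, hle, rfl⟩ hF hc hF'
    have hge : N ≤ 2 ^ e := by simp [rx, ry] at hc; exact_mod_cast hc
    exact hQ _ _ e hF' rx rl hge hle (by simp; omega)

end

section

variable {E : Env} {s : State} {Q : State → ℕ → Prop} {G : WDigraph} {n m : ℕ}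

/-- The padding beyond the vertices of `G` and the missing edges are both left at `H`. The diagonal
is set to zero whatever loops the graph has. -/
theorem fillProg_wp {H : ℤ} (ha : HoldsGraph (s.arr 0) G) (h0 : s.reg 0 = G.n) (h2 : s.reg 2 = m)
    (h3 : s.reg 3 = (m * m : ℕ)) (h5 : s.reg 5 = H) (hM : G.maxWeight ≤ H) (hB : H ≤ E.B)
    (h4 : ∀ c, |s.arr 4 c| ≤ H)
    (hQ : ∀ s' t, fillProg.Frame s s' → (∀ c, |s'.arr 4 c| ≤ H) →
      (∀ i j : ℕ, i < m → j < m → mat (s'.arr 4) m i j = G.finWeight H i j) →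
      t ≤ 70 * (m * m) + 6 → Q s' t) : WP E fillProg s Q := by
  have hB8 := E.eight_le
  refine .of_bounded fun hbd => ?_
  have hmB := (hbd.1 3).2
  rw [h3] at hmB
  refine .forTo_le (m * m) 62 (fun k s' => (∀ c, |s'.arr 4 c| ≤ H) ∧
    ∀ l < k, s'.arr 4 l = G.finWeight H (l / m) (l % m)) h3 (by decide)
    ⟨h4, by simp⟩ ?_ ?_
  · rintro k s₁ hk ⟨i1, i2⟩ hx hF
    obtain ⟨i, hi⟩ : ∃ i, i = k / m := ⟨_, rfl⟩
    obtain ⟨j, hj⟩ : ∃ j, j = k % m := ⟨_, rfl⟩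
    have a0 : s₁.arr 0 = s.arr 0 := hF.2 0 (by decide)
    have r0 : s₁.reg 0 = G.n := (hF.1 0 (by decide)).trans h0
    have r2 : s₁.reg 2 = m := (hF.1 2 (by decide)).trans h2
    have r5 : s₁.reg 5 = H := (hF.1 5 (by decide)).trans h5
    have c1 : (k : ℤ) / m = i := by rw [hi]; push_cast; rfl
    have c2 : (k : ℤ) - i * m = j := by rw [hi, hj]; exact natCast_sub_ediv_mul k m
    have hik : i ≤ k := hi ▸ Nat.div_le_self _ _
    have hjk : j ≤ k := hj ▸ Nat.mod_le _ _
    refine .assign_seq (by simp) (by simp [hx, r2, c1]; omega) ?_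
    simp only [Expr.eval_div, Expr.eval_reg, hx, r2, c1]
    refine .assign_seq (by simp) (by simp [hx, r2, c2]; omega) ?_
    simp only [Expr.eval_sub, Expr.eval_mul, Expr.eval_reg, State.reg_setReg, Nat.reduceEqDiff,
      if_true, if_false, hx, r2, c2]
    refine .assign_seq (by simp) (by simp [r5]; omega) ?_
    simp only [Expr.eval_reg, State.reg_setReg, Nat.reduceEqDiff, if_false, r5]
    set s₂ := ((s₁.setReg 26 i).setReg 27 j).setReg 28 H with hs₂
    have b0 : s₂.arr 0 = s.arr 0 := a0
    have b4 : s₂.arr 4 = s₁.arr 4 := rfl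
    have q0 : s₂.reg 0 = G.n := by simp [hs₂, r0]
    have q20 : s₂.reg 20 = k := by simp [hs₂, hx]
    have q26 : s₂.reg 26 = i := by simp [hs₂]
    have q27 : s₂.reg 27 = j := by simp [hs₂]
    have q28 : s₂.reg 28 = H := by simp [hs₂]
    clear_value s₂
    have hH := G.abs_finWeight_le (M := G.maxWeight) (H := H) (fun u v a h => by
      rw [Int.abs_eq_natAbs]; exact_mod_cast G.natAbs_le_maxWeight h) hM (by omega) i j
    have hH' := abs_le.1 hH
    have key : WP E (.ite (reg 26 - reg 27)
        (.ite (.lt (reg 26) (reg 0)) (.ite (.lt (reg 27) (reg 0))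
          (.ite (cell 0 (2 * (reg 26 * reg 0 + reg 27) + 1))
            (.assign 28 (cell 0 (2 * (reg 26 * reg 0 + reg 27) + 2))) .skip) .skip) .skip)
        (.assign 28 0)) s₂ fun s' t => s'.reg 28 = G.finWeight H i j ∧ s'.reg 20 = k ∧
          s'.arr 4 = s₁.arr 4 ∧ t ≤ 42 := by
      refine .ite (by simp) (fun hc => ?_) (fun hc => ?_)
      · have hne : i ≠ j := by rintro rfl; simp [q26, q27] at hc
        refine .ite_lt (by simp) (by simp) (fun hc1 => ?_) (fun hc1 => ?_)
        · have hin : i < G.n := by simp [q26, q0] at hc1; exact hc1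
          refine .ite_lt (by simp) (by simp) (fun hc2 => ?_) (fun hc2 => ?_)
          · have hjn : j < G.n := by simp [q27, q0] at hc2; exact hc2
            have hfw : G.finWeight H i j = (G.w ⟨i, hin⟩ ⟨j, hjn⟩).untopD H := by
              simp [WDigraph.finWeight, hne, hin, hjn]
            rcases ha.entry ⟨i, hin⟩ ⟨j, hjn⟩ with ⟨e1, e2, e3⟩ | ⟨e1, e2, e3⟩
            · simp only at e2 e3
              refine .ite (by simp [b0, q26, q27, q0, e2]) (fun hc3 => ?_) (fun _ => ?_)
              · simp [b0, q26, q27, q0, e2] at hc3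
              · refine .skip ⟨?_, q20, b4, by simp⟩
                rw [q28, hfw, e1]; rfl
            · simp only at e2 e3
              have hv : s.arr 0 (2 * ((i : ℤ) * G.n + j) + 2) = G.finWeight H i j := by
                rw [hfw, e1]; rfl
              refine .ite (by simp [b0, q26, q27, q0, e2]; omega) (fun _ => ?_) (fun hc3 => ?_)
              · refine .assign (by simp [b0, q26, q27, q0, hv]; omega)
                  (by simp [b0, q26, q27, q0, hv]; omega) ⟨?_, by simp [q20], b4, by simp⟩
                simp [b0, q26, q27, q0, hv]
              · simp [b0, q26, q27, q0, e2] at hc3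
          · have hjn : ¬ j < G.n := by simp [q27, q0] at hc2; omega
            exact .skip ⟨by simp [q28, WDigraph.finWeight, hne, hjn], q20, b4, by simp⟩
        · have hin : ¬ i < G.n := by simp [q26, q0] at hc1; omega
          exact .skip ⟨by simp [q28, WDigraph.finWeight, hne, hin], q20, b4, by simp⟩
      · have heq : i = j := by simp [q26, q27] at hc; omega
        exact .assign (by simp) (by simp) ⟨by simp [WDigraph.finWeight, heq], by simp [q20], b4,
          by simp⟩
    refine .seq (key.mono ?_)
    rintro s₃ t₃ - - ⟨g28, g20, g4, ht₃⟩
    refine .store (by simp) (by simp) (by simp [g28]; omega) ⟨by simp; omega, ?_, ?_⟩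
    · intro c
      simp only [State.arr_setReg, State.arr_setCell_same, Function.update_apply, Expr.eval_reg,
        g28, g4]
      split
      · exact hH
      · exact i1 c
    · intro l hl
      simp only [State.arr_setReg, State.arr_setCell_same, Function.update_apply, Expr.eval_reg,
        g28, g4, g20]
      split
      · next h => rw [show l = k by exact_mod_cast h, hi, hj]
      · next h => exact i2 l (by omega)
  · rintro s₁ t₁ ⟨i1, i2⟩ - hF ht
    refine hQ _ _ hF i1 (fun i j hi hj => ?_) (by omega)
    have := i2 (i * m + j) (rowMajor_lt hi hj)
    rw [rowMajor_div hj, rowMajor_mod hj] at this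
    rw [mat, ← this]
    push_cast; rfl

theorem outputProg_wp {q : ℤ} {A : ℕ → ℕ → ℤ} (h0 : s.reg 0 = n) (h2 : s.reg 2 = m)
    (h4 : s.reg 4 = q) (hB : n * n ≤ E.B)
    (hA : ∀ i j : ℕ, i < n → j < n → mat (s.arr 4) m i j = A i j)
    (hQ : ∀ s' t, outputProg.Frame s s' →
      HoldsMatrix (s'.arr 1) 0 (fun u v : Fin n => if A u v ≤ q then (A u v : WithTop ℤ) else ⊤) →
      t ≤ 50 * (n * n) + 10 → Q s' t) : WP E outputProg s Q := by
  have hB8 := E.eight_le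
  have hn0 : (0 : ℤ) ≤ (n : ℤ) * n := by positivity
  have hnB : (n : ℤ) * n ≤ E.B := by exact_mod_cast hB
  refine .of_frame (.assign_seq (by simp) (by simp [h0]; omega) ?_)
  simp only [Expr.eval_mul, Expr.eval_reg, h0]
  refine .forTo_le (n * n) 42 (fun k s' => ∀ l < k,
    s'.arr 1 (2 * l) = (if A (l / n) (l % n) ≤ q then 1 else 0) ∧
    s'.arr 1 (2 * l + 1) = (if A (l / n) (l % n) ≤ q then A (l / n) (l % n) else 0))
    (by simp) (by decide) (by simp) ?_ ?_
  · rintro k s₁ hk i1 hx hF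
    refine .of_bounded fun hbd => ?_
    obtain ⟨i, hi⟩ : ∃ i, i = k / n := ⟨_, rfl⟩
    obtain ⟨j, hj⟩ : ∃ j, j = k % n := ⟨_, rfl⟩
    have hin : i < n := hi ▸ Nat.div_lt_of_lt_mul hk
    have hjn : j < n := hj ▸ Nat.mod_lt _ (by omega)
    have a4 : s₁.arr 4 = s.arr 4 := hF.2 4 (by decide)
    have r0 : s₁.reg 0 = n := (hF.1 0 (by decide)).trans (by simp [h0])
    have r2 : s₁.reg 2 = m := (hF.1 2 (by decide)).trans (by simp [h2])
    have r4 : s₁.reg 4 = q := (hF.1 4 (by decide)).trans (by simp [h4])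
    have c1 : (k : ℤ) / n = i := by rw [hi]; push_cast; rfl
    have c2 : (k : ℤ) - i * n = j := by rw [hi, hj]; exact natCast_sub_ediv_mul k n
    have hik : i ≤ k := hi ▸ Nat.div_le_self _ _
    have hjk : j ≤ k := hj ▸ Nat.mod_le _ _
    have hv : s₁.arr 4 (i * m + j) = A i j := by rw [a4]; exact hA i j hin hjn
    have hvB := hbd.2 4 (by decide) (by decide) (i * m + j)
    rw [hv] at hvB
    refine .assign_seq (by simp) (by simp [hx, r0, c1]; omega) ?_
    simp only [Expr.eval_div, Expr.eval_reg, hx, r0, c1]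
    refine .assign_seq (by simp) (by simp [hx, r0, c2]; omega) ?_
    simp only [Expr.eval_sub, Expr.eval_mul, Expr.eval_reg, State.reg_setReg, Nat.reduceEqDiff,
      if_true, if_false, hx, r0, c2]
    refine .assign_seq (by simp) (by simp [r2, hv]; omega) ?_
    simp only [Expr.eval_cell, Expr.eval_add, Expr.eval_mul, Expr.eval_reg, State.reg_setReg,
      Nat.reduceEqDiff, if_true, if_false, State.arr_setReg, r2, hv]
    have hfin : ∀ (a : ℤ → ℤ) (x y : ℤ), a = Function.update (Function.update (s₁.arr 1) (2 * k) x)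
        (2 * k + 1) y → x = (if A i j ≤ q then 1 else 0) → y = (if A i j ≤ q then A i j else 0) →
        ∀ l < k + 1, a (2 * l) = (if A (l / n) (l % n) ≤ q then 1 else 0) ∧
          a (2 * l + 1) = (if A (l / n) (l % n) ≤ q then A (l / n) (l % n) else 0) := by
      rintro a x y rfl hxe hye l hl
      rcases Nat.lt_succ_iff_lt_or_eq.1 hl with h | rfl
      · rw [Function.update_of_ne (by omega), Function.update_of_ne (by omega),
          Function.update_of_ne (by omega), Function.update_of_ne (by omega)]
        exact i1 l h
      · rw [← hi, ← hj, Function.update_of_ne (by omega), Function.update_self,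
          Function.update_self]
        exact ⟨hxe, hye⟩
    refine .ite_lt (by simp) (by simp) (fun hc => ?_) (fun hc => ?_)
    · have hlt : ¬ A i j ≤ q := by simp [r4] at hc; omega
      refine .store_seq (by simp) (by simp) (by simp) ?_
      refine .store (by simp) (by simp) (by simp) ⟨by simp, ?_⟩
      refine hfin _ 0 0 ?_ (by simp [hlt]) (by simp [hlt])
      simp [hx]
    · have hle : A i j ≤ q := by simpa [r4] using hc
      refine .store_seq (by simp) (by simp) (by simp; omega) ?_
      refine .store (by simp) (by simp) (by simp; omega) ⟨by simp, ?_⟩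
      refine hfin _ 1 (A i j) ?_ (by simp [hle]) (by simp [hle])
      simp [hx]
  · rintro s₁ t₁ i1 - - ht hF
    refine hQ _ _ hF (fun u v => ?_) (by simp; omega)
    have := i1 (u * n + v) (rowMajor_lt u.2 v.2)
    rw [rowMajor_div v.2, rowMajor_mod v.2] at this
    push_cast at this
    rw [zero_add, this.1, this.2]
    by_cases hle : A u v ≤ q <;> simp [hle]

end

/-- Reduce all-pairs shortest paths to CoDiameter by repeated squaring. -/
def apspProg : Prog :=
  .seq sizeProg <| .seq normProg <| .seq (powerProg 14 8 0) <|
  .seq (.assign 4 (reg 14 * reg 15)) <|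
  .seq (.assign 5 (reg 4 + reg 4 + 1)) <|
  .seq (.assign 26 (reg 14 * reg 5 + 1)) <|
  .seq (powerProg 6 7 26) <|
  .seq (.assign 7 (reg 7 + 1)) <|
  .seq (.assign 12 (4 * reg 6)) <|
  .seq fillProg <| .seq (.forTo 20 8 squareProg) outputProg

/-- A bound for the time of one squaring. -/
def squareTime (σ τ f : ℕ) : ℕ :=
  (f + 1) * (3 * searchTime σ τ * (σ ^ 3 * σ ^ 3) + 60 * (σ ^ 3 * σ ^ 3) + 20) +
    40 * (σ ^ 3 * σ ^ 3) + 30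

theorem IsMinWalk.congr {W A A' : ℕ → ℕ → ℤ} {m k : ℕ} (h : IsMinWalk W m k A)
    (hA : ∀ i j, i < m → j < m → A' i j = A i j) : IsMinWalk W m k A' := fun i j hi hj => by
  rw [hA i j hi hj]
  exact h i j hi hj

theorem WDigraph.maxWeight_le {G : WDigraph} {M : ℕ}
    (h : ∀ u v (a : ℤ), G.w u v = (a : WithTop ℤ) → |a| ≤ M) : G.maxWeight ≤ M := by
  refine Finset.sup_le fun p _ => ?_
  cases hw : G.w p.1 p.2 with
  | top => simp
  | coe d =>
    have := h _ _ _ hw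
    rw [Int.abs_eq_natAbs] at this
    exact_mod_cast this

section

variable {E : Env} {s : State} {Q : State → ℕ → Prop}

theorem Work.congr {s' : State} {σ f : ℕ} (h : Work E σ f s)
    (h' : ∀ x ∈ [1, 2, 3, 10, 11, 12, 13, 6, 7], s'.reg x = s.reg x)
    (h4 : s'.arr 4 = s.arr 4) (h5 : s'.arr 5 = s.arr 5) : Work E σ f s' where
  sizes := h.sizes.congr fun x hx => h' x (by simp at hx ⊢; tauto)
  r6 := (h' 6 (by simp)).trans h.r6
  r7 := (h' 7 (by simp)).trans h.r7
  le := h.le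
  sq_le := h.sq_le
  a4 := h4 ▸ h.a4
  a5 := h5 ▸ h.a5

/-- All matrices that occur consist of weights of walks with at most `2 ^ e` steps, so their entries
are at most `2 ^ e * H` in absolute value. The condition `hHf` puts them strictly inside the range
of the binary search. -/
theorem squaring_wp {σ τ e f : ℕ} {H : ℤ} {W : ℕ → ℕ → ℤ} (hs : SolvesCoDiameter E (4 * σ + 1) τ)
    (hw : Work E σ f s) (h8 : s.reg 8 = e) (hH : ∀ i j, |W i j| ≤ H) (hHf : 2 ^ e * H < 2 ^ f)
    (hA : ∀ i j : ℕ, i < σ ^ 3 → j < σ ^ 3 → mat (s.arr 4) (σ ^ 3 : ℕ) i j = W i j)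
    (hQ : ∀ s' t, (squareProg.forTo 20 8).Frame s s' →
      IsMinWalk W (σ ^ 3) (2 ^ e) (fun i j => mat (s'.arr 4) (σ ^ 3 : ℕ) i j) →
      t ≤ e * (squareTime σ τ f + 8) + 6 → Q s' t) :
    WP E (squareProg.forTo 20 8) s Q := by
  have hH0 : 0 ≤ H := (abs_nonneg _).trans (hH 0 0)
  refine .forTo_le e (squareTime σ τ f) (fun k s' => Work E σ f s' ∧
    IsMinWalk W (σ ^ 3) (2 ^ k) (fun i j => mat (s'.arr 4) (σ ^ 3 : ℕ) i j)) h8 (by decide)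
    ⟨hw.congr (by simp) rfl rfl, (isMinWalk_one W _).congr hA⟩ ?_
    fun s' t h _ hF ht => hQ s' t hF h.2 ht
  rintro k s₁ hk ⟨i1, i2⟩ - -
  obtain ⟨C, hC⟩ := exists_isMinPlusSq (σ ^ 3) (fun i j => mat (s₁.arr 4) (σ ^ 3 : ℕ) i j)
  have hsq := i2.sq hC
  have hle : (2 : ℤ) ^ k + 2 ^ k ≤ 2 ^ e := by
    have : (2 : ℤ) ^ k + 2 ^ k = 2 ^ (k + 1) := by ring
    rw [this]
    exact pow_le_pow_right₀ (by norm_num) hk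
  refine squareProg_wp hs i1 hC (fun i j hi hj => ?_) fun s₂ t₂ hF hw₂ hm ht => ⟨ht, ?_, ?_⟩
  · have h1 := (hsq i j hi hj).1.abs_le hH
    have h2 : (((2 ^ k + 2 ^ k : ℕ) : ℤ)) * H ≤ 2 ^ e * H :=
      mul_le_mul_of_nonneg_right (by exact_mod_cast hle) hH0
    have h3 := abs_le.1 (h1.trans h2)
    omega
  · exact hw₂.congr (by simp) rfl rfl
  · rw [pow_succ 2 k, mul_two]
    exact hsq.congr hm

end

theorem solvesCoDiameter {O : CoDiameter.Inst → ℤ → ℤ} {T : ℕ → ℕ → ℕ} {W B v τ : ℕ} (h8 : 8 ≤ B)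
    (hW : B ^ 40 ≤ W) (hO : IsOracle CoDiameter O) (hT : ∀ M ≤ B, T v M ≤ τ) :
    SolvesCoDiameter ⟨CoDiameter, O, T, W, B, h8, hW⟩ v τ := by
  intro s Q G hG hv hM ha hQ
  refine .call (⟨G, hG⟩ : CoDiameter.Inst) ha (hQ _ _ (hO ⟨G, hG⟩) ?_)
  change 1 + T G.n G.maxWeight ≤ _
  rw [hv]
  exact Nat.add_le_add_left (hT _ hM) 1

/-- With `M` the sum of the squared weights and `N = 2 ^ e ≤ 2 * n + 1`, the program uses the
threshold `q = N * M`, the infinity `2 * q + 1`, and the first power `2 ^ f` above `X = N * (2 * q +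
1)`. The nested product in `hB` follows these steps: `D`, `P` and `Y` bound `M`, `q` and `X`, then
`2 * (Y + 1) + 1` bounds `2 ^ f`, and the factor 12 is the one in `Work.le`. -/
theorem apspProg_wp {O : CoDiameter.Inst → ℤ → ℤ} {T : ℕ → ℕ → ℕ} {W B : ℕ} {τ : ℕ → ℕ}
    (h8 : 8 ≤ B) (hW : B ^ 40 ≤ W) (hO : IsOracle CoDiameter O) (G : WDigraph)
    (hG : G.NoNegCycle) (hT : ∀ σ M, G.n ≤ σ ^ 3 → M ≤ B → T (4 * σ + 1) M ≤ τ σ) {a : ℤ → ℤ}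
    (ha : HoldsGraph a G) (hM : G.maxWeight ≤ B) (hn : 64 * (G.n + 1) * (G.n + 1) ≤ B)
    (hB : 12 * (2 * ((2 * G.n + 1) * (2 * ((2 * G.n + 1) *
      (G.n * G.n * (G.maxWeight * G.maxWeight))) + 1) + 1) + 1) ≤ B) :
    WP ⟨CoDiameter, O, T, W, B, h8, hW⟩ apspProg (State.start a) fun s t =>
      APSP.Output ⟨G, hG⟩ (s.arr 1) ∧ ∃ σ e f : ℕ, σ ^ 3 ≤ 8 * G.n ∧ 2 ^ e ≤ 2 * G.n + 1 ∧
        2 ^ f ≤ B ∧ t ≤ 12 * G.n + 80 * (G.n * G.n) + 12 * e + 12 * f + 70 * (σ ^ 3 * σ ^ 3) +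
          e * (squareTime σ (τ σ) f + 8) + 150 := by
  obtain ⟨n, hnn⟩ : ∃ n, n = G.n := ⟨_, rfl⟩
  obtain ⟨D, hD⟩ : ∃ D, D = G.n * G.n * (G.maxWeight * G.maxWeight) := ⟨_, rfl⟩
  obtain ⟨P, hP⟩ : ∃ P, P = (2 * n + 1) * D := ⟨_, rfl⟩
  obtain ⟨Y, hY⟩ : ∃ Y, Y = (2 * n + 1) * (2 * P + 1) := ⟨_, rfl⟩
  rw [← hD, ← hnn, ← hP, ← hY] at hB
  have hDP : D ≤ P := hP ▸ Nat.le_mul_of_pos_left _ (by omega)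
  have hPY : 2 * P + 1 ≤ Y := hY ▸ Nat.le_mul_of_pos_left _ (by omega)
  have hn' : 64 * (n * n) + 128 * n + 64 ≤ B := by rw [hnn]; linarith
  have hh8 : (8 : ℤ) ≤ B := by exact_mod_cast h8
  have s0a : (State.start a).arr 0 = a := by simp [State.start]
  have s0r : ∀ x, (State.start a).reg x = 0 := fun x => rfl
  have s0a4 : (State.start a).arr 4 = fun _ => 0 := by simp [State.start]
  have s0a5 : (State.start a).arr 5 = fun _ => 0 := by simp [State.start]
  generalize State.start a = s0 at s0a s0r s0a4 s0a5
  refine .seq (sizeProg_wp (n := G.n) (by rw [s0a]; exact ha.1) (s0r 1) hn ?_)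
  intro s₁ t₁ σ F₁ hnσ hσn hσn' r0 r1 r2 r3 r10 r11 r13 ht₁
  have a10 : s₁.arr 0 = a := (F₁.2 0 (by decide)).trans s0a
  have a14 : s₁.arr 4 = fun _ => 0 := (F₁.2 4 (by decide)).trans s0a4
  have a15 : s₁.arr 5 = fun _ => 0 := (F₁.2 5 (by decide)).trans s0a5
  have r1_15 : s₁.reg 15 = 0 := (F₁.1 15 (by decide)).trans (s0r 15)
  refine .seq (normProg_wp (G := G) (by rw [a10]; exact ha) r0 r1_15
    (by change G.n * G.n ≤ B; rw [← hnn]; omega) hM (by change _ ≤ B; rw [← hD]; omega) ?_)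
  intro s₂ t₂ M F₂ r2_15 hMD hMw ht₂
  rw [← hD] at hMD
  refine .seq (powerProg_wp (N := n) (by decide) (by decide) (by decide)
    ((F₂.1 0 (by decide)).trans (by rw [r0, hnn])) (by change _ ≤ B; omega) ?_)
  intro s₃ t₃ e F₃ r14 r8 hne hen ht₃
  obtain ⟨N, hN⟩ : ∃ N, N = 2 ^ e := ⟨_, rfl⟩
  rw [← hN] at hne hen
  have r14' : s₃.reg 14 = N := by rw [r14, hN]; push_cast; rfl
  have r15 : s₃.reg 15 = M := (F₃.1 15 (by decide)).trans r2_15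
  have hNM : N * M ≤ P := hP ▸ Nat.mul_le_mul hen hMD
  have hNH : N * (2 * (N * M) + 1) ≤ Y := hY ▸ Nat.mul_le_mul hen (by omega)
  obtain ⟨q, hq⟩ : ∃ q, q = N * M := ⟨_, rfl⟩
  obtain ⟨X, hX⟩ : ∃ X, X = N * (2 * q + 1) := ⟨_, rfl⟩
  rw [← hq] at hNM hNH
  rw [← hX] at hNH
  have e1 : (N : ℤ) * M = q := by rw [hq]; push_cast; rfl
  have e2 : (q : ℤ) + q + 1 = (2 * q + 1 : ℕ) := by push_cast; ring
  have e3 : (N : ℤ) * (2 * q + 1 : ℕ) + 1 = (X + 1 : ℕ) := by rw [hX]; push_cast; rfl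
  refine .assign_seq (by simp) (by simp only [Expr.eval_mul, Expr.eval_reg, r14', r15, e1]; omega) ?_
  simp only [Expr.eval_mul, Expr.eval_reg, r14', r15, e1]
  refine .assign_seq (by simp) (by simp; omega) ?_
  simp only [Expr.eval_add, Expr.eval_reg, Expr.eval_ofNat, State.reg_setReg, if_true,
    Nat.cast_one, e2]
  refine .assign_seq (by simp) (by
    simp only [Expr.eval_add, Expr.eval_mul, Expr.eval_reg, Expr.eval_ofNat, State.reg_setReg,
      Nat.reduceEqDiff, if_true, if_false, Nat.cast_one, r14', e3]; omega) ?_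
  simp only [Expr.eval_add, Expr.eval_mul, Expr.eval_reg, Expr.eval_ofNat, State.reg_setReg,
    Nat.reduceEqDiff, if_true, if_false, Nat.cast_one, r14', e3]
  refine .seq (powerProg_wp (N := X + 1) (by decide) (by decide) (by decide) (by simp)
    (by change _ ≤ B; omega) ?_)
  intro s₄ t₄ f F₄ r6 r7 hXf hfX ht₄
  have hef : e ≤ B := by have : e < 2 ^ e := Nat.lt_two_pow_self; omega
  have hfB : f < 2 ^ f := Nat.lt_two_pow_self
  have hR : (2 : ℤ) ^ f = (2 ^ f : ℕ) := by push_cast; rfl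
  refine .assign_seq (by simp) (by simp [r7]; omega) ?_
  simp only [Expr.eval_add, Expr.eval_reg, Expr.eval_ofNat, r7]
  refine .assign_seq (by simp) (by simp [r6]; omega) ?_
  simp only [Expr.eval_mul, Expr.eval_reg, Expr.eval_ofNat, State.reg_setReg,
    Nat.reduceEqDiff, if_false, r6]
  have F4 : ∀ x ∈ [0, 1, 2, 3, 8, 10, 11, 13], s₄.reg x = s₃.reg x := fun x hx => by
    rw [F₄.1 x (by revert x; decide)]
    fin_cases hx <;> simp
  have F43 : ∀ x ∈ [0, 1, 2, 3, 10, 11, 13], s₄.reg x = s₁.reg x := fun x hx => by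
    rw [F4 x (by simp at hx ⊢; tauto), F₃.1 x (by revert x; decide), F₂.1 x (by revert x; decide)]
  have a4 : ∀ r ∈ [0, 4, 5], s₄.arr r = s₁.arr r := fun r hr => by
    rw [F₄.2 r (by revert r; decide)]
    exact (F₃.2 r (by revert r; decide)).trans (F₂.2 r (by revert r; decide))
  have r5 : s₄.reg 5 = (2 * q + 1 : ℕ) := (F₄.1 5 (by decide)).trans (by simp)
  have r4 : s₄.reg 4 = q := (F₄.1 4 (by decide)).trans (by simp)
  refine .seq (fillProg_wp (G := G) (m := σ ^ 3) (H := (2 * q + 1 : ℕ))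
    (by simp only [State.arr_setReg]; rw [a4 0 (by simp), a10]; exact ha)
    (by simp [F43, r0]) (by simp [F43, r2]) (by simp [F43, r3]) (by simp [r5])
    (by
      have h1 : G.maxWeight ≤ M := WDigraph.maxWeight_le hMw
      rcases Nat.eq_zero_or_pos N with h | h
      · exact absurd (hN ▸ h) (by positivity)
      · have : M ≤ q := hq ▸ Nat.le_mul_of_pos_left _ h
        omega) (by simp; omega)
    (by simp [a4, a14]; omega) ?_)
  intro s₅ t₅ F₅ h5 hA ht₅
  have a55 : s₅.arr 5 = fun _ => 0 := by
    rw [F₅.2 5 (by decide)]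
    simp [a4, a15]
  have F5 : ∀ x ∈ [0, 1, 2, 3, 10, 11, 13], s₅.reg x = s₁.reg x := fun x hx => by
    rw [F₅.1 x (by revert x; decide), ← F43 x hx]
    fin_cases hx <;> simp
  have hw : Work ⟨CoDiameter, O, T, W, B, h8, hW⟩ σ f s₅ := by
    refine ⟨⟨?_, ?_, ?_, ?_, ?_, ?_, ?_⟩, ?_, ?_, ?_, ?_, ?_, ?_⟩
    · rw [F5 1 (by simp), r1]
    · rw [F5 2 (by simp), r2]
    · rw [F5 3 (by simp), r3]
    · rw [F5 10 (by simp), r10]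
    · rw [F5 11 (by simp), r11]
    · rw [F₅.1 12 (by decide)]; simp
    · rw [F5 13 (by simp), r13]
    · rw [F₅.1 6 (by decide)]; simp [r6]
    · rw [F₅.1 7 (by decide)]; simp
    · change _ ≤ (B : ℤ); omega
    · change _ ≤ B
      have h1 : (4 * σ + 1) * (4 * σ + 1) ≤ (4 * n + 1) * (4 * n + 1) :=
        Nat.mul_le_mul (by omega) (by omega)
      have h2 : (4 * n + 1) * (4 * n + 1) = 16 * (n * n) + 8 * n + 1 := by ring
      omega
    · intro c
      have h1 := abs_le.1 (h5 c)
      have h2 : 2 * q + 1 ≤ X := by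
        rw [hX]
        exact Nat.le_mul_of_pos_left _ (by rw [hN]; positivity)
      omega
    · intro c
      rw [a55]
      simp
  refine .seq (squaring_wp (e := e) (H := (2 * q + 1 : ℕ)) (W := G.finWeight (2 * q + 1 : ℕ))
    (solvesCoDiameter h8 hW hO fun M hM => hT σ M hnσ hM) hw ?_
    (fun i j => G.abs_finWeight_le (M := M) hMw ?_ (by positivity) i j) ?_ hA ?_)
  · rw [F₅.1 8 (by decide)]
    simp [F4, r8]
  · have : M ≤ q := hq ▸ Nat.le_mul_of_pos_left _ (by rw [hN]; positivity)
    push_cast; omega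
  · rw [← Nat.cast_ofNat, ← Nat.cast_pow, ← Nat.cast_pow, ← hN]
    exact_mod_cast lt_of_lt_of_le (by omega : N * (2 * q + 1) < X + 1) hXf
  intro s₆ t₆ F₆ hmin ht₆
  refine outputProg_wp (n := G.n) (m := σ ^ 3) (q := q)
    (A := fun i j => mat (s₆.arr 4) (σ ^ 3 : ℕ) i j) ?_ ?_ ?_
    (by change G.n * G.n ≤ B; rw [← hnn]; omega) (fun i j _ _ => rfl) ?_
  · rw [F₆.1 0 (by decide), F5 0 (by simp), r0]
  · rw [F₆.1 2 (by decide), F5 2 (by simp), r2]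
  · rw [F₆.1 4 (by decide), F₅.1 4 (by decide)]; simp [r4]
  intro s₇ t₇ F₇ hout ht₇
  rw [← hN] at hmin
  -- The output replaces entries above `q = N * M` by infinity, which is precisely the threshold of
  -- this lemma.
  have hdist := WDigraph.isDist_of_isMinWalk (M := M) (N := N) hG hMw (by positivity)
    (by omega) hnσ (A := fun i j => mat (s₆.arr 4) (σ ^ 3 : ℕ) i j) (by
      convert hmin using 2
      rw [e1]; push_cast; ring)
  rw [e1] at hdist
  refine ⟨⟨_, hdist, hout⟩, σ, e, f, hσn, by omega, by omega, ?_⟩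
  rw [← hnn] at ht₁ ht₂ ht₇ ⊢
  simp only [Expr.cost_mul, Expr.cost_add, Expr.cost_reg, Expr.cost_ofNat]
  omega

/-! ### The running time -/

/-- The exponent `e` is logarithmic in `y`, and `log y ≤ y ^ η / η` trades the logarithm for an
arbitrarily small power. -/
theorem natCast_le_mul_rpow {y η : ℝ} {e b : ℕ} (hy : 1 ≤ y) (hη : 0 < η)
    (h : (2 : ℝ) ^ e ≤ (2 * y) ^ b) : (e : ℝ) ≤ 2 * b * (1 + 1 / η) * y ^ η := by
  have hy0 : 0 < y := by linarith
  have h1 := Real.log_le_log (by positivity) h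
  rw [Real.log_pow, Real.log_pow, Real.log_mul (by norm_num) hy0.ne'] at h1
  have h2 : Real.log y ≤ y ^ η / η := Real.log_le_rpow_div hy0.le hη
  have h3 := Real.log_two_gt_d9
  have h4 := Real.log_two_lt_d9
  have h5 : (1 : ℝ) ≤ y ^ η := Real.one_le_rpow hy hη.le
  have h6 : (e : ℝ) * (1 / 2) ≤ e * Real.log 2 :=
    mul_le_mul_of_nonneg_left (by linarith) (by positivity)
  have h7 : (b : ℝ) * (Real.log 2 + Real.log y) ≤ b * ((1 + 1 / η) * y ^ η) := by
    refine mul_le_mul_of_nonneg_left ?_ (by positivity)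
    rw [add_mul, one_div_mul_eq_div]
    linarith
  linarith

/-- `z` plays the role of the cube root of n. The argument `4 * σ + 2` is at most `10 * z`, which
gives the factor 1000, and `ε ≤ 1` lets the oracle's time exponent cover the quadratic terms. -/
theorem searchTime_le {z C ε : ℝ} {σ τ : ℕ} (hz : 1 ≤ z) (hε : 0 < ε) (hε1 : ε ≤ 1) (hC : 0 ≤ C)
    (hσ : (σ : ℝ) ≤ 2 * z) (hτ : (τ : ℝ) ≤ C * (4 * σ + 2) ^ (3 - ε)) :
    (searchTime σ τ : ℝ) ≤ (10000 + 1000 * C) * z ^ (3 - ε) := by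
  have hz0 : 0 < z := by linarith
  have h1 : (4 * (σ : ℝ) + 2) ^ (3 - ε) ≤ 1000 * z ^ (3 - ε) := by
    calc (4 * (σ : ℝ) + 2) ^ (3 - ε) ≤ (10 * z) ^ (3 - ε) :=
          Real.rpow_le_rpow (by positivity) (by linarith) (by linarith)
      _ = 10 ^ (3 - ε) * z ^ (3 - ε) := Real.mul_rpow (by norm_num) hz0.le
      _ ≤ 1000 * z ^ (3 - ε) := by
          refine mul_le_mul_of_nonneg_right ?_ (by positivity)
          calc (10 : ℝ) ^ (3 - ε) ≤ 10 ^ (3 : ℝ) :=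
                Real.rpow_le_rpow_of_exponent_le (by norm_num) (by linarith)
            _ = 1000 := by norm_num
  have h2 : z ^ 2 ≤ z ^ (3 - ε) := by
    rw [← Real.rpow_two]
    exact Real.rpow_le_rpow_of_exponent_le hz (by linarith)
  have h3 : (1 : ℝ) ≤ z ^ 2 := one_le_pow₀ hz
  have h4 : (τ : ℝ) ≤ 1000 * C * z ^ (3 - ε) := by
    calc (τ : ℝ) ≤ C * (4 * σ + 2) ^ (3 - ε) := hτ
      _ ≤ C * (1000 * z ^ (3 - ε)) := mul_le_mul_of_nonneg_left h1 hC
      _ = 1000 * C * z ^ (3 - ε) := by ring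
  have h5 : (4 * (σ : ℝ) + 1) * (4 * σ + 1) ≤ 81 * z ^ 2 := by
    calc (4 * (σ : ℝ) + 1) * (4 * σ + 1) ≤ (9 * z) * (9 * z) := by gcongr <;> linarith
      _ = 81 * z ^ 2 := by ring
  have h6 : (σ : ℝ) * σ ≤ 4 * z ^ 2 := by
    calc (σ : ℝ) * σ ≤ (2 * z) * (2 * z) := by gcongr
      _ = 4 * z ^ 2 := by ring
  simp only [searchTime]
  push_cast
  linarith

theorem squareTime_le {y C ε : ℝ} {σ τ f : ℕ} (hy : 1 ≤ y) (hε : 0 < ε) (hε1 : ε ≤ 1) (hC : 0 ≤ C)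
    (hσ : (σ : ℝ) ^ 3 ≤ 8 * y) (hτ : (τ : ℝ) ≤ C * (4 * σ + 2) ^ (3 - ε)) :
    (squareTime σ τ f : ℝ) ≤
      (f + 1) * (192 * (10000 + 1000 * C) + 7000) * y ^ (3 - ε / 3) := by
  have hy0 : 0 ≤ y := by linarith
  set z : ℝ := y ^ (1 / 3 : ℝ) with hz
  have hz1 : 1 ≤ z := Real.one_le_rpow hy (by norm_num)
  have hz3 : z ^ 3 = y := by
    rw [hz, ← Real.rpow_natCast, ← Real.rpow_mul hy0]; norm_num
  have hσz : (σ : ℝ) ≤ 2 * z := by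
    refine le_of_pow_le_pow_left₀ (n := 3) (by norm_num) (by positivity) ?_
    rw [mul_pow, hz3]; linarith
  have h1 := searchTime_le hz1 hε hε1 hC hσz hτ
  -- One search takes `z ^ (3 - ε)` with `z ^ 3 = y`, and a phase makes about `y ^ 2` searches: this
  -- is where the saving ε turns into ε / 3.
  have h2 : z ^ (3 - ε) * y ^ 2 = y ^ (3 - ε / 3) := by
    rw [hz, ← Real.rpow_mul hy0, ← Real.rpow_two, ← Real.rpow_add (by linarith)]
    congr 1; ring
  have h3 : y ^ 2 ≤ y ^ (3 - ε / 3) := by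
    rw [← Real.rpow_two]
    exact Real.rpow_le_rpow_of_exponent_le hy (by linarith)
  have h4 : (1 : ℝ) ≤ y ^ 2 := one_le_pow₀ hy
  have h5 : (σ : ℝ) ^ 3 * σ ^ 3 ≤ 64 * y ^ 2 := by
    calc (σ : ℝ) ^ 3 * σ ^ 3 ≤ (8 * y) * (8 * y) := by gcongr
      _ = 64 * y ^ 2 := by ring
  have h6 : (searchTime σ τ : ℝ) * (σ ^ 3 * σ ^ 3) ≤
      64 * (10000 + 1000 * C) * y ^ (3 - ε / 3) := by
    calc (searchTime σ τ : ℝ) * (σ ^ 3 * σ ^ 3) ≤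
        ((10000 + 1000 * C) * z ^ (3 - ε)) * (64 * y ^ 2) := by gcongr
      _ = 64 * (10000 + 1000 * C) * (z ^ (3 - ε) * y ^ 2) := by ring
      _ = _ := by rw [h2]
  have h7 : 3 * (searchTime σ τ : ℝ) * (σ ^ 3 * σ ^ 3) + 60 * (σ ^ 3 * σ ^ 3) + 20 ≤
      (192 * (10000 + 1000 * C) + 3860) * y ^ (3 - ε / 3) := by linarith
  have h8 : 40 * ((σ : ℝ) ^ 3 * σ ^ 3) + 30 ≤ (f + 1) * (2590 * y ^ (3 - ε / 3)) := by
    have : 0 ≤ (f : ℝ) * (2590 * y ^ (3 - ε / 3)) := by positivity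
    linarith
  have h9 : (f + 1 : ℝ) * (3 * (searchTime σ τ : ℝ) * (σ ^ 3 * σ ^ 3) + 60 * (σ ^ 3 * σ ^ 3) + 20) ≤
      (f + 1) * ((192 * (10000 + 1000 * C) + 3860) * y ^ (3 - ε / 3)) :=
    mul_le_mul_of_nonneg_left h7 (by positivity)
  have h10 : 0 ≤ (f + 1 : ℝ) * (550 * y ^ (3 - ε / 3)) := by positivity
  simp only [squareTime]
  push_cast
  linarith

/-- The factors `e` and `f`, for squarings and phases, are each at most a multiple of `y ^ (ε /
12)`. They spend half of the saving ε / 3 and leave ε / 6. -/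
theorem apsp_time_le {y C ε : ℝ} {n σ τ e f b t : ℕ} (hy : (n : ℝ) + 1 = y) (hε : 0 < ε)
    (hε1 : ε ≤ 1) (hC : 0 ≤ C) (hσ : σ ^ 3 ≤ 8 * n)
    (hτ : (τ : ℝ) ≤ C * (4 * σ + 2) ^ (3 - ε)) (he : (2 : ℝ) ^ e ≤ (2 * y) ^ b)
    (hf : (2 : ℝ) ^ f ≤ (2 * y) ^ b)
    (ht : t ≤ 12 * n + 80 * (n * n) + 12 * e + 12 * f + 70 * (σ ^ 3 * σ ^ 3) +
      e * (squareTime σ τ f + 8) + 150) {L K : ℝ} (hL : L = 2 * b * (1 + 1 / (ε / 12)))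
    (hK : K = 192 * (10000 + 1000 * C) + 7000) :
    (t : ℝ) ≤ (5000 + 24 * L + L * ((L + 1) * K + 8)) * y ^ (3 - ε / 6) := by
  have hn0 : (0 : ℝ) ≤ n := by positivity
  have hy1 : 1 ≤ y := by linarith
  have hL0 : 0 ≤ L := by rw [hL]; positivity
  have hK0 : 0 ≤ K := by rw [hK]; positivity
  have hσ' : (σ : ℝ) ^ 3 ≤ 8 * y := by
    have : (σ : ℝ) ^ 3 ≤ 8 * n := by exact_mod_cast hσ
    linarith
  have h1 := natCast_le_mul_rpow hy1 (by positivity : 0 < ε / 12) he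
  have h2 := natCast_le_mul_rpow hy1 (by positivity : 0 < ε / 12) hf
  have h3 := squareTime_le (f := f) hy1 hε hε1 hC hσ' hτ
  rw [← hL] at h1 h2
  rw [← hK] at h3
  set g := y ^ (ε / 12) with hg
  have hg1 : 1 ≤ g := Real.one_le_rpow hy1 (by positivity)
  have e1 : g * g * y ^ (3 - ε / 3) = y ^ (3 - ε / 6) := by
    rw [hg, ← Real.rpow_add (by linarith), ← Real.rpow_add (by linarith)]
    congr 1; ring
  have e2 : g ≤ y ^ (3 - ε / 6) := Real.rpow_le_rpow_of_exponent_le hy1 (by linarith)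
  have e3 : y ^ 2 ≤ y ^ (3 - ε / 6) := by
    rw [← Real.rpow_two]
    exact Real.rpow_le_rpow_of_exponent_le hy1 (by linarith)
  have e4 : y ≤ y ^ 2 := by nlinarith
  have e5 : (n : ℝ) * n ≤ y ^ 2 := by rw [← hy]; nlinarith
  have e6 : (σ : ℝ) ^ 3 * σ ^ 3 ≤ 64 * y ^ 2 := by
    calc (σ : ℝ) ^ 3 * σ ^ 3 ≤ (8 * y) * (8 * y) := by gcongr
      _ = 64 * y ^ 2 := by ring
  have e7 : L * g ≤ L * y ^ (3 - ε / 6) := mul_le_mul_of_nonneg_left e2 hL0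
  have e8 : (e : ℝ) * (squareTime σ τ f + 8) ≤ L * ((L + 1) * K + 8) * y ^ (3 - ε / 6) := by
    have k1 : (f : ℝ) + 1 ≤ (L + 1) * g := by linarith
    have k2 : (squareTime σ τ f : ℝ) ≤ (L + 1) * g * K * y ^ (3 - ε / 3) := h3.trans (by gcongr)
    calc (e : ℝ) * (squareTime σ τ f + 8) ≤ (L * g) * ((L + 1) * g * K * y ^ (3 - ε / 3) + 8) := by
          gcongr
      _ = L * (L + 1) * K * (g * g * y ^ (3 - ε / 3)) + 8 * (L * g) := by ring
      _ ≤ L * (L + 1) * K * y ^ (3 - ε / 6) + 8 * (L * y ^ (3 - ε / 6)) := by rw [e1]; gcongr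
      _ = _ := by ring
  have ht' : (t : ℝ) ≤ 12 * n + 80 * (n * n) + 12 * e + 12 * f + 70 * (σ ^ 3 * σ ^ 3) +
      e * (squareTime σ τ f + 8) + 150 := by exact_mod_cast ht
  have h0 : (1 : ℝ) ≤ y ^ 2 := one_le_pow₀ hy1
  linarith

/-- With `x = n + 2`, the sum of squares is at most `x ^ (2 * c + 2)`, and the two factors `2 * n +
1` together with the small constants raise the exponent to `2 * c + 8`. The outer constants are
covered by `2 ^ 7 ≤ x ^ 7`. -/
theorem apsp_weights_le {n M c x b : ℕ} (hxn : x = n + 2) (hM : M ≤ x ^ c) (hb : b = 2 * c + 15) :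
    8 ≤ x ^ b ∧ M ≤ x ^ b ∧ 2 * n + 1 ≤ x ^ b ∧ 64 * (n + 1) * (n + 1) ≤ x ^ b ∧
    12 * (2 * ((2 * n + 1) * (2 * ((2 * n + 1) * (n * n * (M * M))) + 1) + 1) + 1) ≤ x ^ b := by
  have hx2 : 2 ≤ x := by omega
  have hge : ∀ j k l, l = j + k → 2 ^ j * x ^ k ≤ x ^ l := by
    rintro j k _ rfl
    rw [pow_add]
    exact Nat.mul_le_mul_right _ (Nat.pow_le_pow_left hx2 j)
  have hpos : ∀ k, 1 ≤ x ^ k := fun k => Nat.one_le_pow _ _ (by omega)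
  have hmono : ∀ k, k ≤ b → x ^ k ≤ x ^ b := fun k hk => Nat.pow_le_pow_right (by omega) hk
  have hdn : 2 * n + 1 ≤ x ^ 2 := by rw [hxn]; nlinarith
  have hD : n * n * (M * M) ≤ x ^ (2 * c + 2) := by
    calc n * n * (M * M) ≤ x * x * (x ^ c * x ^ c) := by gcongr <;> omega
      _ = x ^ (2 * c + 2) := by ring
  obtain ⟨P, hP⟩ : ∃ P, P = (2 * n + 1) * (n * n * (M * M)) := ⟨_, rfl⟩
  obtain ⟨Y, hY⟩ : ∃ Y, Y = (2 * n + 1) * (2 * P + 1) := ⟨_, rfl⟩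
  have hP' : P ≤ x ^ (2 * c + 4) := by
    rw [hP, show 2 * c + 4 = 2 + (2 * c + 2) by ring, pow_add]
    exact Nat.mul_le_mul hdn hD
  have hY' : Y ≤ x ^ (2 * c + 8) := by
    rw [hY, show 2 * c + 8 = 2 + (2 * c + 6) by ring, pow_add]
    refine Nat.mul_le_mul hdn ?_
    have h1 := hge 2 (2 * c + 4) (2 * c + 6) (by ring)
    have h2 := hpos (2 * c + 4)
    omega
  have h64 : 64 * (n + 1) * (n + 1) ≤ x ^ 8 := by
    calc 64 * (n + 1) * (n + 1) ≤ 2 ^ 6 * x * x := by gcongr <;> omega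
      _ ≤ x ^ 6 * x * x := by gcongr
      _ = x ^ 8 := by ring
  refine ⟨?_, hM.trans (hmono c (by omega)), hdn.trans (hmono 2 (by omega)),
    h64.trans (hmono 8 (by omega)), ?_⟩
  · exact le_trans (Nat.pow_le_pow_left hx2 3) (hmono 3 (by omega))
  · rw [← hP, ← hY]
    have h1 := hge 7 (2 * c + 8) b (by rw [hb]; ring)
    have h2 := hpos (2 * c + 8)
    omega

/-- All-pairs shortest paths reduces to CoDiameter. -/
theorem APSP_reducible_coDiameter : SubcubicReducible APSP CoDiameter := by
  refine ⟨apspProg, fun c => ⟨(2 * c + 15) * 40, fun T hT => ?_⟩⟩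
  obtain ⟨b, hb⟩ : ∃ b, b = 2 * c + 15 := ⟨_, rfl⟩
  rw [← hb]
  -- The oracle sees graphs with only about the cube root of n vertices, but with weights up to `(n
  -- + 2) ^ b`. In terms of their own size the exponent of the weights is three times as large.
  obtain ⟨ε₀, hε₀, C, hC⟩ := hT (3 * b)
  obtain ⟨ε, hε⟩ : ∃ ε, ε = min ε₀ 1 := ⟨_, rfl⟩
  have hε0 : 0 < ε := by rw [hε]; positivity
  have hε1 : ε ≤ 1 := hε ▸ min_le_right _ _
  have hεε : ε ≤ ε₀ := hε ▸ min_le_left _ _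
  obtain ⟨L, hL⟩ : ∃ L : ℝ, L = 2 * b * (1 + 1 / (ε / 12)) := ⟨_, rfl⟩
  obtain ⟨K, hK⟩ : ∃ K : ℝ, K = 192 * (10000 + 1000 * |C|) + 7000 := ⟨_, rfl⟩
  refine ⟨ε / 6, by positivity, 5000 + 24 * L + L * ((L + 1) * K + 8), fun O hO x hx a ha => ?_⟩
  obtain ⟨G, hG⟩ := x
  obtain ⟨b1, b2, b3, b4, b5⟩ := apsp_weights_le rfl (show G.maxWeight ≤ (G.n + 2) ^ c from hx) hb
  -- The base is the number of vertices `4 * σ + 1` plus the one from the definition of a truly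
  -- subcubic bound; rounding down is harmless because `T` takes natural values.
  obtain ⟨τ, hτ⟩ : ∃ τ : ℕ → ℕ, ∀ σ, τ σ = ⌊|C| * (4 * (σ : ℝ) + 2) ^ (3 - ε)⌋₊ :=
    ⟨_, fun _ => rfl⟩
  have hTτ : ∀ σ M, G.n ≤ σ ^ 3 → M ≤ (G.n + 2) ^ b → T (4 * σ + 1) M ≤ τ σ := by
    intro σ M hσ hM
    rw [hτ]
    refine Nat.le_floor ?_
    have h1 : G.n + 2 ≤ (4 * σ + 1 + 2) ^ 3 := by
      nlinarith [Nat.zero_le (σ ^ 3), Nat.zero_le (σ ^ 2)]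
    have h2 := hC (4 * σ + 1) M (hM.trans (by rw [pow_mul]; exact Nat.pow_le_pow_left h1 b))
    push_cast at h2
    rw [add_assoc, one_add_one_eq_two] at h2
    refine h2.trans (mul_le_mul (le_abs_self C) ?_ (by positivity) (abs_nonneg C))
    exact Real.rpow_le_rpow_of_exponent_le (by linarith [(by positivity : (0 : ℝ) ≤ σ)])
      (by linarith)
  obtain ⟨B, hB⟩ : ∃ B, B = (G.n + 2) ^ b := ⟨_, rfl⟩
  rw [← hB] at b1 b2 b3 b4 b5 hTτ
  have hW : B ^ 40 ≤ (G.n + 2) ^ (b * 40) := by rw [hB, pow_mul]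
  obtain ⟨s, t, h1, -, -, h2, σ, e, f, hσ, he, hf, ht⟩ :=
    apspProg_wp b1 hW hO G hG hTτ ha b2 b4 b5 (State.start_bounded _ a)
  refine ⟨s, t, h1, h2, ?_⟩
  change (t : ℝ) ≤ _ * ((G.n : ℝ) + 1) ^ (3 - ε / 6)
  have hcast : ∀ k : ℕ, 2 ^ k ≤ B → (2 : ℝ) ^ k ≤ (2 * ((G.n : ℝ) + 1)) ^ b := by
    intro k hk
    rw [hB] at hk
    have h3 : (2 : ℝ) ^ k ≤ ((G.n : ℝ) + 2) ^ b := by exact_mod_cast hk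
    refine h3.trans (pow_le_pow_left₀ (by positivity) ?_ _)
    linarith [(by positivity : (0 : ℝ) ≤ G.n)]
  exact apsp_time_le rfl hε0 hε1 (abs_nonneg C) hσ
    (by rw [hτ]; exact Nat.floor_le (by positivity)) (hcast e (he.trans b3)) (hcast f hf) ht hL hK

end FineGrained

theorem theorem1p1 :
    FineGrained.SubcubicEquivalent FineGrained.APSP FineGrained.CoDiameter :=
  ⟨FineGrained.APSP_reducible_coDiameter, FineGrained.coDiameter_reducible_APSP⟩
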